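/- Let $n\ge 2$, $\mathbb{Y}^{n+1}=\mathbb{S}^{n-1}\times\mathbb{R}\times(0,\infty)$ with points $(\mathbf u,b,a)$. Let $\mathcal{S}_0(\mathbb{R}^d)$ be the space of Schwartz functions $\phi$ on $\mathbb{R}^d$ with $\int_{\mathbb{R}^d}\mathbf x^m\phi(\mathbf x)\,d\mathbf x=0$ for all $m\in\mathbb{N}_0^d$, with the topology induced by $\mathcal{S}(\mathbb{R}^d)$. Let $\mathcal{S}(\mathbb{Y}^{n+1})$ be the space of all $\Phi\in C^\infty(\mathbb{Y}^{n+1})$ such that $$\rho^{l,m,k}_{s,r}(\Phi)=\sup_{(\mathbf u,b,a)\in\mathbb{Y}^{n+1}}\Big(a^s+\frac1{a^s}\Big)(1+b^2)^{r/2}\,\big|\partial_a^l\,\partial_b^m\,\triangle_{\mathbf u}^k\Phi(\mathbf u,b,a)\big|<\infty\qquad\text{for all }l,m,k,s,r\in\mathbb{N}_0,$$ where $\triangle_{\mathbf u}$ is the Laplace–Beltrami operator of $\mathbb{S}^{n-1}$, with the locally convex topology defined by these seminorms. The (continuous) duals $\mathcal{S}_0'(\mathbb{R}^n)$ and $\mathcal{S}'(\mathbb{Y}^{n+1})$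 carry the strong dual topologies. For $\psi\in\mathcal{S}_0(\mathbb{R})$ put $\psi_{\mathbf u,b,a}(\mathbf x)=\frac1a\psi\big(\frac{\mathbf x\cdot\mathbf u-b}{a}\big)$ and, for $\phi\in\mathcal{S}_0(\mathbb{R}^n)$ and $\Phi\in\mathcal{S}(\mathbb{Y}^{n+1})$, $$\mathcal{R}_\psi\phi(\mathbf u,b,a)=\int_{\mathbb{R}^n}\phi(\mathbf x)\,\overline{\psi_{\mathbf u,b,a}(\mathbf x)}\,d\mathbf x,\qquad \mathcal{R}^t_\psi\Phi(\mathbf x)=\int_{\mathbb{S}^{n-1}}\int_0^\infty\int_{-\infty}^\infty\Phi(\mathbf u,b,a)\,\psi_{\mathbf u,b,a}(\mathbf x)\,\frac{db\,da\,d\mathbf u}{a^n},$$ where $d\mathbf u$ is the surface measure on $\mathbb{S}^{n-1}$. **Proposition.** Let $\psi\in\mathcal{S}_0(\mathbb{R})$. Then $\mathcal{R}^t_{\overline\psi}\Phi\in\mathcal{S}_0(\mathbb{R}^n)$ for every $\Phi\in\mathcal{S}(\mathbb{Y}^{n+1})$ and $\mathcal{R}_{\overline\psi}\phi\in\mathcal{S}(\mathbb{Y}^{n+1})$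 for every $\phi\in\mathcal{S}_0(\mathbb{R}^n)$. The ridgelet transform $\mathcal{R}_\psi:\mathcal{S}_0'(\mathbb{R}^n)\to\mathcal{S}'(\mathbb{Y}^{n+1})$, defined by $$\langle\mathcal{R}_\psi f,\Phi\rangle=\langle f,\mathcal{R}^t_{\overline\psi}\Phi\rangle,\qquad f\in\mathcal{S}_0'(\mathbb{R}^n),\ \Phi\in\mathcal{S}(\mathbb{Y}^{n+1}),$$ and the ridgelet synthesis operator $\mathcal{R}^t_\psi:\mathcal{S}'(\mathbb{Y}^{n+1})\to\mathcal{S}_0'(\mathbb{R}^n)$, defined by $$\langle\mathcal{R}^t_\psi F,\phi\rangle=\langle F,\mathcal{R}_{\overline\psi}\phi\rangle,\qquad F\in\mathcal{S}'(\mathbb{Y}^{n+1}),\ \phi\in\mathcal{S}_0(\mathbb{R}^n),$$ are well-defined continuous linear maps. -/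

import Mathlib

open MeasureTheory Metric Set
open scoped SchwartzMap ContDiff

noncomputable section

namespace Ridgelet

/-- Euclidean space `ℝⁿ`. -/
abbrev E (n : ℕ) : Type := EuclideanSpace ℝ (Fin n)

/-! ### The Lizorkin spaces -/

lemma integrable_monomial_mul (n : ℕ) (m : Fin n → ℕ) (φ : 𝓢(E n, ℂ)) :
    Integrable (fun x : E n => (∏ i, (x i : ℂ) ^ m i) * φ x) := by
  refine (φ.integrable_pow_mul volume (∑ i, m i)).mono' ?_ ?_
  · exact (Continuous.mul (by fun_prop) φ.continuous).aestronglyMeasurable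
  · refine Filter.Eventually.of_forall fun x => ?_
    rw [norm_mul, norm_prod, ← Finset.prod_pow_eq_pow_sum]
    gcongr with i
    rw [norm_pow, Complex.norm_real]
    gcongr
    exact PiLp.norm_apply_le x i

lemma integrable_pow_mul (k : ℕ) (ψ : 𝓢(ℝ, ℂ)) :
    Integrable (fun x : ℝ => (x : ℂ) ^ k * ψ x) := by
  refine (ψ.integrable_pow_mul volume k).mono' ?_ ?_
  · exact (Continuous.mul (by fun_prop) ψ.continuous).aestronglyMeasurable
  · refine Filter.Eventually.of_forall fun x => ?_
    simp

/-- The Lizorkin test function space `𝓢₀(ℝⁿ)`: the Schwartz functions all of whose moments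
`∫ x^m φ(x) dx` (`m` a multi-index) vanish. As a subspace of `𝓢(ℝⁿ)` it carries the subspace
topology. -/
def lizorkin (n : ℕ) : Submodule ℂ 𝓢(E n, ℂ) where
  carrier := {φ | ∀ m : Fin n → ℕ, ∫ x : E n, (∏ i, (x i : ℂ) ^ m i) * φ x = 0}
  zero_mem' := fun m => by simp
  add_mem' := fun {φ φ'} h h' m => by
    have := integral_add (integrable_monomial_mul n m φ) (integrable_monomial_mul n m φ')
    rw [h m, h' m, add_zero] at this
    simpa [mul_add] using this
  smul_mem' := fun c φ h m => by
    have := integral_const_mul c (fun x : E n => (∏ i, (x i : ℂ) ^ m i) * φ x) (μ := volume)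
    rw [h m, mul_zero] at this
    simpa [mul_left_comm] using this

/-- The one-dimensional Lizorkin space `𝓢₀(ℝ)`. -/
def lizorkinReal : Submodule ℂ 𝓢(ℝ, ℂ) where
  carrier := {ψ | ∀ k : ℕ, ∫ x : ℝ, (x : ℂ) ^ k * ψ x = 0}
  zero_mem' := fun m => by simp
  add_mem' := fun {φ φ'} h h' m => by
    have := integral_add (integrable_pow_mul m φ) (integrable_pow_mul m φ')
    rw [h m, h' m, add_zero] at this
    simpa [mul_add] using this
  smul_mem' := fun c φ h m => by
    have := integral_const_mul c (fun x : ℝ => (x : ℂ) ^ m * φ x) (μ := volume)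
    rw [h m, mul_zero] at this
    simpa [mul_left_comm] using this

/-! ### Smooth functions on `𝕐ⁿ⁺¹` -/

/-- `𝕐ⁿ⁺¹ = 𝕊ⁿ⁻¹ × ℝ × ℝ₊`, with points `(u, b, a)`. -/
abbrev Y (n : ℕ) : Type := sphere (0 : E n) 1 × ℝ × Ioi (0 : ℝ)

/-- The open set `(ℝⁿ ∖ {0}) × ℝ × ℝ₊`, of which `𝕐ⁿ⁺¹` is a closed submanifold. -/
def Omega (n : ℕ) : Set (E n × ℝ × ℝ) := {p | p.1 ≠ 0 ∧ 0 < p.2.2}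

/-- The smooth retraction `(x, b, a) ↦ (x / ‖x‖, b, a)` of `(ℝⁿ ∖ {0}) × ℝ × ℝ₊` onto `𝕐ⁿ⁺¹`. -/
def retract {n : ℕ} (p : E n × ℝ × ℝ) (hp : p ∈ Omega n) : Y n :=
  (⟨‖p.1‖⁻¹ • p.1, by
    rw [mem_sphere_zero_iff_norm, norm_smul, norm_inv, norm_norm]
    exact inv_mul_cancel₀ (norm_ne_zero_iff.2 hp.1)⟩, p.2.1, ⟨p.2.2, hp.2⟩)

open Classical in
/-- The extension of a function on `𝕐ⁿ⁺¹` to `(ℝⁿ ∖ {0}) × ℝ × ℝ₊` that is constant along the rays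
from the origin of `ℝⁿ`, i.e. `(x, b, a) ↦ Φ (x / ‖x‖, b, a)` (with value `0` off that open set). -/
def rayExt {n : ℕ} (Φ : Y n → ℂ) (p : E n × ℝ × ℝ) : ℂ :=
  if hp : p ∈ Omega n then Φ (retract p hp) else 0

/-- `Φ ∈ C^∞(𝕐ⁿ⁺¹)`. A function on the submanifold `𝕐ⁿ⁺¹` is smooth iff its composition with the
smooth retraction onto `𝕐ⁿ⁺¹` is smooth on the open set on which the retraction lives. -/
def SmoothY {n : ℕ} (Φ : Y n → ℂ) : Prop := ContDiffOn ℝ ∞ (rayExt Φ) (Omega n)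

/-- The partial derivative `∂/∂a`. -/
def dA {n : ℕ} (Φ : Y n → ℂ) : Y n → ℂ :=
  fun y => deriv (fun t : ℝ => rayExt Φ ((y.1 : E n), y.2.1, t)) (y.2.2 : ℝ)

/-- The partial derivative `∂/∂b`. -/
def dB {n : ℕ} (Φ : Y n → ℂ) : Y n → ℂ :=
  fun y => deriv (fun t : ℝ => rayExt Φ ((y.1 : E n), t, (y.2.2 : ℝ))) y.2.1

/-- The Laplace–Beltrami operator of the unit sphere, acting on the variable `u`: on the sphere it
is the Euclidean Laplacian of the extension that is constant along rays, `x ↦ f (x / ‖x‖)`. -/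
def lapU {n : ℕ} (Φ : Y n → ℂ) : Y n → ℂ :=
  fun y => Laplacian.laplacian (fun x : E n => rayExt Φ (x, y.2.1, (y.2.2 : ℝ))) (y.1 : E n)

/-- The differential operator `∂_a^l ∂_b^m Δ_u^k`. -/
def diffOp {n : ℕ} (l m k : ℕ) (Φ : Y n → ℂ) : Y n → ℂ :=
  dA^[l] (dB^[m] (lapU^[k] Φ))

/-- The quantity `(a^s + 1/a^s) (1 + b²)^{r/2} |∂_a^l ∂_b^m Δ_u^k Φ(u, b, a)|`. -/
def weighted {n : ℕ} (s r l m k : ℕ) (Φ : Y n → ℂ) (y : Y n) : ℝ :=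
  ((y.2.2 : ℝ) ^ s + 1 / (y.2.2 : ℝ) ^ s) * (1 + y.2.1 ^ 2) ^ ((r : ℝ) / 2) *
    ‖diffOp l m k Φ y‖

/-! Linearity of these operators on smooth functions, which is needed to see that the space below
is a vector space and that the suprema of `weighted` are seminorms. -/

lemma isOpen_Omega (n : ℕ) : IsOpen (Omega n) := by
  have h1 : IsOpen {p : E n × ℝ × ℝ | p.1 ≠ 0} := isOpen_ne_fun continuous_fst continuous_const
  have h2 : IsOpen {p : E n × ℝ × ℝ | 0 < p.2.2} :=
    isOpen_lt continuous_const (continuous_snd.comp continuous_snd)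
  exact h1.inter h2

/-- The inclusion of `𝕐ⁿ⁺¹` in `ℝⁿ × ℝ × ℝ`. -/
def incl {n : ℕ} (y : Y n) : E n × ℝ × ℝ := ((y.1 : E n), y.2.1, (y.2.2 : ℝ))

lemma incl_mem {n : ℕ} (y : Y n) : incl y ∈ Omega n :=
  ⟨ne_zero_of_mem_unit_sphere y.1, y.2.2.2⟩

lemma rayExt_add {n : ℕ} (Φ Ψ : Y n → ℂ) : rayExt (Φ + Ψ) = rayExt Φ + rayExt Ψ := by
  funext p
  by_cases hp : p ∈ Omega n <;> simp [rayExt, hp]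

lemma rayExt_smul {n : ℕ} (c : ℂ) (Φ : Y n → ℂ) : rayExt (c • Φ) = c • rayExt Φ := by
  funext p
  by_cases hp : p ∈ Omega n <;> simp [rayExt, hp]

lemma rayExt_zero {n : ℕ} : rayExt (0 : Y n → ℂ) = 0 := by
  funext p
  by_cases hp : p ∈ Omega n <;> simp [rayExt, hp]

/-- The retraction, with values in the ambient space. -/
def ret {n : ℕ} (p : E n × ℝ × ℝ) : E n × ℝ × ℝ := (‖p.1‖⁻¹ • p.1, p.2)

lemma incl_retract {n : ℕ} (p : E n × ℝ × ℝ) (hp : p ∈ Omega n) : incl (retract p hp) = ret p :=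
  rfl

lemma ret_mem {n : ℕ} {p : E n × ℝ × ℝ} (hp : p ∈ Omega n) : ret p ∈ Omega n :=
  incl_retract p hp ▸ incl_mem _

lemma contDiffOn_ret (n : ℕ) : ContDiffOn ℝ ∞ (ret (n := n)) (Omega n) := by
  intro p hp
  have h1 : ContDiffAt ℝ ∞ (fun q : E n × ℝ × ℝ => ‖q.1‖⁻¹) p :=
    (contDiffAt_fst.norm ℝ hp.1).inv (norm_ne_zero_iff.2 hp.1)
  exact ((h1.smul contDiffAt_fst).prodMk contDiffAt_snd).contDiffWithinAt

lemma rayExt_ret {n : ℕ} (Φ : Y n → ℂ) {p : E n × ℝ × ℝ} (hp : p ∈ Omega n) :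
    rayExt Φ (ret p) = rayExt Φ p := by
  have h := ret_mem hp
  have hn : ‖p.1‖ ≠ 0 := norm_ne_zero_iff.2 hp.1
  have : retract (ret p) h = retract p hp := by
    refine Prod.ext (Subtype.ext ?_) rfl
    simp [retract, ret, norm_smul, hn]
  simp only [rayExt, hp, h, dif_pos, this]

lemma SmoothY.contDiffAt {n : ℕ} {Φ : Y n → ℂ} (h : SmoothY Φ) {p : E n × ℝ × ℝ}
    (hp : p ∈ Omega n) : ContDiffAt ℝ ∞ (rayExt Φ) p :=
  ContDiffOn.contDiffAt h ((isOpen_Omega n).mem_nhds hp)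

/-- An operator on functions on `𝕐ⁿ⁺¹` given by a smooth function on the ambient open set. -/
lemma smoothY_of {n : ℕ} {Ψ : Y n → ℂ} {G : E n × ℝ × ℝ → ℂ} (hG : ContDiffOn ℝ ∞ G (Omega n))
    (h : ∀ y, Ψ y = G (incl y)) : SmoothY Ψ := by
  refine (hG.comp (contDiffOn_ret n) fun p hp => ret_mem hp).congr fun p hp => ?_
  simp only [rayExt, hp, dif_pos, h, incl_retract, Function.comp]

lemma contDiffOn_dir {n : ℕ} {G : E n × ℝ × ℝ → ℂ} (hG : ContDiffOn ℝ ∞ G (Omega n))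
    (v : E n × ℝ × ℝ) : ContDiffOn ℝ ∞ (fun p => fderiv ℝ G p v) (Omega n) :=
  (hG.fderiv_of_isOpen (isOpen_Omega n) (by simp)).clm_apply contDiffOn_const

lemma hasDerivAt_lineA {n : ℕ} {G : E n × ℝ × ℝ → ℂ} (hG : ContDiffOn ℝ ∞ G (Omega n))
    {p : E n × ℝ × ℝ} (hp : p ∈ Omega n) :
    HasDerivAt (fun t : ℝ => G (p.1, p.2.1, t)) (fderiv ℝ G p (0, 0, 1)) p.2.2 := by
  have h1 : HasFDerivAt G (fderiv ℝ G p) p :=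
    ((hG.contDiffAt ((isOpen_Omega n).mem_nhds hp)).differentiableAt (by simp)).hasFDerivAt
  have h2 : HasDerivAt (fun t : ℝ => (p.1, p.2.1, t)) ((0 : E n), (0 : ℝ), (1 : ℝ)) p.2.2 :=
    (hasDerivAt_const _ _).prodMk ((hasDerivAt_const _ _).prodMk (hasDerivAt_id _))
  exact HasFDerivAt.comp_hasDerivAt (f := fun t : ℝ => (p.1, p.2.1, t)) p.2.2 h1 h2

lemma hasDerivAt_lineB {n : ℕ} {G : E n × ℝ × ℝ → ℂ} (hG : ContDiffOn ℝ ∞ G (Omega n))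
    {p : E n × ℝ × ℝ} (hp : p ∈ Omega n) :
    HasDerivAt (fun t : ℝ => G (p.1, t, p.2.2)) (fderiv ℝ G p (0, 1, 0)) p.2.1 := by
  have h1 : HasFDerivAt G (fderiv ℝ G p) p :=
    ((hG.contDiffAt ((isOpen_Omega n).mem_nhds hp)).differentiableAt (by simp)).hasFDerivAt
  have h2 : HasDerivAt (fun t : ℝ => (p.1, t, p.2.2)) ((0 : E n), (1 : ℝ), (0 : ℝ)) p.2.1 :=
    (hasDerivAt_const _ _).prodMk ((hasDerivAt_id _).prodMk (hasDerivAt_const _ _))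
  exact HasFDerivAt.comp_hasDerivAt (f := fun t : ℝ => (p.1, t, p.2.2)) p.2.1 h1 h2

lemma hasFDerivAt_slice {n : ℕ} {G : E n × ℝ × ℝ → ℂ} (hG : ContDiffOn ℝ ∞ G (Omega n))
    {x : E n} {q : ℝ × ℝ} (hp : (x, q) ∈ Omega n) :
    HasFDerivAt (fun z : E n => G (z, q))
      ((fderiv ℝ G (x, q)).comp (ContinuousLinearMap.inl ℝ (E n) (ℝ × ℝ))) x := by
  have h1 : HasFDerivAt G (fderiv ℝ G (x, q)) (x, q) :=
    ((hG.contDiffAt ((isOpen_Omega n).mem_nhds hp)).differentiableAt (by simp)).hasFDerivAt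
  exact HasFDerivAt.comp (f := fun z : E n => (z, q)) x h1 (hasFDerivAt_prodMk_left x q)

lemma laplacian_slice {n : ℕ} {G : E n × ℝ × ℝ → ℂ} (hG : ContDiffOn ℝ ∞ G (Omega n))
    {x : E n} {q : ℝ × ℝ} (hp : (x, q) ∈ Omega n) :
    Laplacian.laplacian (fun z : E n => G (z, q)) x =
      ∑ i, fderiv ℝ (fun p => fderiv ℝ G p (stdOrthonormalBasis ℝ (E n) i, 0)) (x, q)
        (stdOrthonormalBasis ℝ (E n) i, 0) := by
  rw [InnerProductSpace.laplacian_eq_iteratedFDeriv_stdOrthonormalBasis]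
  refine Finset.sum_congr rfl fun i _ => ?_
  set v := stdOrthonormalBasis ℝ (E n) i
  rw [iteratedFDeriv_two_apply]
  have hev : ∀ᶠ z in nhds x, (z, q) ∈ Omega n :=
    (Continuous.prodMk continuous_id continuous_const).continuousAt.eventually
      ((isOpen_Omega n).mem_nhds hp)
  have hslice : ContDiffAt ℝ ∞ (fun z : E n => G (z, q)) x :=
    ContDiffAt.comp (f := fun z : E n => (z, q)) x
      (hG.contDiffAt ((isOpen_Omega n).mem_nhds hp)) (contDiffAt_id.prodMk contDiffAt_const)
  have hd : DifferentiableAt ℝ (fderiv ℝ (fun z : E n => G (z, q))) x :=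
    ((contDiffAt_infty.1 hslice 2).fderiv_right (m := 1) (by norm_num)).differentiableAt
      (by simp)
  have h1 : fderiv ℝ (fun z => fderiv ℝ (fun z : E n => G (z, q)) z v) x v =
      fderiv ℝ (fderiv ℝ (fun z : E n => G (z, q))) x v v := by
    rw [fderiv_clm_apply hd (differentiableAt_const _)]
    simp
  have h2 : (fun z => fderiv ℝ (fun z : E n => G (z, q)) z v) =ᶠ[nhds x]
      fun z => (fun p => fderiv ℝ G p (v, 0)) (z, q) := by
    filter_upwards [hev] with z hz
    rw [(hasFDerivAt_slice hG hz).fderiv]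
    simp
  have h3 := hasFDerivAt_slice (contDiffOn_dir hG (v, 0)) hp
  simp only [Matrix.cons_val_zero, Matrix.cons_val_one]
  rw [← h1, h2.fderiv_eq, h3.fderiv]
  simp

lemma SmoothY.dA {n : ℕ} {Φ : Y n → ℂ} (h : SmoothY Φ) : SmoothY (dA Φ) :=
  smoothY_of (contDiffOn_dir h (0, 0, 1)) fun y => (hasDerivAt_lineA h (incl_mem y)).deriv

lemma SmoothY.dB {n : ℕ} {Φ : Y n → ℂ} (h : SmoothY Φ) : SmoothY (dB Φ) :=
  smoothY_of (contDiffOn_dir h (0, 1, 0)) fun y => (hasDerivAt_lineB h (incl_mem y)).deriv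

lemma SmoothY.lapU {n : ℕ} {Φ : Y n → ℂ} (h : SmoothY Φ) : SmoothY (lapU Φ) :=
  smoothY_of
    (ContDiffOn.sum fun i _ => contDiffOn_dir
      (contDiffOn_dir h (stdOrthonormalBasis ℝ (E n) i, 0)) (stdOrthonormalBasis ℝ (E n) i, 0))
    fun y => laplacian_slice h (incl_mem y)

lemma SmoothY.zero {n : ℕ} : SmoothY (0 : Y n → ℂ) := by
  rw [SmoothY, rayExt_zero]; exact contDiffOn_const

lemma SmoothY.add {n : ℕ} {Φ Ψ : Y n → ℂ} (h : SmoothY Φ) (h' : SmoothY Ψ) : SmoothY (Φ + Ψ) := by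
  rw [SmoothY, rayExt_add]; exact ContDiffOn.add h h'

lemma SmoothY.smul {n : ℕ} {Φ : Y n → ℂ} (c : ℂ) (h : SmoothY Φ) : SmoothY (c • Φ) := by
  rw [SmoothY, rayExt_smul]; exact ContDiffOn.const_smul c h

lemma dA_add {n : ℕ} {Φ Ψ : Y n → ℂ} (h : SmoothY Φ) (h' : SmoothY Ψ) :
    dA (Φ + Ψ) = dA Φ + dA Ψ := by
  funext y
  have h1 := hasDerivAt_lineA h (incl_mem y)
  have h2 := hasDerivAt_lineA h' (incl_mem y)
  simp only [dA, rayExt_add, Pi.add_apply]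
  exact ((h1.add h2).deriv.trans (by rw [← h1.deriv, ← h2.deriv]; rfl))

lemma dB_add {n : ℕ} {Φ Ψ : Y n → ℂ} (h : SmoothY Φ) (h' : SmoothY Ψ) :
    dB (Φ + Ψ) = dB Φ + dB Ψ := by
  funext y
  have h1 := hasDerivAt_lineB h (incl_mem y)
  have h2 := hasDerivAt_lineB h' (incl_mem y)
  simp only [dB, rayExt_add, Pi.add_apply]
  exact ((h1.add h2).deriv.trans (by rw [← h1.deriv, ← h2.deriv]; rfl))

lemma SmoothY.contDiffAt_slice {n : ℕ} {Φ : Y n → ℂ} (h : SmoothY Φ) (y : Y n) :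
    ContDiffAt ℝ 2 (fun x : E n => rayExt Φ (x, y.2.1, (y.2.2 : ℝ))) (y.1 : E n) :=
  contDiffAt_infty.1 (ContDiffAt.comp (f := fun z : E n => (z, y.2.1, (y.2.2 : ℝ))) (y.1 : E n)
    (h.contDiffAt (incl_mem y)) (contDiffAt_id.prodMk contDiffAt_const)) 2

lemma lapU_add {n : ℕ} {Φ Ψ : Y n → ℂ} (h : SmoothY Φ) (h' : SmoothY Ψ) :
    lapU (Φ + Ψ) = lapU Φ + lapU Ψ := by
  funext y
  simp only [lapU, rayExt_add]
  exact ContDiffAt.laplacian_add (h.contDiffAt_slice y) (h'.contDiffAt_slice y)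

lemma dA_smul {n : ℕ} (c : ℂ) {Φ : Y n → ℂ} (h : SmoothY Φ) : dA (c • Φ) = c • dA Φ := by
  funext y
  simp only [dA, rayExt_smul, Pi.smul_apply]
  exact deriv_const_smul c (hasDerivAt_lineA h (incl_mem y)).differentiableAt

lemma dB_smul {n : ℕ} (c : ℂ) {Φ : Y n → ℂ} (h : SmoothY Φ) : dB (c • Φ) = c • dB Φ := by
  funext y
  simp only [dB, rayExt_smul, Pi.smul_apply]
  exact deriv_const_smul c (hasDerivAt_lineB h (incl_mem y)).differentiableAt

lemma lapU_smul {n : ℕ} (c : ℂ) {Φ : Y n → ℂ} (h : SmoothY Φ) : lapU (c • Φ) = c • lapU Φ := by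
  funext y
  simp only [lapU, rayExt_smul]
  exact InnerProductSpace.laplacian_smul c (h.contDiffAt_slice y)

/-- Iterates of an operator that is linear on smooth functions. -/
lemma iterate_linear {n : ℕ} {T : (Y n → ℂ) → (Y n → ℂ)} (hT : ∀ {Φ}, SmoothY Φ → SmoothY (T Φ))
    (hadd : ∀ {Φ Ψ}, SmoothY Φ → SmoothY Ψ → T (Φ + Ψ) = T Φ + T Ψ)
    (hsmul : ∀ (c : ℂ) {Φ}, SmoothY Φ → T (c • Φ) = c • T Φ) (j : ℕ) :
    (∀ {Φ}, SmoothY Φ → SmoothY (T^[j] Φ)) ∧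
    (∀ {Φ Ψ}, SmoothY Φ → SmoothY Ψ → T^[j] (Φ + Ψ) = T^[j] Φ + T^[j] Ψ) ∧
    (∀ (c : ℂ) {Φ}, SmoothY Φ → T^[j] (c • Φ) = c • T^[j] Φ) := by
  induction j with
  | zero => exact ⟨fun h => h, fun _ _ => rfl, fun _ _ _ => rfl⟩
  | succ j ih =>
    simp only [Function.iterate_succ_apply']
    refine ⟨fun h => hT (ih.1 h), fun h h' => ?_, fun c _ h => ?_⟩
    · rw [ih.2.1 h h', hadd (ih.1 h) (ih.1 h')]
    · rw [ih.2.2 c h, hsmul c (ih.1 h)]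

lemma iterate_dA {n : ℕ} (j : ℕ) :
    (∀ {Φ : Y n → ℂ}, SmoothY Φ → SmoothY (dA^[j] Φ)) ∧
    (∀ {Φ Ψ : Y n → ℂ}, SmoothY Φ → SmoothY Ψ → dA^[j] (Φ + Ψ) = dA^[j] Φ + dA^[j] Ψ) ∧
    (∀ (c : ℂ) {Φ : Y n → ℂ}, SmoothY Φ → dA^[j] (c • Φ) = c • dA^[j] Φ) :=
  iterate_linear SmoothY.dA dA_add dA_smul j

lemma iterate_dB {n : ℕ} (j : ℕ) :
    (∀ {Φ : Y n → ℂ}, SmoothY Φ → SmoothY (dB^[j] Φ)) ∧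
    (∀ {Φ Ψ : Y n → ℂ}, SmoothY Φ → SmoothY Ψ → dB^[j] (Φ + Ψ) = dB^[j] Φ + dB^[j] Ψ) ∧
    (∀ (c : ℂ) {Φ : Y n → ℂ}, SmoothY Φ → dB^[j] (c • Φ) = c • dB^[j] Φ) :=
  iterate_linear SmoothY.dB dB_add dB_smul j

lemma iterate_lapU {n : ℕ} (j : ℕ) :
    (∀ {Φ : Y n → ℂ}, SmoothY Φ → SmoothY (lapU^[j] Φ)) ∧
    (∀ {Φ Ψ : Y n → ℂ}, SmoothY Φ → SmoothY Ψ → lapU^[j] (Φ + Ψ) = lapU^[j] Φ + lapU^[j] Ψ) ∧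
    (∀ (c : ℂ) {Φ : Y n → ℂ}, SmoothY Φ → lapU^[j] (c • Φ) = c • lapU^[j] Φ) :=
  iterate_linear SmoothY.lapU lapU_add lapU_smul j


lemma diffOp_add {n : ℕ} (l m k : ℕ) {Φ Ψ : Y n → ℂ} (h : SmoothY Φ) (h' : SmoothY Ψ) :
    diffOp l m k (Φ + Ψ) = diffOp l m k Φ + diffOp l m k Ψ := by
  have a := (iterate_lapU k).1 h
  have a' := (iterate_lapU k).1 h'
  rw [diffOp, (iterate_lapU k).2.1 h h', (iterate_dB m).2.1 a a',
    (iterate_dA l).2.1 ((iterate_dB m).1 a) ((iterate_dB m).1 a')]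
  rfl

lemma diffOp_smul {n : ℕ} (l m k : ℕ) (c : ℂ) {Φ : Y n → ℂ} (h : SmoothY Φ) :
    diffOp l m k (c • Φ) = c • diffOp l m k Φ := by
  have a := (iterate_lapU k).1 h
  rw [diffOp, (iterate_lapU k).2.2 c h, (iterate_dB m).2.2 c a,
    (iterate_dA l).2.2 c ((iterate_dB m).1 a)]
  rfl

lemma weight_nonneg {n : ℕ} (s r : ℕ) (y : Y n) :
    0 ≤ ((y.2.2 : ℝ) ^ s + 1 / (y.2.2 : ℝ) ^ s) * (1 + y.2.1 ^ 2) ^ ((r : ℝ) / 2) := by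
  have := y.2.2.2
  simp only [mem_Ioi] at this
  positivity

lemma weighted_nonneg {n : ℕ} (s r l m k : ℕ) (Φ : Y n → ℂ) (y : Y n) :
    0 ≤ weighted s r l m k Φ y :=
  mul_nonneg (weight_nonneg s r y) (norm_nonneg _)

lemma weighted_add_le {n : ℕ} (s r l m k : ℕ) {Φ Ψ : Y n → ℂ} (h : SmoothY Φ) (h' : SmoothY Ψ)
    (y : Y n) :
    weighted s r l m k (Φ + Ψ) y ≤ weighted s r l m k Φ y + weighted s r l m k Ψ y := by
  rw [weighted, weighted, weighted, diffOp_add l m k h h', ← mul_add]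
  exact mul_le_mul_of_nonneg_left (norm_add_le _ _) (weight_nonneg s r y)

lemma weighted_smul {n : ℕ} (s r l m k : ℕ) (c : ℂ) {Φ : Y n → ℂ} (h : SmoothY Φ) (y : Y n) :
    weighted s r l m k (c • Φ) y = ‖c‖ * weighted s r l m k Φ y := by
  rw [weighted, weighted, diffOp_smul l m k c h, Pi.smul_apply, norm_smul]
  ring

lemma weighted_zero {n : ℕ} (s r l m k : ℕ) (y : Y n) :
    weighted s r l m k (0 : Y n → ℂ) y = 0 := by
  have := weighted_smul s r l m k 0 (SmoothY.zero (n := n)) y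
  simpa using this

/-! ### The space `𝓢(𝕐ⁿ⁺¹)` and its topology -/

/-- The set underlying `𝓢(𝕐ⁿ⁺¹)`: the smooth functions on `𝕐ⁿ⁺¹` for which all the suprema
`sup (a^s + 1/a^s) (1 + b²)^{r/2} |∂_a^l ∂_b^m Δ_u^k Φ|` are finite. -/
def schwartzYSubmodule (n : ℕ) : Submodule ℂ (Y n → ℂ) where
  carrier := {Φ | SmoothY Φ ∧ ∀ s r l m k : ℕ, BddAbove (range (weighted s r l m k Φ))}
  zero_mem' := ⟨SmoothY.zero, fun s r l m k => ⟨0, by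
    rintro _ ⟨y, rfl⟩; exact (weighted_zero s r l m k y).le⟩⟩
  add_mem' := fun {Φ Ψ} h h' => ⟨h.1.add h'.1, fun s r l m k => by
    obtain ⟨C, hC⟩ := h.2 s r l m k
    obtain ⟨C', hC'⟩ := h'.2 s r l m k
    refine ⟨C + C', ?_⟩
    rintro _ ⟨y, rfl⟩
    exact (weighted_add_le s r l m k h.1 h'.1 y).trans
      (add_le_add (hC ⟨y, rfl⟩) (hC' ⟨y, rfl⟩))⟩
  smul_mem' := fun c Φ h => ⟨h.1.smul c, fun s r l m k => by
    obtain ⟨C, hC⟩ := h.2 s r l m k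
    refine ⟨‖c‖ * C, ?_⟩
    rintro _ ⟨y, rfl⟩
    rw [weighted_smul s r l m k c h.1]
    exact mul_le_mul_of_nonneg_left (hC ⟨y, rfl⟩) (norm_nonneg c)⟩

/-- The space `𝓢(𝕐ⁿ⁺¹)`. (A type of its own, so that it does not inherit the topology of pointwise
convergence.) -/
def SchwartzY (n : ℕ) : Type := schwartzYSubmodule n

namespace SchwartzY

instance (n : ℕ) : AddCommGroup (SchwartzY n) :=
  inferInstanceAs (AddCommGroup (schwartzYSubmodule n))

instance (n : ℕ) : Module ℂ (SchwartzY n) :=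
  inferInstanceAs (Module ℂ (schwartzYSubmodule n))

instance (n : ℕ) : FunLike (SchwartzY n) (Y n) ℂ where
  coe Φ := Φ.1
  coe_injective := fun _ _ h => Subtype.ext h

lemma smoothY {n : ℕ} (Φ : SchwartzY n) : SmoothY (Φ : Y n → ℂ) := Φ.2.1

lemma bddAbove {n : ℕ} (Φ : SchwartzY n) (s r l m k : ℕ) :
    BddAbove (range (weighted s r l m k (Φ : Y n → ℂ))) := Φ.2.2 s r l m k

lemma coe_add {n : ℕ} (Φ Ψ : SchwartzY n) : ((Φ + Ψ : SchwartzY n) : Y n → ℂ) = Φ + Ψ := rfl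

lemma coe_smul {n : ℕ} (c : ℂ) (Φ : SchwartzY n) :
    ((c • Φ : SchwartzY n) : Y n → ℂ) = c • (Φ : Y n → ℂ) := rfl

/-- The seminorm `ρ_{s,r}^{l,m,k}(Φ) = sup (a^s + 1/a^s) (1 + b²)^{r/2} |∂_a^l ∂_b^m Δ_u^k Φ|`. -/
def rho {n : ℕ} (s r l m k : ℕ) : Seminorm ℂ (SchwartzY n) :=
  Seminorm.of (fun Φ => ⨆ y : Y n, weighted s r l m k (Φ : Y n → ℂ) y)
    (fun Φ Ψ => by
      have h0 : ∀ Θ : SchwartzY n, 0 ≤ ⨆ y : Y n, weighted s r l m k (Θ : Y n → ℂ) y :=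
        fun Θ => Real.iSup_nonneg (weighted_nonneg s r l m k _)
      refine Real.iSup_le (fun y => ?_) (add_nonneg (h0 Φ) (h0 Ψ))
      rw [coe_add]
      exact (weighted_add_le s r l m k Φ.smoothY Ψ.smoothY y).trans
        (add_le_add (le_ciSup (Φ.bddAbove s r l m k) y) (le_ciSup (Ψ.bddAbove s r l m k) y)))
    (fun c Φ => by
      rw [Real.mul_iSup_of_nonneg (norm_nonneg c)]
      exact iSup_congr fun y => weighted_smul s r l m k c Φ.smoothY y)

/-- The family of the seminorms `ρ_{s,r}^{l,m,k}`, indexed by `(s, r, l, m, k)`. -/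
def rhoFamily (n : ℕ) : SeminormFamily ℂ (SchwartzY n) (ℕ × ℕ × ℕ × ℕ × ℕ) :=
  fun i => rho i.1 i.2.1 i.2.2.1 i.2.2.2.1 i.2.2.2.2

/-- The locally convex topology of `𝓢(𝕐ⁿ⁺¹)` defined by the seminorms `ρ_{s,r}^{l,m,k}`. -/
instance (n : ℕ) : TopologicalSpace (SchwartzY n) :=
  (rhoFamily n).moduleFilterBasis.topology'

lemma withSeminorms (n : ℕ) : WithSeminorms (rhoFamily n) := ⟨rfl⟩

end SchwartzY

/-! ### The ridgelet transform and the ridgelet synthesis operator on functions -/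

/-- The ridgelet `ψ_{u,b,a}(x) = a⁻¹ ψ((x · u - b) / a)`. -/
def ridgelet {n : ℕ} (ψ : ℝ → ℂ) (y : Y n) (x : E n) : ℂ :=
  (1 / ((y.2.2 : ℝ) : ℂ)) * ψ ((inner ℝ x (y.1 : E n) - y.2.1) / (y.2.2 : ℝ))

/-- The ridgelet transform of a function,
`R_ψ f(u,b,a) = ∫ f(x) conj(ψ_{u,b,a}(x)) dx`. -/
def ridgeletFun {n : ℕ} (ψ : ℝ → ℂ) (f : E n → ℂ) (y : Y n) : ℂ :=
  ∫ x : E n, f x * starRingEnd ℂ (ridgelet ψ y x)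

/-- The ridgelet synthesis operator on functions,
`R^t_ψ Φ(x) = ∫_{𝕊ⁿ⁻¹} ∫_0^∞ ∫_ℝ Φ(u,b,a) ψ_{u,b,a}(x) a⁻ⁿ db da du`,
where `du` is the surface measure of the sphere. -/
def synthesisFun {n : ℕ} (ψ : ℝ → ℂ) (Φ : Y n → ℂ) (x : E n) : ℂ :=
  ∫ u : sphere (0 : E n) 1, (∫ a : Ioi (0 : ℝ), (∫ b : ℝ,
    Φ (u, b, a) * ridgelet ψ (u, b, a) x / ((a : ℝ) : ℂ) ^ n)
      ∂((volume : Measure ℝ).comap Subtype.val)) ∂((volume : Measure (E n)).toSphere)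

/-- The complex conjugate `ψ̄` of `ψ`. -/
def conjFun (ψ : ℝ → ℂ) : ℝ → ℂ := fun t => starRingEnd ℂ (ψ t)

/-! ### Distributions -/

/-- The Lizorkin distributions `𝓢₀'(ℝⁿ)`. Mathlib's topology on `StrongDual` is the one of uniform
convergence on bounded sets, i.e. the strong dual topology. -/
abbrev LizorkinDist (n : ℕ) : Type := StrongDual ℂ (lizorkin n)

/-- The dual `𝓢'(𝕐ⁿ⁺¹)`, with the strong dual topology. -/
abbrev DistY (n : ℕ) : Type := StrongDual ℂ (SchwartzY n)

/-- `T` is the ridgelet transform `R_ψ : 𝓢₀'(ℝⁿ) → 𝓢'(𝕐ⁿ⁺¹)` of distributions: for every test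
function `Φ`, the function `R^t_{ψ̄} Φ` is (given by) an element of `𝓢₀(ℝⁿ)`, and
`⟨T f, Φ⟩ = ⟨f, R^t_{ψ̄} Φ⟩` for all `f`. -/
def IsRidgeletTransform {n : ℕ} (ψ : ℝ → ℂ) (T : LizorkinDist n → DistY n) : Prop :=
  ∀ Φ : SchwartzY n, ∃ φ : lizorkin n,
    (∀ x : E n, (φ : 𝓢(E n, ℂ)) x = synthesisFun (conjFun ψ) Φ x) ∧
    ∀ f : LizorkinDist n, T f Φ = f φ

/-- `T` is the ridgelet synthesis operator `R^t_ψ : 𝓢'(𝕐ⁿ⁺¹) → 𝓢₀'(ℝⁿ)` on distributions: for every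
test function `φ`, the function `R_{ψ̄} φ` is (given by) an element of `𝓢(𝕐ⁿ⁺¹)`, and
`⟨T F, φ⟩ = ⟨F, R_{ψ̄} φ⟩` for all `F`. -/
def IsRidgeletSynthesis {n : ℕ} (ψ : ℝ → ℂ) (T : DistY n → LizorkinDist n) : Prop :=
  ∀ φ : lizorkin n, ∃ Φ : SchwartzY n,
    (∀ y : Y n, Φ y = ridgeletFun (conjFun ψ) (φ : 𝓢(E n, ℂ)) y) ∧
    ∀ F : DistY n, T F φ = F Φ

end Ridgelet

end

open MeasureTheory Metric Set
open scoped SchwartzMap ContDiff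

noncomputable section

namespace Ridgelet

section

/-! Both distributional operators are transposes, and the transpose of a continuous linear map is
continuous for the strong dual topologies. So the theorem reduces to two statements about test
functions: `R_{ψ̄}` maps `𝓢₀(ℝⁿ)` continuously to `𝓢(𝕐ⁿ⁺¹)` (`exists_ridgeletCLM`), and `R^t_{ψ̄}`
maps `𝓢(𝕐ⁿ⁺¹)` continuously to `𝓢₀(ℝⁿ)` (`exists_synthesisCLM`). All estimates are phrased through
`SeminormBdd`, so that one bound gives both membership in the target space and continuity.

For the transform, write `t = (z · u - b) / a`. Up to the factor `1/a` it is `∫ φ(z) ψ(t) dz`. Decay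
in `b` holds because a large `|b|` makes `|z|` or `|t|` large. As `a → 0` the moments of `ψ` enter:
they make `ψ` a derivative `Ψ'` within `𝓢₀(ℝ)` (`exists_sderiv_eq`), and integration by parts in `z`
moves the derivative to `φ` with a gain of `a` (`ridgeInt_seminormBdd_small`). As `a → ∞` the
moments of `φ` enter: the integral, extended to `u` in the unit ball, is zero at `u = 0`, and its
`u`-gradient is `1/a` times integrals of the same kind (`ridgeInt_seminormBdd_large`). Derivatives
in `a`, `b`, `u` stay within one class of expressions, `RidgeFamily`, all of whose members satisfy
these bounds.

For the synthesis, consider `∫ H(u,b,a) ψ(t) du db da`. Each `z`-derivative only produces a factor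
`uᵢ / a`, which the decay of `H` absorbs. Decay in `z` comes from the spherical Laplacian of the
ridge function: `|z|² Ψ''(t)` equals `a² Δ_u Ψ(t)` plus terms polynomial in `a`, `b`, `t`
(`laplacian_sphRidge`), and Green's formula on the sphere (`integral_sphere_mul_laplacian_comm`)
transfers `Δ_u` to `H`. Thus a factor `|z|²` can be traded for finitely many integrals of the same
type (`norm_sq_smul_synth`), again and again because `ψ` has primitives of every order in `𝓢₀(ℝ)`.
The moments vanish because the Laplacian in `z` of `Ψ(t)` is `a⁻² Ψ''(t)`, so the synthesis integral
is an arbitrarily high power of the Laplacian applied to a Schwartz function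
(`SmoothDecay.momentsVanish`). -/

/-! ### Families of functions bounded by a continuous seminorm -/

/-- The real functions `F v`, depending on a parameter `v` in a topological vector space, are
bounded by `p v` for some continuous seminorm `p`. -/
def SeminormBdd {V ι : Type*} [AddCommGroup V] [Module ℂ V] [TopologicalSpace V]
    (F : V → ι → ℝ) : Prop :=
  ∃ p : Seminorm ℂ V, Continuous p ∧ ∀ v i, F v i ≤ p v

namespace SeminormBdd

variable {V W ι κ : Type*} [AddCommGroup V] [Module ℂ V] [TopologicalSpace V]
  [AddCommGroup W] [Module ℂ W] [TopologicalSpace W]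

lemma mono {F G : V → ι → ℝ} (hG : SeminormBdd G) (h : ∀ v i, F v i ≤ G v i) : SeminormBdd F := by
  obtain ⟨p, hp, hb⟩ := hG
  exact ⟨p, hp, fun v i => (h v i).trans (hb v i)⟩

lemma add {F G : V → ι → ℝ} (hF : SeminormBdd F) (hG : SeminormBdd G) :
    SeminormBdd (fun v i => F v i + G v i) := by
  obtain ⟨p, hp, hb⟩ := hF
  obtain ⟨q, hq, hc⟩ := hG
  exact ⟨p + q, hp.add hq, fun v i => add_le_add (hb v i) (hc v i)⟩

lemma const_mul {F : V → ι → ℝ} (hF : SeminormBdd F) {C : ℝ} (hC : 0 ≤ C) :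
    SeminormBdd (fun v i => C * F v i) := by
  obtain ⟨p, hp, hb⟩ := hF
  lift C to NNReal using hC
  exact ⟨C • p, hp.const_smul C, fun v i => mul_le_mul_of_nonneg_left (hb v i) C.2⟩

lemma zero : SeminormBdd (fun (_ : V) (_ : ι) => (0 : ℝ)) :=
  ⟨0, continuous_const, fun _ _ => le_rfl⟩

lemma sum {α : Type*} (s : Finset α) {F : α → V → ι → ℝ} (hF : ∀ a ∈ s, SeminormBdd (F a)) :
    SeminormBdd (fun v i => ∑ a ∈ s, F a v i) := by
  classical
  induction s using Finset.induction_on with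
  | empty => simpa using zero
  | insert a s ha ih =>
    simp only [Finset.sum_insert ha]
    exact (hF a (by simp)).add (ih fun b hb => hF b (by simp [hb]))

lemma comp {F : W → ι → ℝ} (hF : SeminormBdd F) (L : V →L[ℂ] W) :
    SeminormBdd (fun v i => F (L v) i) := by
  obtain ⟨p, hp, hb⟩ := hF
  exact ⟨p.comp (L : V →ₗ[ℂ] W), hp.comp L.continuous, fun v i => hb (L v) i⟩

end SeminormBdd

/-! ### Elementary inequalities -/

/-- Integer powers are controlled by the weight `a ^ s + a ^ (-s)`. -/
lemma pow_le_weight {a : ℝ} (ha : 0 < a) {i s : ℕ} (h : i ≤ s) : a ^ i ≤ a ^ s + 1 / a ^ s := by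
  rcases le_total a 1 with h1 | h1
  · have : 1 ≤ 1 / a ^ s := by
      rw [le_div_iff₀ (by positivity), one_mul]; exact pow_le_one₀ ha.le h1
    have h2 : a ^ i ≤ 1 := pow_le_one₀ ha.le h1
    have : 0 ≤ a ^ s := by positivity
    linarith
  · have h2 : a ^ i ≤ a ^ s := pow_le_pow_right₀ h1 h
    have : 0 ≤ 1 / a ^ s := by positivity
    linarith

lemma inv_pow_le_weight {a : ℝ} (ha : 0 < a) {i s : ℕ} (h : i ≤ s) :
    1 / a ^ i ≤ a ^ s + 1 / a ^ s := by
  have := pow_le_weight (inv_pos.2 ha) h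
  simp only [inv_pow, one_div, inv_inv] at this ⊢
  linarith

lemma zpow_le_weight {a : ℝ} (ha : 0 < a) {i : ℤ} {s : ℕ} (h : i.natAbs ≤ s) :
    a ^ i ≤ a ^ s + 1 / a ^ s := by
  obtain ⟨j, rfl | rfl⟩ := i.eq_nat_or_neg
  · rw [zpow_natCast]; exact pow_le_weight ha (by simpa using h)
  · rw [zpow_neg, zpow_natCast, ← one_div]; exact inv_pow_le_weight ha (by simpa using h)

/-- The product is a sum of two pure powers whose exponents are at most `s + |i|` in absolute value.
This absorbs the powers of `a` that differentiation and the measure produce. -/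
lemma weight_mul_zpow_le {a : ℝ} (ha : 0 < a) (i : ℤ) (s : ℕ) :
    (a ^ s + 1 / a ^ s) * a ^ i ≤ 2 * (a ^ (s + i.natAbs) + 1 / a ^ (s + i.natAbs)) := by
  have e : (a ^ s + 1 / a ^ s) * a ^ i = a ^ (s + i : ℤ) + a ^ (-s + i : ℤ) := by
    rw [add_mul, zpow_add₀ ha.ne', zpow_add₀ ha.ne', zpow_neg, zpow_natCast, one_div]
  have h1 := zpow_le_weight ha (i := s + i) (s := s + i.natAbs) (by omega)
  have h2 := zpow_le_weight ha (i := -s + i) (s := s + i.natAbs) (by omega)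
  rw [e]; linarith

lemma one_add_sq_rpow_le (b : ℝ) (r : ℕ) : (1 + b ^ 2) ^ ((r : ℝ) / 2) ≤ (1 + |b|) ^ r := by
  have h : 1 + b ^ 2 ≤ (1 + |b|) ^ (2 : ℝ) := by
    rw [Real.rpow_two, add_sq, sq_abs]; nlinarith [abs_nonneg b]
  calc (1 + b ^ 2) ^ ((r : ℝ) / 2) ≤ ((1 + |b|) ^ (2 : ℝ)) ^ ((r : ℝ) / 2) :=
        Real.rpow_le_rpow (by positivity) h (by positivity)
    _ = (1 + |b|) ^ r := by
        rw [← Real.rpow_mul (by positivity), mul_div_cancel₀ _ two_ne_zero, Real.rpow_natCast]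

/-! ### Schwartz functions of one variable -/

lemma exists_one_add_abs_pow_mul_le (ψ : 𝓢(ℝ, ℂ)) (r : ℕ) :
    ∃ C, 0 ≤ C ∧ ∀ t, (1 + |t|) ^ r * ‖ψ t‖ ≤ C := by
  refine ⟨2 ^ r * ((Finset.Iic (r, 0)).sup fun m => SchwartzMap.seminorm ℂ m.1 m.2) ψ, by positivity,
    fun t => ?_⟩
  simpa using SchwartzMap.one_add_le_sup_seminorm_apply (𝕜 := ℂ) (m := (r, 0)) le_rfl le_rfl ψ t

/-- The derivative of a Schwartz function. -/
abbrev sderiv (ψ : 𝓢(ℝ, ℂ)) : 𝓢(ℝ, ℂ) := SchwartzMap.derivCLM ℂ ℂ ψ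

lemma hasDerivAt_sderiv (ψ : 𝓢(ℝ, ℂ)) (t : ℝ) : HasDerivAt ψ (sderiv ψ t) t := by
  simpa using ψ.hasDerivAt t

/-- Multiplication of a Schwartz function by the variable. -/
def smulVar : 𝓢(ℝ, ℂ) →L[ℂ] 𝓢(ℝ, ℂ) := SchwartzMap.smulLeftCLM ℂ (fun t : ℝ => (t : ℂ))

@[simp] lemma smulVar_apply (ψ : 𝓢(ℝ, ℂ)) (t : ℝ) : smulVar ψ t = t * ψ t := by
  rw [smulVar, SchwartzMap.smulLeftCLM_apply_apply Function.Complex.hasTemperateGrowth_ofReal, smul_eq_mul]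

/-- Integration by parts. It is read in both directions: vanishing moments pass from a function to
its derivative, and from the derivative back to a Schwartz primitive. -/
lemma integral_pow_succ_mul_sderiv (k : ℕ) (ψ : 𝓢(ℝ, ℂ)) :
    ∫ t : ℝ, (t : ℂ) ^ (k + 1) * sderiv ψ t = -((k + 1) * ∫ t : ℝ, (t : ℂ) ^ k * ψ t) := by
  rw [← integral_const_mul]
  have h1 := integrable_pow_mul k ψ
  have e : ∀ t : ℝ, (k + 1 : ℂ) * ((t : ℂ) ^ k * ψ t) = ((k + 1 : ℂ) * (t : ℂ) ^ k) * ψ t :=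
    fun t => by ring
  simp only [e]
  refine integral_mul_deriv_eq_deriv_mul_of_integrable (fun x _ => ?_)
    (fun x _ => hasDerivAt_sderiv ψ x) (integrable_pow_mul (k + 1) (sderiv ψ)) ?_
    (integrable_pow_mul (k + 1) ψ)
  · simpa using (Complex.ofRealCLM.hasDerivAt (x := x)).fun_pow (k + 1)
  · convert h1.const_mul (k + 1 : ℂ) using 1
    funext t; simp [mul_assoc]

lemma sderiv_mem {ψ : 𝓢(ℝ, ℂ)} (h : ψ ∈ lizorkinReal) : sderiv ψ ∈ lizorkinReal := by
  intro k
  cases k with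
  | zero =>
    -- The zeroth moment of a derivative is the difference of the limits at `±∞`, which are both
    -- zero.
    have := integral_of_hasDerivAt_of_tendsto (f := ψ) (f' := sderiv ψ) (m := 0) (n := 0)
      (fun t => hasDerivAt_sderiv ψ t) (sderiv ψ).integrable
      ((SchwartzMap.tendsto_cocompact ψ).mono_left (by rw [cocompact_eq_atBot_atTop]; exact le_sup_left))
      ((SchwartzMap.tendsto_cocompact ψ).mono_left (by rw [cocompact_eq_atBot_atTop]; exact le_sup_right))
    simpa using this
  | succ k => rw [integral_pow_succ_mul_sderiv, h k]; simp

lemma smulVar_mem {ψ : 𝓢(ℝ, ℂ)} (h : ψ ∈ lizorkinReal) : smulVar ψ ∈ lizorkinReal := by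
  intro k
  rw [← h (k + 1)]
  refine integral_congr_ae (Filter.Eventually.of_forall fun t => ?_)
  simp only [smulVar_apply]; ring

/-- For `s ≤ t ≤ 0` one has `|t| ≤ |s|`, so the weight may be moved inside the integral. This gives
the decay of the primitive of `ψ` at `-∞`. -/
lemma norm_integral_Iic_mul_le (ψ : 𝓢(ℝ, ℂ)) (k : ℕ) {t : ℝ} (ht : t ≤ 0) :
    |t| ^ k * ‖∫ s in Iic t, ψ s‖ ≤ ∫ s, ‖s‖ ^ k * ‖ψ s‖ := by
  have hi := ψ.integrable_pow_mul volume k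
  calc |t| ^ k * ‖∫ s in Iic t, ψ s‖ ≤ |t| ^ k * ∫ s in Iic t, ‖ψ s‖ := by
        gcongr; exact norm_integral_le_integral_norm _
    _ = ∫ s in Iic t, |t| ^ k * ‖ψ s‖ := (integral_const_mul _ _).symm
    _ ≤ ∫ s in Iic t, ‖s‖ ^ k * ‖ψ s‖ := by
        refine setIntegral_mono_on (ψ.integrable.norm.const_mul _).integrableOn hi.integrableOn
          measurableSet_Iic fun s hs => ?_
        gcongr
        rw [Real.norm_eq_abs, abs_of_nonpos ht, abs_of_nonpos (le_trans hs ht)]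
        exact neg_le_neg hs
    _ ≤ _ := setIntegral_le_integral hi (Filter.Eventually.of_forall fun s => by positivity)

lemma norm_integral_Ioi_mul_le (ψ : 𝓢(ℝ, ℂ)) (k : ℕ) {t : ℝ} (ht : 0 ≤ t) :
    |t| ^ k * ‖∫ s in Ioi t, ψ s‖ ≤ ∫ s, ‖s‖ ^ k * ‖ψ s‖ := by
  have hi := ψ.integrable_pow_mul volume k
  calc |t| ^ k * ‖∫ s in Ioi t, ψ s‖ ≤ |t| ^ k * ∫ s in Ioi t, ‖ψ s‖ := by
        gcongr; exact norm_integral_le_integral_norm _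
    _ = ∫ s in Ioi t, |t| ^ k * ‖ψ s‖ := (integral_const_mul _ _).symm
    _ ≤ ∫ s in Ioi t, ‖s‖ ^ k * ‖ψ s‖ := by
        refine setIntegral_mono_on (ψ.integrable.norm.const_mul _).integrableOn hi.integrableOn
          measurableSet_Ioi fun s hs => ?_
        gcongr
        have hs' : t < s := hs
        rw [Real.norm_eq_abs, abs_of_nonneg ht, abs_of_nonneg (ht.trans hs'.le)]
        exact hs'.le
    _ ≤ _ := setIntegral_le_integral hi (Filter.Eventually.of_forall fun s => by positivity)

/-- Every function of `𝓢₀(ℝ)` is the derivative of a function of `𝓢₀(ℝ)`. -/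
lemma exists_sderiv_eq {ψ : 𝓢(ℝ, ℂ)} (h : ψ ∈ lizorkinReal) :
    ∃ Ψ ∈ lizorkinReal, sderiv Ψ = ψ := by
  set P : ℝ → ℂ := fun t => ∫ s in Iic t, ψ s with hP
  have hd : ∀ t, HasDerivAt P (ψ t) t := by
    intro t
    have e : P = fun t => (∫ s in Iic (0 : ℝ), ψ s) + ∫ s in (0 : ℝ)..t, ψ s := by
      funext u
      rw [← intervalIntegral.integral_Iic_sub_Iic ψ.integrable.integrableOn
        ψ.integrable.integrableOn, add_sub_cancel]
    rw [e]
    exact (intervalIntegral.integral_hasDerivAt_right (ψ.integrable.intervalIntegrable)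
      ψ.continuous.stronglyMeasurable.stronglyMeasurableAtFilter
      ψ.continuous.continuousAt).const_add _
  have hdec : ∀ k : ℕ, ∀ t, ‖t‖ ^ k * ‖P t‖ ≤ ∫ s, ‖s‖ ^ k * ‖ψ s‖ := by
    intro k t
    rcases le_total t 0 with ht | ht
    · exact norm_integral_Iic_mul_le ψ k ht
    -- The zeroth moment of `ψ` vanishes, so the primitive is also minus the right tail, which
    -- decays at `+∞`.
    · have e : P t = -∫ s in Ioi t, ψ s := by
        have hi : Integrable ψ := ψ.integrable
        have h1 := intervalIntegral.integral_Iic_add_Ioi (b := t) hi.integrableOn hi.integrableOn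
        have h2 := h 0
        simp only [pow_zero, one_mul] at h2
        rw [h2] at h1
        exact eq_neg_of_add_eq_zero_left h1
      rw [e, norm_neg]
      exact norm_integral_Ioi_mul_le ψ k ht
  have hder : deriv P = ψ := funext fun t => (hd t).deriv
  let Ψ : 𝓢(ℝ, ℂ) :=
    { toFun := P
      smooth' := by
        rw [contDiff_infty_iff_deriv, hder]
        exact ⟨fun t => (hd t).differentiableAt, ψ.smooth'⟩
      decay' := by
        intro k m
        cases m with
        | zero => exact ⟨_, fun t => by rw [norm_iteratedFDeriv_zero]; exact hdec k t⟩
        | succ m =>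
          obtain ⟨C, hC⟩ := ψ.decay' k m
          refine ⟨C, fun t => ?_⟩
          rw [norm_iteratedFDeriv_eq_norm_iteratedDeriv, iteratedDeriv_succ', hder,
            ← norm_iteratedFDeriv_eq_norm_iteratedDeriv]
          exact hC t }
  have hΨ : sderiv Ψ = ψ := by
    ext t
    simp only [SchwartzMap.derivCLM_apply]
    exact (hd t).deriv
  refine ⟨Ψ, fun k => ?_, hΨ⟩
  -- The `k`-th moment of `Ψ` is a nonzero multiple of the moment of order `k + 1` of `ψ`.
  have := integral_pow_succ_mul_sderiv k Ψ
  rw [hΨ, h (k + 1), eq_comm, neg_eq_zero, mul_eq_zero] at this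
  exact this.resolve_left (by exact_mod_cast k.succ_ne_zero)

/-- The complex conjugate of a Schwartz function. -/
def conjSchwartz (ψ : 𝓢(ℝ, ℂ)) : 𝓢(ℝ, ℂ) :=
  SchwartzMap.postcompCLM (𝕜 := ℝ) (Complex.conjCLE : ℂ →L[ℝ] ℂ) ψ

lemma coe_conjSchwartz (ψ : 𝓢(ℝ, ℂ)) : (conjSchwartz ψ : ℝ → ℂ) = conjFun ψ := by
  funext t; simp [conjSchwartz, conjFun]

lemma conjSchwartz_mem {ψ : 𝓢(ℝ, ℂ)} (h : ψ ∈ lizorkinReal) : conjSchwartz ψ ∈ lizorkinReal := by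
  intro k
  have := congrArg (starRingEnd ℂ) (h k)
  rw [map_zero, ← integral_conj] at this
  rw [← this, coe_conjSchwartz]
  simp [conjFun]

end

section

variable {n : ℕ}

/-! ### Operations on Schwartz functions of several variables -/

lemma hasTemperateGrowth_coord (i : Fin n) :
    (fun x : E n => (x i : ℂ)).HasTemperateGrowth :=
  (Complex.ofRealCLM ∘L (EuclideanSpace.proj i : E n →L[ℝ] ℝ)).hasTemperateGrowth

/-- Multiplication of a Schwartz function by a coordinate. -/
def smulCoord (i : Fin n) : 𝓢(E n, ℂ) →L[ℂ] 𝓢(E n, ℂ) :=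
  SchwartzMap.smulLeftCLM ℂ (fun x : E n => (x i : ℂ))

@[simp] lemma smulCoord_apply (i : Fin n) (φ : 𝓢(E n, ℂ)) (x : E n) :
    smulCoord i φ x = x i * φ x := by
  rw [smulCoord, SchwartzMap.smulLeftCLM_apply_apply (hasTemperateGrowth_coord i), smul_eq_mul]

lemma smulCoord_mem (i : Fin n) {φ : 𝓢(E n, ℂ)} (h : φ ∈ lizorkin n) :
    smulCoord i φ ∈ lizorkin n := by
  intro m
  rw [← h (m + Pi.single i 1)]
  refine integral_congr_ae (Filter.Eventually.of_forall fun x => ?_)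
  simp only [smulCoord_apply, Pi.add_apply, pow_add, Finset.prod_mul_distrib]
  have : ∏ j, (x j : ℂ) ^ (Pi.single i 1 : Fin n → ℕ) j = x i := by
    rw [Finset.prod_eq_single i] <;> simp +contextual
  rw [this]; ring

/-- Multiplication by a coordinate on the Lizorkin space. -/
def lizCoord (i : Fin n) : lizorkin n →L[ℂ] lizorkin n :=
  ((smulCoord i).comp (lizorkin n).subtypeL).codRestrict _ fun φ => smulCoord_mem i φ.2

@[simp] lemma coe_lizCoord (i : Fin n) (φ : lizorkin n) :
    (lizCoord i φ : 𝓢(E n, ℂ)) = smulCoord i φ := rfl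

/-- The partial derivative of a Schwartz function. -/
def pderiv (i : Fin n) : 𝓢(E n, ℂ) →L[ℂ] 𝓢(E n, ℂ) :=
  (SchwartzMap.evalCLM ℂ (E n) ℂ (EuclideanSpace.single i (1 : ℝ))).comp
    (SchwartzMap.fderivCLM ℂ (E n) ℂ)

lemma pderiv_apply (i : Fin n) (φ : 𝓢(E n, ℂ)) (x : E n) :
    pderiv i φ x = fderiv ℝ φ x (EuclideanSpace.single i 1) := rfl

lemma inner_eq_sum (x y : E n) : inner ℝ x y = ∑ i, x i * y i := by
  simp [PiLp.inner_apply, mul_comm]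

/-! ### The ridgelet integral -/

/-- `∫ φ(z) ψ((z · x - b) / a) dz`, at `q = (x, b, a)`. -/
def ridgeInt (φ : 𝓢(E n, ℂ)) (ψ : 𝓢(ℝ, ℂ)) (q : E n × ℝ × ℝ) : ℂ :=
  ∫ z : E n, φ z * ψ ((inner ℝ z q.1 - q.2.1) / q.2.2)

lemma continuous_profile (ψ : 𝓢(ℝ, ℂ)) (q : E n × ℝ × ℝ) :
    Continuous (fun z : E n => ψ ((inner ℝ z q.1 - q.2.1) / q.2.2)) :=
  ψ.continuous.comp (by fun_prop)

lemma integrable_ridgeInt (φ : 𝓢(E n, ℂ)) (ψ : 𝓢(ℝ, ℂ)) (q : E n × ℝ × ℝ) :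
    Integrable (fun z : E n => φ z * ψ ((inner ℝ z q.1 - q.2.1) / q.2.2)) := by
  obtain ⟨C, -, hC⟩ := exists_one_add_abs_pow_mul_le ψ 0
  exact φ.integrable.mul_bdd (c := C) (continuous_profile ψ q).aestronglyMeasurable
    (Filter.Eventually.of_forall fun z => by simpa using hC _)

/-- The derivative of `(x, b, a) ↦ (z · x - b) / a` at a point where its value is `t`. -/
def phaseDeriv (z : E n) (a t : ℝ) : E n × ℝ × ℝ →L[ℝ] ℝ :=
  a⁻¹ • ((innerSL ℝ z).comp (ContinuousLinearMap.fst ℝ (E n) (ℝ × ℝ)) -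
    (ContinuousLinearMap.fst ℝ ℝ ℝ).comp (ContinuousLinearMap.snd ℝ (E n) (ℝ × ℝ)) -
    t • (ContinuousLinearMap.snd ℝ ℝ ℝ).comp (ContinuousLinearMap.snd ℝ (E n) (ℝ × ℝ)))

lemma phaseDeriv_apply (z : E n) (a t : ℝ) (v : E n × ℝ × ℝ) :
    phaseDeriv z a t v = a⁻¹ * (inner ℝ z v.1 - v.2.1 - t * v.2.2) := by
  simp [phaseDeriv]

lemma norm_phaseDeriv_le (z : E n) {a : ℝ} (ha : 0 < a) (t : ℝ) :
    ‖phaseDeriv z a t‖ ≤ a⁻¹ * (‖z‖ + 1 + |t|) := by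
  refine ContinuousLinearMap.opNorm_le_bound _ (by positivity) fun v => ?_
  rw [phaseDeriv_apply, norm_mul, Real.norm_of_nonneg (inv_nonneg.2 ha.le), mul_assoc]
  gcongr
  have h1 : ‖v.1‖ ≤ ‖v‖ := norm_fst_le v
  have h2 : |v.2.1| ≤ ‖v‖ := (norm_fst_le v.2).trans (norm_snd_le v)
  have h3 : |v.2.2| ≤ ‖v‖ := (norm_snd_le v.2).trans (norm_snd_le v)
  calc ‖inner ℝ z v.1 - v.2.1 - t * v.2.2‖
      ≤ ‖z‖ * ‖v.1‖ + |v.2.1| + |t| * |v.2.2| := by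
        refine (norm_sub_le _ _).trans (add_le_add ((norm_sub_le _ _).trans
          (add_le_add (norm_inner_le_norm _ _) le_rfl)) ?_)
        rw [Real.norm_eq_abs, abs_mul]
    _ ≤ ‖z‖ * ‖v‖ + ‖v‖ + |t| * ‖v‖ := by gcongr
    _ = _ := by ring

lemma hasFDerivAt_phase (z : E n) {q : E n × ℝ × ℝ} (hq : 0 < q.2.2) :
    HasFDerivAt (fun q : E n × ℝ × ℝ => (inner ℝ z q.1 - q.2.1) / q.2.2)
      (phaseDeriv z q.2.2 ((inner ℝ z q.1 - q.2.1) / q.2.2)) q := by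
  have h1 : HasFDerivAt (fun q : E n × ℝ × ℝ => inner ℝ z q.1 - q.2.1)
      ((innerSL ℝ z).comp (ContinuousLinearMap.fst ℝ (E n) (ℝ × ℝ)) -
        (ContinuousLinearMap.fst ℝ ℝ ℝ).comp (ContinuousLinearMap.snd ℝ (E n) (ℝ × ℝ))) q :=
    ((innerSL ℝ z).hasFDerivAt.comp q hasFDerivAt_fst).sub (hasFDerivAt_fst.comp q hasFDerivAt_snd)
  have h2 : HasFDerivAt (fun q : E n × ℝ × ℝ => q.2.2)
      ((ContinuousLinearMap.snd ℝ ℝ ℝ).comp (ContinuousLinearMap.snd ℝ (E n) (ℝ × ℝ))) q :=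
    hasFDerivAt_snd.comp q hasFDerivAt_snd
  have h3 := h1.mul ((hasDerivAt_inv hq.ne').comp_hasFDerivAt q h2)
  simp only [div_eq_mul_inv]
  refine h3.congr_fderiv (ContinuousLinearMap.ext fun v => ?_)
  simp [phaseDeriv]
  field_simp
  ring

lemma hasFDerivAt_profile (ψ : 𝓢(ℝ, ℂ)) (z : E n) {q : E n × ℝ × ℝ} (hq : 0 < q.2.2) :
    HasFDerivAt (fun q : E n × ℝ × ℝ => ψ ((inner ℝ z q.1 - q.2.1) / q.2.2))
      ((phaseDeriv z q.2.2 ((inner ℝ z q.1 - q.2.1) / q.2.2)).smulRight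
        (sderiv ψ ((inner ℝ z q.1 - q.2.1) / q.2.2))) q := by
  refine (((hasDerivAt_sderiv ψ _).hasFDerivAt).comp q (hasFDerivAt_phase z hq)).congr_fderiv ?_
  ext v <;> simp

/-- The derivative in `a` brings a factor `t`, which the decay of `ψ'` absorbs. What remains grows
only linearly in `z`, so that multiplied by `φ` it dominates the differentiated integrand. -/
lemma exists_norm_profileDeriv_le (ψ : 𝓢(ℝ, ℂ)) :
    ∃ C, 0 ≤ C ∧ ∀ (z : E n) (a t : ℝ), 0 < a →
      ‖(phaseDeriv z a t).smulRight (sderiv ψ t)‖ ≤ a⁻¹ * (C * (1 + ‖z‖)) := by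
  obtain ⟨C, hC0, hC⟩ := exists_one_add_abs_pow_mul_le (sderiv ψ) 1
  refine ⟨C, hC0, fun z a t ha => ?_⟩
  rw [ContinuousLinearMap.norm_smulRight_apply]
  calc _ ≤ a⁻¹ * (‖z‖ + 1 + |t|) * ‖sderiv ψ t‖ := by
        gcongr; exact norm_phaseDeriv_le z ha t
    _ ≤ a⁻¹ * ((1 + |t|) ^ 1 * ‖sderiv ψ t‖ * (1 + ‖z‖)) := by
        rw [mul_assoc, pow_one]
        refine mul_le_mul_of_nonneg_left ?_ (inv_nonneg.2 ha.le)
        rw [mul_right_comm]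
        refine mul_le_mul_of_nonneg_right ?_ (norm_nonneg _)
        nlinarith [mul_nonneg (abs_nonneg t) (norm_nonneg z)]
    _ ≤ _ := by gcongr; exact hC t

/-- Differentiation under the integral sign. The point of the formula is closure: the gradient
consists of ridge integrals again, with `zᵢ φ` in place of `φ` and `ψ'` or `t ψ'` in place of `ψ`,
and both replacements preserve vanishing moments. -/
lemma hasFDerivAt_ridgeInt (φ : 𝓢(E n, ℂ)) (ψ : 𝓢(ℝ, ℂ)) {q : E n × ℝ × ℝ} (hq : 0 < q.2.2) :
    DifferentiableAt ℝ (ridgeInt φ ψ) q ∧ ∀ v, fderiv ℝ (ridgeInt φ ψ) q v =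
      (q.2.2 : ℂ)⁻¹ * ((∑ i, v.1 i * ridgeInt (smulCoord i φ) (sderiv ψ) q) -
        v.2.1 * ridgeInt φ (sderiv ψ) q - v.2.2 * ridgeInt φ (smulVar (sderiv ψ)) q) := by
  obtain ⟨C, hC0, hC⟩ := exists_norm_profileDeriv_le (n := n) ψ
  set F' : E n × ℝ × ℝ → E n → (E n × ℝ × ℝ →L[ℝ] ℂ) := fun p z =>
    φ z • (phaseDeriv z p.2.2 ((inner ℝ z p.1 - p.2.1) / p.2.2)).smulRight
        (sderiv ψ ((inner ℝ z p.1 - p.2.1) / p.2.2)) with hF'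
  -- On this neighbourhood `a⁻¹` is bounded, so one integrable majorant serves all points.
  set s : Set (E n × ℝ × ℝ) := {p | q.2.2 / 2 < p.2.2}
  have hs : s ∈ nhds q := by
    refine IsOpen.mem_nhds (isOpen_lt continuous_const (by fun_prop)) ?_
    change q.2.2 / 2 < q.2.2
    linarith
  have hbound : Integrable (fun z : E n => ‖φ z‖ * ((q.2.2 / 2)⁻¹ * (C * (1 + ‖z‖)))) := by
    have h := ((φ.integrable (μ := volume)).norm.add (φ.integrable_pow_mul volume 1)).const_mul
      ((q.2.2 / 2)⁻¹ * C)
    refine h.congr (Filter.Eventually.of_forall fun z => ?_)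
    simp only [Pi.add_apply, pow_one]; ring
  have hle : ∀ z, ∀ p ∈ s, ‖F' p z‖ ≤ ‖φ z‖ * ((q.2.2 / 2)⁻¹ * (C * (1 + ‖z‖))) := by
    intro z p hp
    have hp' : q.2.2 / 2 < p.2.2 := hp
    have hq2 : 0 < q.2.2 / 2 := by positivity
    rw [hF', norm_smul]
    refine mul_le_mul_of_nonneg_left ((hC z _ _ (hq2.trans hp')).trans ?_) (norm_nonneg _)
    have := inv_anti₀ hq2 hp'.le
    gcongr
  have hmeas : AEStronglyMeasurable (F' q) volume := by
    refine Continuous.aestronglyMeasurable ?_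
    have ht : Continuous (fun z : E n => (inner ℝ z q.1 - q.2.1) / q.2.2) := by fun_prop
    have h1 : Continuous (fun z : E n => (innerSL ℝ z).comp
        (ContinuousLinearMap.fst ℝ (E n) (ℝ × ℝ))) :=
      (innerSL ℝ).continuous.clm_comp continuous_const
    have h2 : Continuous (fun z : E n => phaseDeriv z q.2.2 ((inner ℝ z q.1 - q.2.1) / q.2.2)) := by
      simp only [phaseDeriv]; fun_prop
    exact φ.continuous.smul
      (isBoundedBilinearMap_smulRight.continuous.comp₂ h2 (continuous_profile (sderiv ψ) q))
  have key : HasFDerivAt (ridgeInt φ ψ) (∫ z, F' q z) q := by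
    refine hasFDerivAt_integral_of_dominated_of_fderiv_le hs
      (Filter.Eventually.of_forall fun p => (integrable_ridgeInt φ ψ p).aestronglyMeasurable)
      (integrable_ridgeInt φ ψ q) hmeas (Filter.Eventually.of_forall hle) hbound
      (Filter.Eventually.of_forall fun z p hp => ?_)
    have hp' : q.2.2 / 2 < p.2.2 := hp
    exact (hasFDerivAt_profile ψ z (lt_trans (by positivity) hp')).const_mul (φ z)
  refine ⟨key.differentiableAt, fun v => ?_⟩
  have hi : Integrable (F' q) := hbound.mono' hmeas
    (Filter.Eventually.of_forall fun z => hle z q (mem_of_mem_nhds hs))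
  rw [key.fderiv, ContinuousLinearMap.integral_apply hi]
  have i1 : ∀ i, Integrable (fun z : E n => (v.1 i : ℂ) *
      (smulCoord i φ z * sderiv ψ ((inner ℝ z q.1 - q.2.1) / q.2.2))) := fun i =>
    (integrable_ridgeInt (smulCoord i φ) (sderiv ψ) q).const_mul _
  have i2 := (integrable_ridgeInt φ (sderiv ψ) q).const_mul (v.2.1 : ℂ)
  have i3 := (integrable_ridgeInt φ (smulVar (sderiv ψ)) q).const_mul (v.2.2 : ℂ)
  simp only [ridgeInt, ← integral_const_mul]
  have i0 := integrable_finsetSum Finset.univ (fun i _ => i1 i)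
  rw [← integral_finsetSum _ (fun i _ => i1 i), ← integral_sub i0 i2]
  have i02 := i0.sub i2
  simp only [Pi.sub_def] at i02
  rw [← integral_sub i02 i3, ← integral_const_mul]
  refine integral_congr_ae (Filter.Eventually.of_forall fun z => ?_)
  simp only [hF', smul_apply, ContinuousLinearMap.smulRight_apply,
    phaseDeriv_apply, smulCoord_apply, smulVar_apply, smul_eq_mul, Complex.real_smul,
    inner_eq_sum z v.1]
  push_cast
  simp only [mul_sub, sub_mul, Finset.mul_sum, Finset.sum_mul]
  congr 1
  · congr 1
    · exact Finset.sum_congr rfl fun i _ => by ring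
    · ring
  · ring

end

section

variable {n : ℕ}

/-! ### Decay of the ridgelet integral -/

lemma exists_integral_weight_le (r : ℕ) : ∃ p : Seminorm ℂ 𝓢(E n, ℂ), Continuous p ∧
    ∀ φ : 𝓢(E n, ℂ), Integrable (fun z : E n => (1 + ‖z‖) ^ r * ‖φ z‖) ∧
      ∫ z : E n, (1 + ‖z‖) ^ r * ‖φ z‖ ≤ p φ := by
  have hb : ∀ k, SeminormBdd (fun (φ : 𝓢(E n, ℂ)) (_ : Unit) => ∫ z : E n, ‖z‖ ^ k * ‖φ z‖) := by
    intro k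
    set μ : Measure (E n) := volume
    have hc : ∀ i j, Continuous (SchwartzMap.seminorm ℂ i j : Seminorm ℂ 𝓢(E n, ℂ)) := fun i j =>
      (schwartz_withSeminorms ℂ (E n) ℂ).continuous_seminorm (i, j)
    have h1 : SeminormBdd (fun (φ : 𝓢(E n, ℂ)) (_ : Unit) => SchwartzMap.seminorm ℂ 0 0 φ) :=
      ⟨_, hc 0 0, fun _ _ => le_rfl⟩
    have h2 : SeminormBdd (fun (φ : 𝓢(E n, ℂ)) (_ : Unit) =>
        SchwartzMap.seminorm ℂ (k + μ.integrablePower) 0 φ) :=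
      ⟨_, hc _ 0, fun _ _ => le_rfl⟩
    refine ((h1.add h2).const_mul (C := 2 ^ μ.integrablePower *
      ∫ x : E n, (1 + ‖x‖) ^ (-μ.integrablePower : ℝ)) ?_).mono fun φ _ => ?_
    · exact mul_nonneg (by positivity) (integral_nonneg fun x => by positivity)
    · simpa using SchwartzMap.integral_pow_mul_iteratedFDeriv_le ℂ μ φ k 0
  -- The constant is that of `(1 + x) ^ r ≤ 2 ^ (r - 1) (1 + x ^ r)`, valid also for `r = 0` with
  -- truncated subtraction.
  obtain ⟨p, hp, h⟩ := ((hb 0).add (hb r)).const_mul (C := 2 ^ (r - 1)) (by positivity)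
  refine ⟨p, hp, fun φ => ?_⟩
  have hle : ∀ z : E n, (1 + ‖z‖) ^ r * ‖φ z‖ ≤
      2 ^ (r - 1) * (‖z‖ ^ 0 * ‖φ z‖ + ‖z‖ ^ r * ‖φ z‖) := by
    intro z
    have := add_pow_le (zero_le_one' ℝ) (norm_nonneg z) r
    rw [pow_zero, ← add_mul, ← mul_assoc]
    rw [one_pow] at this
    gcongr
  have hi : Integrable (fun z : E n => 2 ^ (r - 1) * (‖z‖ ^ 0 * ‖φ z‖ + ‖z‖ ^ r * ‖φ z‖)) :=
    ((φ.integrable_pow_mul volume 0).add (φ.integrable_pow_mul volume r)).const_mul _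
  have hi' : Integrable (fun z : E n => (1 + ‖z‖) ^ r * ‖φ z‖) :=
    hi.mono' (Continuous.aestronglyMeasurable (by fun_prop)) (Filter.Eventually.of_forall fun z => by
      rw [Real.norm_of_nonneg (by positivity)]; exact hle z)
  refine ⟨hi', (integral_mono hi' hi hle).trans ?_⟩
  rw [integral_const_mul, integral_add (φ.integrable_pow_mul volume 0)
    (φ.integrable_pow_mul volume r)]
  exact h φ ()

/-- Since `b = z · x - a t`, growth in `b` is paid for by growth in `z` (controlled by `φ`) and in
`t` (controlled by `ψ`). -/
lemma one_add_abs_le_mul {z x : E n} {a b m : ℝ} (hx : ‖x‖ ≤ 1) (ha : 0 < a) (hm : 1 ≤ m)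
    (ham : a ≤ m) :
    1 + |b| ≤ m * (1 + ‖z‖) * (1 + |(inner ℝ z x - b) / a|) := by
  set t := (inner ℝ z x - b) / a with ht
  have hb : b = inner ℝ z x - a * t := by rw [ht]; field_simp; ring
  have h1 : |inner ℝ z x| ≤ ‖z‖ :=
    (abs_real_inner_le_norm z x).trans (mul_le_of_le_one_right (norm_nonneg z) hx)
  have h2 : |b| ≤ ‖z‖ + m * |t| := by
    rw [hb]
    refine (abs_sub _ _).trans (add_le_add h1 ?_)
    rw [abs_mul, abs_of_pos ha]
    gcongr
  nlinarith [norm_nonneg z, abs_nonneg t, mul_nonneg (norm_nonneg z) (abs_nonneg t)]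

/-- No moments are involved here. The parameter `m` lets one bound serve both regimes: `m = 1` for
`a ≤ 1`, and `m = a` for `a ≥ 1` at the cost of `a ^ r`. -/
lemma exists_ridgeInt_le (ψ : 𝓢(ℝ, ℂ)) (r : ℕ) : ∃ p : Seminorm ℂ 𝓢(E n, ℂ), Continuous p ∧
    ∀ (φ : 𝓢(E n, ℂ)) (q : E n × ℝ × ℝ) (m : ℝ), ‖q.1‖ ≤ 1 → 0 < q.2.2 → 1 ≤ m → q.2.2 ≤ m →
      (1 + |q.2.1|) ^ r * ‖ridgeInt φ ψ q‖ ≤ m ^ r * p φ := by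
  obtain ⟨p, hp, h⟩ := exists_integral_weight_le (n := n) r
  obtain ⟨C, hC0, hC⟩ := exists_one_add_abs_pow_mul_le ψ r
  lift C to NNReal using hC0
  refine ⟨C • p, hp.const_smul C, fun φ q m hx ha hm ham => ?_⟩
  have hle : ∀ z : E n, (1 + |q.2.1|) ^ r * ‖φ z * ψ ((inner ℝ z q.1 - q.2.1) / q.2.2)‖ ≤
      m ^ r * C * ((1 + ‖z‖) ^ r * ‖φ z‖) := by
    intro z
    set t := (inner ℝ z q.1 - q.2.1) / q.2.2 with ht
    have h1 : (1 + |q.2.1|) ^ r ≤ (m * (1 + ‖z‖) * (1 + |t|)) ^ r :=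
      pow_le_pow_left₀ (by positivity) (one_add_abs_le_mul hx ha hm ham) r
    calc (1 + |q.2.1|) ^ r * ‖φ z * ψ t‖ ≤ (m * (1 + ‖z‖) * (1 + |t|)) ^ r * ‖φ z * ψ t‖ := by
          gcongr
      _ = m ^ r * ((1 + |t|) ^ r * ‖ψ t‖) * ((1 + ‖z‖) ^ r * ‖φ z‖) := by
          rw [norm_mul, mul_pow, mul_pow]; ring
      _ ≤ _ := by gcongr; exact hC t
  calc (1 + |q.2.1|) ^ r * ‖ridgeInt φ ψ q‖
      ≤ (1 + |q.2.1|) ^ r * ∫ z : E n, ‖φ z * ψ ((inner ℝ z q.1 - q.2.1) / q.2.2)‖ := by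
        gcongr; exact norm_integral_le_integral_norm _
    _ ≤ ∫ z : E n, m ^ r * C * ((1 + ‖z‖) ^ r * ‖φ z‖) := by
        rw [← integral_const_mul]
        exact integral_mono ((integrable_ridgeInt φ ψ q).norm.const_mul _)
          ((h φ).1.const_mul _) hle
    _ ≤ m ^ r * C * p φ := by
        rw [integral_const_mul]
        gcongr
        exact (h φ).2
    _ = _ := by rw [mul_assoc]; rfl

/-- Integration by parts in the ridgelet integral. -/
lemma coord_mul_ridgeInt_sderiv (φ : 𝓢(E n, ℂ)) (ψ : 𝓢(ℝ, ℂ)) (i : Fin n) {q : E n × ℝ × ℝ}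
    (hq : 0 < q.2.2) :
    q.1 i * ridgeInt φ (sderiv ψ) q = -(q.2.2 * ridgeInt (pderiv i φ) ψ q) := by
  set e : E n := EuclideanSpace.single i 1
  have hd : ∀ z : E n, HasFDerivAt (fun z : E n => ψ ((inner ℝ z q.1 - q.2.1) / q.2.2))
      ((q.2.2⁻¹ • innerSL ℝ q.1).smulRight (sderiv ψ ((inner ℝ z q.1 - q.2.1) / q.2.2))) z := by
    intro z
    have h1 : HasFDerivAt (fun z : E n => (inner ℝ z q.1 - q.2.1) / q.2.2)
        (q.2.2⁻¹ • innerSL ℝ q.1) z := by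
      have := (((innerSL ℝ q.1).hasFDerivAt (x := z)).sub_const q.2.1).const_smul q.2.2⁻¹
      refine this.congr_of_eventuallyEq (Filter.Eventually.of_forall fun z => ?_)
      simp [real_inner_comm, div_eq_inv_mul]
    refine (((hasDerivAt_sderiv ψ _).hasFDerivAt).comp z h1).congr_fderiv ?_
    ext v
    simp [mul_assoc]
  have hv : ∀ z : E n, fderiv ℝ (fun z : E n => ψ ((inner ℝ z q.1 - q.2.1) / q.2.2)) z e =
      (q.2.2 : ℂ)⁻¹ * (q.1 i * sderiv ψ ((inner ℝ z q.1 - q.2.1) / q.2.2)) := by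
    intro z
    rw [(hd z).fderiv]
    simp [e, EuclideanSpace.inner_single_right, mul_assoc]
  have key := integral_mul_fderiv_eq_neg_fderiv_mul_of_integrable (μ := (volume : Measure (E n)))
    (f := φ) (g := fun z : E n => ψ ((inner ℝ z q.1 - q.2.1) / q.2.2)) (v := e)
    (integrable_ridgeInt (pderiv i φ) ψ q) (by
      simp only [hv]
      refine ((integrable_ridgeInt φ (sderiv ψ) q).const_mul ((q.2.2 : ℂ)⁻¹ * q.1 i)).congr
        (Filter.Eventually.of_forall fun z => ?_)
      ring) (integrable_ridgeInt φ ψ q) (fun x _ => φ.differentiableAt)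
      (fun x _ => (hd x).differentiableAt)
  simp only [hv] at key
  have h2 : (q.2.2 : ℂ)⁻¹ * (q.1 i * ridgeInt φ (sderiv ψ) q) = -ridgeInt (pderiv i φ) ψ q := by
    rw [ridgeInt, ridgeInt, ← integral_const_mul, ← integral_const_mul]
    refine Eq.trans ?_ key
    exact integral_congr_ae (Filter.Eventually.of_forall fun z => by ring)
  have hne : (q.2.2 : ℂ) ≠ 0 := by exact_mod_cast hq.ne'
  rw [mul_comm (q.2.2 : ℂ), ← neg_mul, ← h2]
  field_simp

/-- On the unit sphere `∑ xᵢ² = 1`, so the integral is recovered from its products with the `xᵢ`,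
and integration by parts turns each of those into `a` times a ridge integral. -/
lemma norm_ridgeInt_sderiv_le (φ : 𝓢(E n, ℂ)) (ψ : 𝓢(ℝ, ℂ)) {q : E n × ℝ × ℝ}
    (hq : 0 < q.2.2) (hx : ‖q.1‖ = 1) :
    ‖ridgeInt φ (sderiv ψ) q‖ ≤ q.2.2 * ∑ i, ‖ridgeInt (pderiv i φ) ψ q‖ := by
  have h1 : ∑ i, (q.1 i : ℂ) * q.1 i = 1 := by
    have := inner_eq_sum q.1 q.1
    rw [real_inner_self_eq_norm_sq, hx, one_pow] at this
    exact_mod_cast this.symm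
  calc ‖ridgeInt φ (sderiv ψ) q‖
      = ‖∑ i, (q.1 i : ℂ) * (q.1 i * ridgeInt φ (sderiv ψ) q)‖ := by
        simp only [← mul_assoc]; rw [← Finset.sum_mul, h1, one_mul]
    _ ≤ ∑ i, q.2.2 * ‖ridgeInt (pderiv i φ) ψ q‖ := by
        refine (norm_sum_le _ _).trans (Finset.sum_le_sum fun i _ => ?_)
        rw [coord_mul_ridgeInt_sderiv φ ψ i hq, norm_mul, norm_neg, norm_mul, Complex.norm_real,
          Complex.norm_real, Real.norm_of_nonneg hq.le]
        exact mul_le_of_le_one_left (by positivity) ((PiLp.norm_apply_le q.1 i).trans hx.le)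
    _ = _ := by rw [Finset.mul_sum]

/-- Replacing `ψ` by its primitive gains one factor `a` and costs one derivative of `φ`. Only the
moments of `ψ` matter, so `φ` ranges over all Schwartz functions, as the induction needs for the `∂ᵢ
φ`. -/
lemma ridgeInt_seminormBdd_small (r s : ℕ) : ∀ ψ ∈ lizorkinReal,
    SeminormBdd (fun (φ : 𝓢(E n, ℂ)) (q : {q : E n × ℝ × ℝ // ‖q.1‖ = 1 ∧ 0 < q.2.2 ∧ q.2.2 ≤ 1}) =>
      1 / q.1.2.2 ^ s * ((1 + |q.1.2.1|) ^ r * ‖ridgeInt φ ψ q.1‖)) := by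
  induction s with
  | zero =>
    intro ψ _
    obtain ⟨p, hp, h⟩ := exists_ridgeInt_le (n := n) ψ r
    exact ⟨p, hp, fun φ q => by
      simpa using h φ q.1 1 q.2.1.le q.2.2.1 le_rfl q.2.2.2⟩
  | succ s ih =>
    intro ψ hψ
    obtain ⟨Ψ, hΨ, rfl⟩ := exists_sderiv_eq hψ
    refine (SeminormBdd.sum Finset.univ fun i _ => (ih Ψ hΨ).comp (pderiv i)).mono fun φ q => ?_
    have ha := q.2.2.1
    rw [← Finset.mul_sum, ← Finset.mul_sum]
    calc _ ≤ 1 / q.1.2.2 ^ (s + 1) * ((1 + |q.1.2.1|) ^ r *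
          (q.1.2.2 * ∑ i, ‖ridgeInt (pderiv i φ) Ψ q.1‖)) := by
          gcongr
          exact norm_ridgeInt_sderiv_le φ Ψ ha q.2.1
      _ = _ := by rw [pow_succ]; field_simp

/-- At `x = 0` the ridge factor does not depend on `z`, and the zeroth moment of `φ` is left. -/
lemma ridgeInt_zero_left (φ : lizorkin n) (ψ : 𝓢(ℝ, ℂ)) (b a : ℝ) :
    ridgeInt (φ : 𝓢(E n, ℂ)) ψ (0, b, a) = 0 := by
  have := φ.2 0
  simp only [Pi.zero_apply, pow_zero, Finset.prod_const_one, one_mul] at this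
  simp only [ridgeInt, inner_zero_right]
  rw [integral_mul_const, this, zero_mul]

/-- The integral vanishes at `x = 0`, so the mean value inequality bounds it by its gradient in `x`,
which is `a⁻¹` times ridge integrals of `zᵢ φ`. These have vanishing moments too, so the gain
repeats. The segment from `0` forces the estimate onto the whole ball; the loss `a ^ r` is that of
the base case. -/
lemma ridgeInt_seminormBdd_large (r N : ℕ) : ∀ ψ : 𝓢(ℝ, ℂ),
    SeminormBdd (fun (φ : lizorkin n) (q : {q : E n × ℝ × ℝ // ‖q.1‖ ≤ 1 ∧ 1 ≤ q.2.2}) =>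
      q.1.2.2 ^ N / q.1.2.2 ^ r * ((1 + |q.1.2.1|) ^ r * ‖ridgeInt (φ : 𝓢(E n, ℂ)) ψ q.1‖)) := by
  induction N with
  | zero =>
    intro ψ
    obtain ⟨p, hp, h⟩ := exists_ridgeInt_le (n := n) ψ r
    refine ⟨p.comp (lizorkin n).subtype, hp.comp (lizorkin n).subtypeL.continuous, fun φ q => ?_⟩
    have ha : 0 < q.1.2.2 := one_pos.trans_le q.2.2
    simp only [pow_zero, one_div]
    rw [inv_mul_le_iff₀ (by positivity)]
    exact h φ q.1 _ q.2.1 ha q.2.2 le_rfl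
  | succ N ih =>
    intro ψ
    obtain ⟨p, hp, h⟩ := SeminormBdd.sum Finset.univ fun i _ =>
      (ih (sderiv ψ)).comp (lizCoord (n := n) i)
    refine ⟨p, hp, fun φ ⟨⟨x, b, a⟩, hx, h1⟩ => ?_⟩
    simp only at hx h1
    have ha : 0 < a := one_pos.trans_le h1
    -- The induction hypothesis, solved for the sum of the norms of the ridge integrals of `zᵢ φ`.
    set C : ℝ := a ^ r / a ^ N * p φ / (1 + |b|) ^ r with hC
    have hf : ∀ y ∈ closedBall (0 : E n) 1, HasFDerivWithinAt
        (fun y : E n => ridgeInt (φ : 𝓢(E n, ℂ)) ψ (y, b, a))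
        ((fderiv ℝ (ridgeInt (φ : 𝓢(E n, ℂ)) ψ) (y, b, a)).comp
          (ContinuousLinearMap.inl ℝ (E n) (ℝ × ℝ))) (closedBall 0 1) y := fun y _ =>
      ((hasFDerivAt_ridgeInt (φ : 𝓢(E n, ℂ)) ψ (q := (y, b, a)) ha).1.hasFDerivAt.comp
        (f := fun y : E n => (y, b, a)) y (hasFDerivAt_prodMk_left y (b, a))).hasFDerivWithinAt
    have hb : ∀ y ∈ closedBall (0 : E n) 1, ‖(fderiv ℝ (ridgeInt (φ : 𝓢(E n, ℂ)) ψ) (y, b, a)).comp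
          (ContinuousLinearMap.inl ℝ (E n) (ℝ × ℝ))‖ ≤ a⁻¹ * C := by
      intro y hy
      rw [mem_closedBall_zero_iff] at hy
      have hsum := h φ ⟨(y, b, a), hy, h1⟩
      simp only [coe_lizCoord, ← Finset.mul_sum] at hsum
      have hpC : ∑ i, ‖ridgeInt (smulCoord i (φ : 𝓢(E n, ℂ))) (sderiv ψ) (y, b, a)‖ ≤ C := by
        rw [hC, le_div_iff₀ (by positivity), div_mul_eq_mul_div, le_div_iff₀ (by positivity)]
        rw [div_mul_eq_mul_div, div_le_iff₀ (by positivity)] at hsum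
        linarith
      have hp0 : 0 ≤ p φ := apply_nonneg p φ
      refine ContinuousLinearMap.opNorm_le_bound _ (by positivity) fun v => ?_
      rw [ContinuousLinearMap.comp_apply, ContinuousLinearMap.inl_apply,
        (hasFDerivAt_ridgeInt (φ : 𝓢(E n, ℂ)) ψ (q := (y, b, a)) ha).2]
      simp only [Prod.fst_zero, Prod.snd_zero, Complex.ofReal_zero, zero_mul, sub_zero]
      rw [norm_mul, norm_inv, Complex.norm_real, Real.norm_of_nonneg ha.le, mul_assoc]
      gcongr
      refine (norm_sum_le _ _).trans (le_trans ?_ (mul_le_mul_of_nonneg_right hpC (norm_nonneg v)))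
      rw [Finset.sum_mul]
      refine Finset.sum_le_sum fun i _ => ?_
      rw [norm_mul, Complex.norm_real, mul_comm]
      gcongr
      exact PiLp.norm_apply_le v i
    have hm := Convex.norm_image_sub_le_of_norm_hasFDerivWithin_le hf hb (convex_closedBall 0 1)
      (mem_closedBall_self zero_le_one) (mem_closedBall_zero_iff.2 hx)
    rw [ridgeInt_zero_left, sub_zero, sub_zero] at hm
    have hp0 : 0 ≤ p φ := apply_nonneg p φ
    have hm' : ‖ridgeInt (φ : 𝓢(E n, ℂ)) ψ (x, b, a)‖ ≤ a⁻¹ * C :=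
      hm.trans (mul_le_of_le_one_right (by positivity) hx)
    calc _ ≤ a ^ (N + 1) / a ^ r * ((1 + |b|) ^ r * (a⁻¹ * C)) := by
          simp only
          gcongr
      _ = p φ := by rw [hC, pow_succ]; field_simp

/-- The ridgelet integral decays rapidly in `b`, as `a → 0` and as `a → ∞`. -/
lemma ridgeInt_seminormBdd (s r : ℕ) {ψ : 𝓢(ℝ, ℂ)} (hψ : ψ ∈ lizorkinReal) :
    SeminormBdd (fun (φ : lizorkin n) (y : Y n) =>
      ((y.2.2 : ℝ) ^ s + 1 / (y.2.2 : ℝ) ^ s) * (1 + |y.2.1|) ^ r *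
        ‖ridgeInt (φ : 𝓢(E n, ℂ)) ψ (incl y)‖) := by
  obtain ⟨p, hp, h⟩ := ((ridgeInt_seminormBdd_small (n := n) r s ψ hψ).comp
    (lizorkin n).subtypeL).const_mul (C := 2) zero_le_two
  -- The exponent `s + r` makes up for the loss `a ^ r`; the factor `2` reflects that one of `a ^
  -- s`, `a ^ (-s)` dominates the other.
  obtain ⟨p', hp', h'⟩ := (ridgeInt_seminormBdd_large (n := n) r (s + r) ψ).const_mul
    (C := 2) zero_le_two
  refine ⟨p + p', hp.add hp', fun φ y => ?_⟩
  have ha : 0 < (y.2.2 : ℝ) := y.2.2.2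
  have hu : ‖(incl y).1‖ = 1 := norm_eq_of_mem_sphere y.1
  have n1 : 0 ≤ p φ := apply_nonneg p φ
  have n2 : 0 ≤ p' φ := apply_nonneg p' φ
  change _ ≤ p φ + p' φ
  rcases le_total (y.2.2 : ℝ) 1 with h1 | h1
  · have hb := h φ ⟨incl y, hu, ha, h1⟩
    refine le_trans ?_ (le_add_of_le_of_nonneg hb n2)
    simp only [incl, Submodule.coe_subtypeL, Submodule.coe_subtype]
    have : (y.2.2 : ℝ) ^ s ≤ 1 / (y.2.2 : ℝ) ^ s := by
      rw [le_div_iff₀ (by positivity), ← mul_pow]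
      exact pow_le_one₀ (by positivity) (by nlinarith)
    rw [mul_assoc, ← mul_assoc 2]
    gcongr
    linarith
  · have hb := h' φ ⟨incl y, hu.le, h1⟩
    refine le_trans ?_ (le_add_of_nonneg_of_le n1 hb)
    simp only [incl]
    have : 1 / (y.2.2 : ℝ) ^ s ≤ (y.2.2 : ℝ) ^ s := by
      rw [div_le_iff₀ (by positivity), ← mul_pow]
      exact one_le_pow₀ (by nlinarith)
    rw [mul_assoc, ← mul_assoc 2, pow_add, mul_div_cancel_right₀ _ (by positivity)]
    gcongr
    linarith

end

section

variable {n : ℕ}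

/-! ### A class of families of functions stable under differentiation -/

/-- The finite sums of families `φ ↦ P(x) a⁻ʲ ∫ (L φ)(z) ψ((z · x/‖x‖ - b) / a) dz`, with `P` smooth
off the origin. -/
inductive RidgeFamily : (lizorkin n → E n × ℝ × ℝ → ℂ) → Prop
  | term (P : E n → ℂ) (hP : ContDiffOn ℝ ∞ P {0}ᶜ) (j : ℕ) (L : lizorkin n →L[ℂ] lizorkin n)
      (ψ : 𝓢(ℝ, ℂ)) (hψ : ψ ∈ lizorkinReal) :
      RidgeFamily fun φ p =>
        P p.1 * (((p.2.2 : ℂ)⁻¹) ^ j * ridgeInt (L φ : 𝓢(E n, ℂ)) ψ (ret p))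
  | add {T T' : lizorkin n → E n × ℝ × ℝ → ℂ} (hT : RidgeFamily T) (hT' : RidgeFamily T') :
      RidgeFamily fun φ p => T φ p + T' φ p

namespace RidgeFamily

lemma zero : RidgeFamily (fun (_ : lizorkin n) _ => 0) := by
  have := term (n := n) (fun _ => 0) contDiffOn_const 0 (ContinuousLinearMap.id ℂ _) 0
    lizorkinReal.zero_mem
  simpa using this

lemma sum {α : Type*} (s : Finset α) {T : α → lizorkin n → E n × ℝ × ℝ → ℂ}
    (hT : ∀ i ∈ s, RidgeFamily (T i)) : RidgeFamily fun φ p => ∑ i ∈ s, T i φ p := by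
  classical
  induction s using Finset.induction_on with
  | empty => simpa using zero
  | insert a s ha ih =>
    simp only [Finset.sum_insert ha]
    exact (hT a (by simp)).add (ih fun b hb => hT b (by simp [hb]))

/-- The radial projection `x ↦ x / ‖x‖`. -/
lemma contDiffOn_normalize : ContDiffOn ℝ ∞ (fun x : E n => ‖x‖⁻¹ • x) {0}ᶜ := by
  intro x hx
  have h1 : ContDiffAt ℝ ∞ (fun x : E n => ‖x‖⁻¹) x :=
    (contDiffAt_id.norm ℝ hx).inv (norm_ne_zero_iff.2 hx)
  exact (h1.smul contDiffAt_id).contDiffWithinAt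

lemma contDiffOn_fderiv_apply {F : Type*} [NormedAddCommGroup F] [NormedSpace ℝ F] {f : E n → F}
    (hf : ContDiffOn ℝ ∞ f {0}ᶜ) (v : E n) :
    ContDiffOn ℝ ∞ (fun x => fderiv ℝ f x v) {0}ᶜ :=
  (hf.fderiv_of_isOpen isOpen_compl_singleton (by simp)).clm_apply contDiffOn_const

lemma hasFDerivAt_of_contDiffOn {F : Type*} [NormedAddCommGroup F] [NormedSpace ℝ F] {f : E n → F}
    (hf : ContDiffOn ℝ ∞ f {0}ᶜ) {x : E n} (hx : x ≠ 0) : HasFDerivAt f (fderiv ℝ f x) x :=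
  ((hf.contDiffAt (isOpen_compl_singleton.mem_nhds hx)).differentiableAt (by simp)).hasFDerivAt

/-- As `ret` is idempotent, only the coefficient `P` changes. Hence the ray extension of a family
restricted to `𝕐ⁿ⁺¹` is again a family, which is what the operators on `𝕐ⁿ⁺¹` differentiate. -/
lemma comp_ret {T : lizorkin n → E n × ℝ × ℝ → ℂ} (hT : RidgeFamily T) :
    ∃ T', RidgeFamily T' ∧ ∀ φ, ∀ p ∈ Omega n, T φ (ret p) = T' φ p := by
  induction hT with
  | term P hP j L ψ hψ =>
    refine ⟨_, term (fun x => P (‖x‖⁻¹ • x))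
      (hP.comp contDiffOn_normalize fun x hx => ?_) j L ψ hψ, fun φ p hp => ?_⟩
    · exact smul_ne_zero (inv_ne_zero (norm_ne_zero_iff.2 hx)) hx
    · have : ret (ret p) = ret p := by
        simp [ret, norm_smul, norm_ne_zero_iff.2 hp.1]
      simp only [this]
      rfl
  | add _ _ ih ih' =>
    obtain ⟨T₁, h₁, e₁⟩ := ih
    obtain ⟨T₂, h₂, e₂⟩ := ih'
    exact ⟨_, h₁.add h₂, fun φ p hp => congrArg₂ (· + ·) (e₁ φ p hp) (e₂ φ p hp)⟩

/-- The product rule together with `hasFDerivAt_ridgeInt`. The family `T'` is chosen before `φ`, so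
seminorm bounds for derivatives are uniform in `φ`. -/
lemma exists_fderiv {T : lizorkin n → E n × ℝ × ℝ → ℂ} (hT : RidgeFamily T) (v : E n × ℝ × ℝ) :
    ∃ T', RidgeFamily T' ∧ ∀ φ, ∀ p ∈ Omega n,
      DifferentiableAt ℝ (T φ) p ∧ fderiv ℝ (T φ) p v = T' φ p := by
  induction hT with
  | term P hP j L ψ hψ =>
    set ν : E n → E n := fun x => ‖x‖⁻¹ • x with hν
    have hν' : ContDiffOn ℝ ∞ ν {0}ᶜ := contDiffOn_normalize
    have hN : ∀ i, ContDiffOn ℝ ∞ (fun x => ((fderiv ℝ ν x v.1 i : ℝ) : ℂ)) {0}ᶜ := fun i =>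
      (Complex.ofRealCLM ∘L (EuclideanSpace.proj i : E n →L[ℝ] ℝ)).contDiff.comp_contDiffOn
        (contDiffOn_fderiv_apply hν' v.1)
    -- The five terms come from differentiating `P`, the power `a⁻ʲ`, and then the argument of `ψ`
    -- through `x / ‖x‖`, through `b` and through `a`.
    have h1 := term (fun x => fderiv ℝ P x v.1) (contDiffOn_fderiv_apply hP v.1) j L ψ hψ
    have h2 := term (fun x => P x * (-(j * v.2.2))) (hP.mul contDiffOn_const) (j + 1) L ψ hψ
    have h3 := sum Finset.univ fun i _ => term (fun x => P x * (fderiv ℝ ν x v.1 i : ℝ))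
      (hP.mul (hN i)) (j + 1) ((lizCoord i).comp L) (sderiv ψ) (sderiv_mem hψ)
    have h4 := term (fun x => P x * (-v.2.1)) (hP.mul contDiffOn_const) (j + 1) L (sderiv ψ)
      (sderiv_mem hψ)
    have h5 := term (fun x => P x * (-v.2.2)) (hP.mul contDiffOn_const) (j + 1) L
      (smulVar (sderiv ψ)) (smulVar_mem (sderiv_mem hψ))
    refine ⟨_, (((h1.add h2).add h3).add h4).add h5, fun φ p hp => ?_⟩
    have ha : (p.2.2 : ℂ) ≠ 0 := by exact_mod_cast hp.2.ne'
    have d1 : HasFDerivAt (fun p : E n × ℝ × ℝ => P p.1)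
        ((fderiv ℝ P p.1).comp (ContinuousLinearMap.fst ℝ (E n) (ℝ × ℝ))) p :=
      (hasFDerivAt_of_contDiffOn hP hp.1).comp p hasFDerivAt_fst
    have hsnd : HasFDerivAt (fun q : E n × ℝ × ℝ => q.2.2)
        ((ContinuousLinearMap.snd ℝ ℝ ℝ).comp (ContinuousLinearMap.snd ℝ (E n) (ℝ × ℝ))) p :=
      hasFDerivAt_snd.comp p hasFDerivAt_snd
    have hpow : HasDerivAt (fun t : ℝ => ((t : ℂ)⁻¹) ^ j)
        (-(j * ((p.2.2 : ℂ)⁻¹) ^ (j + 1))) p.2.2 := by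
      have := ((Complex.ofRealCLM.hasDerivAt (x := p.2.2)).fun_inv ha).fun_pow j
      simp only [Complex.ofRealCLM_apply] at this
      refine this.congr_deriv ?_
      rcases j with _ | j
      · simp
      · rw [Nat.add_sub_cancel, Complex.ofReal_one, neg_div, one_div, ← inv_pow]; ring
    have d2 : HasFDerivAt (fun q : E n × ℝ × ℝ => ((q.2.2 : ℂ)⁻¹) ^ j) _ p :=
      HasFDerivAt.comp (g := fun t : ℝ => ((t : ℂ)⁻¹) ^ j)
        (f := fun q : E n × ℝ × ℝ => q.2.2) p hpow.hasFDerivAt hsnd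
    have hret : HasFDerivAt (ret (n := n)) (((fderiv ℝ ν p.1).comp
        (ContinuousLinearMap.fst ℝ (E n) (ℝ × ℝ))).prod (ContinuousLinearMap.snd ℝ (E n) (ℝ × ℝ))) p :=
      ((hasFDerivAt_of_contDiffOn hν' hp.1).comp p hasFDerivAt_fst).prodMk hasFDerivAt_snd
    have hI := hasFDerivAt_ridgeInt (L φ : 𝓢(E n, ℂ)) ψ (q := ret p) (ret_mem hp).2
    have d3 : HasFDerivAt (fun q => ridgeInt (L φ : 𝓢(E n, ℂ)) ψ (ret q)) _ p :=
      hI.1.hasFDerivAt.comp p hret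
    have key := d1.fun_mul (d2.fun_mul d3)
    refine ⟨key.differentiableAt, (DFunLike.congr_fun key.fderiv v).trans ?_⟩
    simp only [add_apply, smul_apply, ContinuousLinearMap.comp_apply, hI.2, smul_eq_mul,
      ContinuousLinearMap.prod_apply, ContinuousLinearMap.coe_fst', ContinuousLinearMap.coe_snd',
      coe_lizCoord]
    simp only [ret, mul_sub, Finset.mul_sum, ContinuousLinearMap.toSpanSingleton_apply,
      Complex.real_smul]
    have e : ∀ i : Fin n, P p.1 * ((fderiv ℝ ν p.1 v.1 i : ℝ) : ℂ) * ((p.2.2 : ℂ)⁻¹ ^ (j + 1) *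
        ridgeInt (smulCoord i (L φ : 𝓢(E n, ℂ))) (sderiv ψ) (‖p.1‖⁻¹ • p.1, p.2)) =
        P p.1 * ((p.2.2 : ℂ)⁻¹ ^ j * ((p.2.2 : ℂ)⁻¹ * (((fderiv ℝ ν p.1 v.1 i : ℝ) : ℂ) *
          ridgeInt (smulCoord i (L φ : 𝓢(E n, ℂ))) (sderiv ψ) (‖p.1‖⁻¹ • p.1, p.2)))) :=
      fun i => by ring
    simp only [e, ← Finset.mul_sum]
    ring
  | add _ _ ih ih' =>
    obtain ⟨T₁, h₁, e₁⟩ := ih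
    obtain ⟨T₂, h₂, e₂⟩ := ih'
    refine ⟨_, h₁.add h₂, fun φ p hp => ⟨(e₁ φ p hp).1.add (e₂ φ p hp).1, ?_⟩⟩
    rw [fderiv_fun_add (e₁ φ p hp).1 (e₂ φ p hp).1, add_apply, (e₁ φ p hp).2, (e₂ φ p hp).2]

lemma contDiffOn_nat (N : ℕ) : ∀ {T : lizorkin n → E n × ℝ × ℝ → ℂ}, RidgeFamily T →
    ∀ φ, ContDiffOn ℝ N (T φ) (Omega n) := by
  induction N with
  | zero =>
    intro T hT φ
    obtain ⟨_, _, h⟩ := hT.exists_fderiv 0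
    exact contDiffOn_zero.2 fun p hp => (h φ p hp).1.continuousAt.continuousWithinAt
  | succ N ih =>
    intro T hT φ
    push_cast
    rw [contDiffOn_succ_iff_fderiv_of_isOpen (isOpen_Omega n)]
    refine ⟨fun p hp => ?_, by simp, contDiffOn_clm_apply.2 fun v => ?_⟩
    · obtain ⟨_, _, h⟩ := hT.exists_fderiv 0
      exact (h φ p hp).1.differentiableWithinAt
    · obtain ⟨T', hT', h⟩ := hT.exists_fderiv v
      exact (ih hT' φ).congr fun p hp => (h φ p hp).2

lemma contDiffOn {T : lizorkin n → E n × ℝ × ℝ → ℂ} (hT : RidgeFamily T) (φ : lizorkin n) :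
    ContDiffOn ℝ ∞ (T φ) (Omega n) :=
  contDiffOn_infty.2 fun N => contDiffOn_nat N hT φ

lemma smoothY {T : lizorkin n → E n × ℝ × ℝ → ℂ} (hT : RidgeFamily T) (φ : lizorkin n) :
    SmoothY (fun y => T φ (incl y)) :=
  smoothY_of (hT.contDiffOn φ) fun _ => rfl

/-- The coefficient is bounded on the compact sphere, and `a⁻ʲ` is absorbed by raising the weight
from `s` to `s + j`. -/
lemma seminormBdd {T : lizorkin n → E n × ℝ × ℝ → ℂ} (hT : RidgeFamily T) (s r : ℕ) :
    SeminormBdd (fun φ (y : Y n) => ((y.2.2 : ℝ) ^ s + 1 / (y.2.2 : ℝ) ^ s) * (1 + |y.2.1|) ^ r *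
      ‖T φ (incl y)‖) := by
  induction hT with
  | term P hP j L ψ hψ =>
    have hc : ContinuousOn P (sphere 0 1) := hP.continuousOn.mono fun x hx =>
      ne_zero_of_mem_unit_sphere ⟨x, hx⟩
    obtain ⟨C, hC⟩ := (isCompact_sphere (0 : E n) 1).exists_bound_of_continuousOn hc
    refine (((ridgeInt_seminormBdd (s + j) r hψ).comp L).const_mul (C := 2 * |C|)
      (by positivity)).mono fun φ y => ?_
    have ha : 0 < (y.2.2 : ℝ) := y.2.2.2
    have hw := weight_mul_zpow_le ha (-j) s
    simp only [Int.natAbs_neg, Int.natAbs_natCast, zpow_neg, zpow_natCast] at hw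
    have hr : ret (incl y) = incl y := by simp [ret, incl]
    simp only [hr]
    rw [norm_mul, norm_mul, norm_pow, norm_inv]
    simp only [incl, Complex.norm_real, Real.norm_of_nonneg ha.le, inv_pow]
    have hP' : ‖P y.1‖ ≤ |C| := (hC _ y.1.2).trans (le_abs_self C)
    calc _ = ((((y.2.2 : ℝ) ^ s + 1 / (y.2.2 : ℝ) ^ s) * ((y.2.2 : ℝ) ^ j)⁻¹) *
          (1 + |y.2.1|) ^ r * ‖ridgeInt (L φ : 𝓢(E n, ℂ)) ψ (y.1, y.2.1, y.2.2)‖) * ‖P y.1‖ := by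
          ring
      _ ≤ ((2 * ((y.2.2 : ℝ) ^ (s + j) + 1 / (y.2.2 : ℝ) ^ (s + j))) *
          (1 + |y.2.1|) ^ r * ‖ridgeInt (L φ : 𝓢(E n, ℂ)) ψ (y.1, y.2.1, y.2.2)‖) * |C| := by
          gcongr
      _ = _ := by ring
  | add _ _ ih ih' =>
    refine (ih.add ih').mono fun φ y => ?_
    have ha : 0 < (y.2.2 : ℝ) := y.2.2.2
    rw [← mul_add]
    gcongr
    exact norm_add_le _ _

/-- The function on `𝕐ⁿ⁺¹` cut out by a family. -/
def toY (T : lizorkin n → E n × ℝ × ℝ → ℂ) (φ : lizorkin n) : Y n → ℂ := fun y => T φ (incl y)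

lemma exists_rayExt {T : lizorkin n → E n × ℝ × ℝ → ℂ} (hT : RidgeFamily T) :
    ∃ T', RidgeFamily T' ∧ ∀ φ, ∀ p ∈ Omega n, rayExt (toY T φ) p = T' φ p := by
  obtain ⟨T', hT', h⟩ := hT.comp_ret
  refine ⟨T', hT', fun φ p hp => ?_⟩
  simp only [rayExt, hp, dif_pos, toY, incl_retract, h φ p hp]

lemma exists_fderiv_rayExt {T : lizorkin n → E n × ℝ × ℝ → ℂ} (hT : RidgeFamily T)
    (v : E n × ℝ × ℝ) : ∃ T', RidgeFamily T' ∧ ∀ φ, ∀ p ∈ Omega n,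
      fderiv ℝ (rayExt (toY T φ)) p v = T' φ p := by
  obtain ⟨T₁, hT₁, h₁⟩ := hT.exists_rayExt
  obtain ⟨T₂, hT₂, h₂⟩ := hT₁.exists_fderiv v
  refine ⟨T₂, hT₂, fun φ p hp => ?_⟩
  have : rayExt (toY T φ) =ᶠ[nhds p] T₁ φ := by
    filter_upwards [(isOpen_Omega n).mem_nhds hp] with q hq using h₁ φ q hq
  rw [this.fderiv_eq, (h₂ φ p hp).2]

lemma exists_dA {T : lizorkin n → E n × ℝ × ℝ → ℂ} (hT : RidgeFamily T) :
    ∃ T', RidgeFamily T' ∧ ∀ φ, dA (toY T φ) = toY T' φ := by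
  obtain ⟨T', hT', h⟩ := hT.exists_fderiv_rayExt (0, 0, 1)
  exact ⟨T', hT', fun φ => funext fun y =>
    (hasDerivAt_lineA (hT.smoothY φ) (incl_mem y)).deriv.trans (h φ _ (incl_mem y))⟩

lemma exists_dB {T : lizorkin n → E n × ℝ × ℝ → ℂ} (hT : RidgeFamily T) :
    ∃ T', RidgeFamily T' ∧ ∀ φ, dB (toY T φ) = toY T' φ := by
  obtain ⟨T', hT', h⟩ := hT.exists_fderiv_rayExt (0, 1, 0)
  exact ⟨T', hT', fun φ => funext fun y =>
    (hasDerivAt_lineB (hT.smoothY φ) (incl_mem y)).deriv.trans (h φ _ (incl_mem y))⟩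

lemma exists_lapU {T : lizorkin n → E n × ℝ × ℝ → ℂ} (hT : RidgeFamily T) :
    ∃ T', RidgeFamily T' ∧ ∀ φ, lapU (toY T φ) = toY T' φ := by
  choose T₁ hT₁ h₁ using fun i => hT.exists_fderiv_rayExt (stdOrthonormalBasis ℝ (E n) i, 0)
  choose T₂ hT₂ h₂ using fun i => (hT₁ i).exists_fderiv (stdOrthonormalBasis ℝ (E n) i, 0)
  refine ⟨_, sum Finset.univ fun i _ => hT₂ i, fun φ => funext fun y => ?_⟩
  refine (laplacian_slice (hT.smoothY φ) (incl_mem y)).trans (Finset.sum_congr rfl fun i _ => ?_)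
  have : (fun p => fderiv ℝ (rayExt (toY T φ)) p (stdOrthonormalBasis ℝ (E n) i, 0))
      =ᶠ[nhds (incl y)] T₁ i φ := by
    filter_upwards [(isOpen_Omega n).mem_nhds (incl_mem y)] with q hq using h₁ i φ q hq
  exact (DFunLike.congr_fun this.fderiv_eq _).trans
    (h₂ i φ _ (incl_mem y)).2

lemma exists_iterate {op : (Y n → ℂ) → Y n → ℂ}
    (hop : ∀ {T : lizorkin n → E n × ℝ × ℝ → ℂ}, RidgeFamily T →
      ∃ T', RidgeFamily T' ∧ ∀ φ, op (toY T φ) = toY T' φ) (k : ℕ)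
    {T : lizorkin n → E n × ℝ × ℝ → ℂ} (hT : RidgeFamily T) :
    ∃ T', RidgeFamily T' ∧ ∀ φ, op^[k] (toY T φ) = toY T' φ := by
  induction k with
  | zero => exact ⟨T, hT, fun _ => rfl⟩
  | succ k ih =>
    obtain ⟨T₁, hT₁, h₁⟩ := ih
    obtain ⟨T₂, hT₂, h₂⟩ := hop hT₁
    exact ⟨T₂, hT₂, fun φ => by rw [Function.iterate_succ_apply', h₁, h₂]⟩

lemma exists_diffOp (l m k : ℕ) {T : lizorkin n → E n × ℝ × ℝ → ℂ} (hT : RidgeFamily T) :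
    ∃ T', RidgeFamily T' ∧ ∀ φ, diffOp l m k (toY T φ) = toY T' φ := by
  obtain ⟨T₁, hT₁, h₁⟩ := exists_iterate exists_lapU k hT
  obtain ⟨T₂, hT₂, h₂⟩ := exists_iterate exists_dB m hT₁
  obtain ⟨T₃, hT₃, h₃⟩ := exists_iterate exists_dA l hT₂
  exact ⟨T₃, hT₃, fun φ => by rw [diffOp, h₁, h₂, h₃]⟩

lemma weighted_seminormBdd {T : lizorkin n → E n × ℝ × ℝ → ℂ} (hT : RidgeFamily T)
    (s r l m k : ℕ) : SeminormBdd (fun φ (y : Y n) => weighted s r l m k (toY T φ) y) := by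
  obtain ⟨T', hT', h⟩ := hT.exists_diffOp l m k
  refine (hT'.seminormBdd s r).mono fun φ y => ?_
  have ha : 0 < (y.2.2 : ℝ) := y.2.2.2
  rw [weighted, h]
  have := one_add_sq_rpow_le y.2.1 r
  rw [toY]
  gcongr

end RidgeFamily

/-! ### The ridgelet transform on `𝓢₀(ℝⁿ)` -/

/-- The conjugation in the definition of the transform cancels the one on the profile. -/
lemma ridgeletFun_conjFun (ψ : 𝓢(ℝ, ℂ)) (φ : lizorkin n) (y : Y n) :
    ridgeletFun (conjFun ψ) (φ : 𝓢(E n, ℂ)) y =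
      ((y.2.2 : ℝ) : ℂ)⁻¹ * ridgeInt (φ : 𝓢(E n, ℂ)) ψ (incl y) := by
  rw [ridgeletFun, ridgeInt, ← integral_const_mul]
  refine integral_congr_ae (Filter.Eventually.of_forall fun x => ?_)
  simp [ridgelet, conjFun, incl]
  ring

/-- `R_{ψ̄}` maps `𝓢₀(ℝⁿ)` continuously to `𝓢(𝕐ⁿ⁺¹)`. -/
theorem exists_ridgeletCLM (n : ℕ) (ψ : lizorkinReal) :
    ∃ A : lizorkin n →L[ℂ] SchwartzY n, ∀ φ y,
      A φ y = ridgeletFun (conjFun (ψ : 𝓢(ℝ, ℂ))) (φ : 𝓢(E n, ℂ)) y := by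
  set T : lizorkin n → E n × ℝ × ℝ → ℂ := fun φ p =>
    1 * (((p.2.2 : ℂ)⁻¹) ^ 1 * ridgeInt (φ : 𝓢(E n, ℂ)) ψ (ret p)) with hTdef
  have hT : RidgeFamily T := .term (fun _ => 1) contDiffOn_const 1 (ContinuousLinearMap.id ℂ _) ψ ψ.2
  have hTy : ∀ φ y, RidgeFamily.toY T φ y =
      ridgeletFun (conjFun (ψ : 𝓢(ℝ, ℂ))) (φ : 𝓢(E n, ℂ)) y := fun φ y => by
    have hr : ret (incl y) = incl y := by simp [ret, incl]
    rw [ridgeletFun_conjFun, RidgeFamily.toY, hTdef]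
    simp only [hr, one_mul, pow_one]
    rfl
  have hadd : ∀ φ φ', RidgeFamily.toY T (φ + φ') = RidgeFamily.toY T φ + RidgeFamily.toY T φ' := by
    intro φ φ'
    funext y
    rw [Pi.add_apply]
    simp only [hTy, ridgeletFun_conjFun, ridgeInt]
    rw [← mul_add, ← integral_add (integrable_ridgeInt _ _ _) (integrable_ridgeInt _ _ _)]
    simp [add_mul]
  have hsmul : ∀ (c : ℂ) φ, RidgeFamily.toY T (c • φ) = c • RidgeFamily.toY T φ := by
    intro c φ
    funext y
    rw [Pi.smul_apply]
    simp only [hTy, ridgeletFun_conjFun, ridgeInt]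
    rw [smul_eq_mul, mul_left_comm]
    congr 1
    rw [← integral_const_mul]
    simp [mul_assoc]
  let A : lizorkin n →ₗ[ℂ] SchwartzY n :=
    { toFun := fun φ => ⟨RidgeFamily.toY T φ, hT.smoothY φ, fun s r l m k => by
        obtain ⟨p, -, h⟩ := hT.weighted_seminormBdd s r l m k
        exact ⟨p φ, by rintro _ ⟨y, rfl⟩; exact h φ y⟩⟩
      map_add' := fun φ φ' => Subtype.ext (hadd φ φ')
      map_smul' := fun c φ => Subtype.ext (hsmul c φ) }
  have hA : Continuous A := by
    rw [(SchwartzY.withSeminorms n).continuous_iff_continuous_comp]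
    rintro ⟨s, r, l, m, k⟩
    obtain ⟨p, hp, h⟩ := hT.weighted_seminormBdd s r l m k
    exact Seminorm.continuous_of_le hp fun φ =>
      Real.iSup_le (fun y => h φ y) (apply_nonneg p φ)
  exact ⟨⟨A, hA⟩, hTy⟩

end

section

variable {n : ℕ}

/-! ### Integrals over `𝕐ⁿ⁺¹` -/

/-- The measure `du db da` on `𝕐ⁿ⁺¹`. -/
def measY (n : ℕ) : Measure (Y n) :=
  ((volume : Measure (E n)).toSphere).prod
    ((volume : Measure ℝ).prod ((volume : Measure ℝ).comap Subtype.val))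

/-- The weight `(a ^ s + a ^ (-s)) (1 + b²) ^ r`. -/
def wt (s r : ℕ) (y : Y n) : ℝ :=
  ((y.2.2 : ℝ) ^ s + 1 / (y.2.2 : ℝ) ^ s) * (1 + y.2.1 ^ 2) ^ r

lemma wt_pos (s r : ℕ) (y : Y n) : 0 < wt s r y := by
  have ha : 0 < (y.2.2 : ℝ) := y.2.2.2
  rw [wt]; positivity

/-- An integrable function on `𝕐ⁿ⁺¹`. -/
def envelope (y : Y n) : ℝ := 1 * ((1 + y.2.1 ^ 2)⁻¹ * (1 + (y.2.2 : ℝ) ^ 2)⁻¹)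

instance : SigmaFinite ((volume : Measure ℝ).comap (Subtype.val : Ioi (0 : ℝ) → ℝ)) := by
  refine SigmaFinite.of_map _ measurable_subtype_coe.aemeasurable ?_
  rw [map_comap_subtype_coe measurableSet_Ioi]
  infer_instance

lemma integrable_envelope : Integrable (envelope (n := n)) (measY n) := by
  have h1 : Integrable (fun _ : sphere (0 : E n) 1 => (1 : ℝ)) ((volume : Measure (E n)).toSphere) :=
    integrable_const 1
  have h2 : Integrable (fun b : ℝ => (1 + b ^ 2)⁻¹) := integrable_inv_one_add_sq
  have h3 : Integrable (fun a : Ioi (0 : ℝ) => (1 + (a : ℝ) ^ 2)⁻¹)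
      ((volume : Measure ℝ).comap Subtype.val) :=
    (integrableOn_iff_comap_subtypeVal measurableSet_Ioi).1 h2.integrableOn
  exact h1.mul_prod (h2.mul_prod h3)

lemma envelope_nonneg (y : Y n) : 0 ≤ envelope y := by
  rw [envelope]; positivity

/-- The weight with indices `2, 1` dominates `(1 + a²)(1 + b²) / 2`, so a bound on this one weighted
supremum gives integrability over `𝕐ⁿ⁺¹`. -/
lemma norm_le_envelope {c C : ℝ} {y : Y n} (h : wt 2 1 y * c ≤ C) (hc : 0 ≤ c) :
    c ≤ 2 * C * envelope y := by
  have ha : 0 < (y.2.2 : ℝ) := y.2.2.2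
  have h1 : 1 + (y.2.2 : ℝ) ^ 2 ≤ 2 * ((y.2.2 : ℝ) ^ 2 + 1 / (y.2.2 : ℝ) ^ 2) := by
    have := pow_le_weight ha (i := 0) (s := 2) (by norm_num)
    have := pow_le_weight ha (i := 2) (s := 2) (by norm_num)
    linarith
  have h2 : (1 + y.2.1 ^ 2) * (1 + (y.2.2 : ℝ) ^ 2) ≤ 2 * wt 2 1 y := by
    rw [wt, pow_one]
    calc _ ≤ (1 + y.2.1 ^ 2) * (2 * ((y.2.2 : ℝ) ^ 2 + 1 / (y.2.2 : ℝ) ^ 2)) := by gcongr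
      _ = _ := by ring
  rw [envelope, one_mul, ← mul_inv, ← div_eq_mul_inv, le_div_iff₀ (by positivity)]
  nlinarith

/-- Continuous functions on `𝕐ⁿ⁺¹` of rapid decay in `b`, as `a → 0` and as `a → ∞`. -/
def RapidDecay (H : Y n → ℂ) : Prop :=
  Continuous H ∧ ∀ s r, ∃ C, ∀ y, wt s r y * ‖H y‖ ≤ C

lemma wt_mul_zpow_le (s r : ℕ) (j : ℤ) (y : Y n) :
    wt s r y * (y.2.2 : ℝ) ^ j ≤ 2 * wt (s + j.natAbs) r y := by
  have ha : 0 < (y.2.2 : ℝ) := y.2.2.2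
  rw [wt, wt]
  calc _ = ((y.2.2 : ℝ) ^ s + 1 / (y.2.2 : ℝ) ^ s) * (y.2.2 : ℝ) ^ j * (1 + y.2.1 ^ 2) ^ r := by ring
    _ ≤ 2 * ((y.2.2 : ℝ) ^ (s + j.natAbs) + 1 / (y.2.2 : ℝ) ^ (s + j.natAbs)) *
        (1 + y.2.1 ^ 2) ^ r :=
        mul_le_mul_of_nonneg_right (weight_mul_zpow_le ha j s) (by positivity)
    _ = _ := by ring

lemma wt_mul_abs_pow_le (s r i : ℕ) (y : Y n) :
    wt s r y * |y.2.1| ^ i ≤ wt s (r + i) y := by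
  have ha : 0 < (y.2.2 : ℝ) := y.2.2.2
  rw [wt, wt, mul_assoc, pow_add]
  gcongr
  nlinarith [sq_nonneg (|y.2.1| - 1), sq_abs y.2.1]

namespace RapidDecay

variable {H : Y n → ℂ}

lemma integrable (hH : RapidDecay H) : Integrable H (measY n) := by
  obtain ⟨C, hC⟩ := hH.2 2 1
  exact (integrable_envelope.const_mul (2 * C)).mono' hH.1.aestronglyMeasurable
    (Filter.Eventually.of_forall fun y => norm_le_envelope (hC y) (norm_nonneg _))

lemma integral_norm_le (hH : RapidDecay H) {C : ℝ} (hC : ∀ y, wt 2 1 y * ‖H y‖ ≤ C) :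
    ∫ y, ‖H y‖ ∂(measY n) ≤ C * (2 * ∫ y, envelope y ∂(measY n)) := by
  refine (integral_mono hH.integrable.norm (integrable_envelope.const_mul (2 * C))
    fun y => norm_le_envelope (hC y) (norm_nonneg _)).trans ?_
  rw [integral_const_mul]
  linarith

lemma mul_zpow (hH : RapidDecay H) {c : Y n → ℂ} (hc : Continuous c) {j : ℤ} {D : ℝ}
    (hD : ∀ y, ‖c y‖ ≤ D * (y.2.2 : ℝ) ^ j) : RapidDecay fun y => c y * H y := by
  refine ⟨hc.mul hH.1, fun s r => ?_⟩
  obtain ⟨C, hC⟩ := hH.2 (s + j.natAbs) r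
  refine ⟨2 * |D| * C, fun y => ?_⟩
  have hw := (wt_pos s r y).le
  have ha : 0 < (y.2.2 : ℝ) := y.2.2.2
  rw [norm_mul]
  calc wt s r y * (‖c y‖ * ‖H y‖) ≤ wt s r y * ((|D| * (y.2.2 : ℝ) ^ j) * ‖H y‖) := by
        gcongr
        exact (hD y).trans (by gcongr; exact le_abs_self D)
    _ = |D| * (wt s r y * (y.2.2 : ℝ) ^ j) * ‖H y‖ := by ring
    _ ≤ |D| * (2 * wt (s + j.natAbs) r y) * ‖H y‖ := by
        have := wt_mul_zpow_le s r j y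
        gcongr ?_ * ?_ * ?_
    _ = 2 * |D| * (wt (s + j.natAbs) r y * ‖H y‖) := by ring
    _ ≤ _ := by gcongr; exact hC y

end RapidDecay

lemma continuous_scale : Continuous (fun y : Y n => (y.2.2 : ℝ)) := by fun_prop

lemma scale_ne_zero (y : Y n) : (y.2.2 : ℝ) ≠ 0 := (show (0 : ℝ) < y.2.2 from y.2.2.2).ne'

/-- The factor produced by differentiating `ψ((z · u - b) / a)` in `z` in the direction `v`. -/
def dirFactor (v : E n) (y : Y n) : ℂ := ((inner ℝ (y.1 : E n) v / (y.2.2 : ℝ) : ℝ) : ℂ)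

lemma continuous_dirFactor (v : E n) : Continuous (dirFactor v) := by
  refine Complex.continuous_ofReal.comp (Continuous.div ?_ continuous_scale scale_ne_zero)
  fun_prop

lemma norm_dirFactor_le (v : E n) (y : Y n) : ‖dirFactor v y‖ ≤ ‖v‖ * (y.2.2 : ℝ) ^ (-1 : ℤ) := by
  have ha : 0 < (y.2.2 : ℝ) := y.2.2.2
  rw [dirFactor, Complex.norm_real, norm_div, Real.norm_of_nonneg ha.le, zpow_neg_one,
    div_eq_mul_inv]
  gcongr
  refine (norm_inner_le_norm _ _).trans (mul_le_of_le_one_left (norm_nonneg _) ?_)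
  exact (norm_eq_of_mem_sphere y.1).le

lemma RapidDecay.dirFactor_mul {H : Y n → ℂ} (hH : RapidDecay H) (v : E n) :
    RapidDecay fun y => dirFactor v y * H y :=
  hH.mul_zpow (continuous_dirFactor v) (norm_dirFactor_le v)

/-! ### The synthesis integral -/

/-- The value `(z · u - b) / a`. -/
def phase (z : E n) (y : Y n) : ℝ := (inner ℝ z (y.1 : E n) - y.2.1) / (y.2.2 : ℝ)

lemma continuous_phase (z : E n) : Continuous (phase z) := by
  refine Continuous.div ?_ continuous_scale scale_ne_zero
  fun_prop

/-- `∫ H(u,b,a) ψ((z · u - b) / a) du db da`. -/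
def synth (ψ : 𝓢(ℝ, ℂ)) (H : Y n → ℂ) (z : E n) : ℂ :=
  ∫ y, H y * ψ (phase z y) ∂(measY n)

lemma RapidDecay.integrable_synth {H : Y n → ℂ} (hH : RapidDecay H) (ψ : 𝓢(ℝ, ℂ)) (z : E n) :
    Integrable (fun y => H y * ψ (phase z y)) (measY n) := by
  obtain ⟨C, -, hC⟩ := exists_one_add_abs_pow_mul_le ψ 0
  exact hH.integrable.mul_bdd (c := C)
    (ψ.continuous.comp (continuous_phase z)).aestronglyMeasurable
    (Filter.Eventually.of_forall fun z => by simpa using hC _)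

/-- Only the boundedness of `ψ` is used, so the bound is uniform in `z`; integrability comes
entirely from `H`. -/
lemma exists_norm_synth_le (ψ : 𝓢(ℝ, ℂ)) : ∃ D, 0 ≤ D ∧ ∀ {H : Y n → ℂ} {C : ℝ}, RapidDecay H →
    (∀ y, wt 2 1 y * ‖H y‖ ≤ C) → ∀ z, ‖synth ψ H z‖ ≤ D * C := by
  obtain ⟨B, hB0, hB⟩ := exists_one_add_abs_pow_mul_le ψ 0
  refine ⟨B * (2 * ∫ y, envelope y ∂(measY n)), mul_nonneg hB0 (mul_nonneg zero_le_two
    (integral_nonneg envelope_nonneg)), fun {H C} hH hC z => ?_⟩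
  calc ‖synth ψ H z‖ ≤ ∫ y, ‖H y * ψ (phase z y)‖ ∂(measY n) := norm_integral_le_integral_norm _
    _ ≤ ∫ y, B * ‖H y‖ ∂(measY n) := by
        refine integral_mono (hH.integrable_synth ψ z).norm (hH.integrable.norm.const_mul B)
          fun y => ?_
        simp only [norm_mul, mul_comm B]
        gcongr
        simpa using hB (phase z y)
    _ ≤ B * (C * (2 * ∫ y, envelope y ∂(measY n))) := by
        rw [integral_const_mul]
        gcongr
        exact hH.integral_norm_le hC
    _ = _ := by ring

lemma hasFDerivAt_phase_left (z : E n) (y : Y n) :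
    HasFDerivAt (fun z : E n => phase z y) ((y.2.2 : ℝ)⁻¹ • innerSL ℝ (y.1 : E n)) z := by
  have := (((innerSL ℝ (y.1 : E n)).hasFDerivAt (x := z)).sub_const y.2.1).const_smul
    (y.2.2 : ℝ)⁻¹
  refine this.congr_of_eventuallyEq (Filter.Eventually.of_forall fun z => ?_)
  simp [phase, real_inner_comm, div_eq_inv_mul]

/-- Differentiation under the integral sign. The new factor `(u · v) / a` preserves rapid decay, so
the class of synthesis integrals is closed under differentiation. -/
lemma fderiv_synth {H : Y n → ℂ} (hH : RapidDecay H) (ψ : 𝓢(ℝ, ℂ)) (z : E n) :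
    DifferentiableAt ℝ (synth ψ H) z ∧ ∀ v,
      fderiv ℝ (synth ψ H) z v = synth (sderiv ψ) (fun y => dirFactor v y * H y) z := by
  obtain ⟨C, hC0, hC⟩ := exists_one_add_abs_pow_mul_le (sderiv ψ) 0
  set F' : E n → Y n → (E n →L[ℝ] ℂ) := fun z y =>
    H y • ((y.2.2 : ℝ)⁻¹ • innerSL ℝ (y.1 : E n)).smulRight (sderiv ψ (phase z y)) with hF'
  have hinv : Continuous (fun y : Y n => (y.2.2 : ℝ)⁻¹) := continuous_scale.inv₀ scale_ne_zero
  have hmeas : AEStronglyMeasurable (F' z) (measY n) := by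
    refine Continuous.aestronglyMeasurable ?_
    have h1 : Continuous (fun y : Y n => (y.2.2 : ℝ)⁻¹ • innerSL ℝ (y.1 : E n)) := by fun_prop
    exact hH.1.smul (isBoundedBilinearMap_smulRight.continuous.comp₂ h1
      ((sderiv ψ).continuous.comp (continuous_phase z)))
  have hinvH : RapidDecay (fun y => (((y.2.2 : ℝ)⁻¹ : ℝ) : ℂ) * H y) :=
    hH.mul_zpow (Complex.continuous_ofReal.comp hinv) (j := -1) (D := 1) fun y => by
      have ha : 0 < (y.2.2 : ℝ) := y.2.2.2
      simp [abs_of_pos ha]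
  have hbound : Integrable (fun y => C * ‖(((y.2.2 : ℝ)⁻¹ : ℝ) : ℂ) * H y‖) (measY n) :=
    hinvH.integrable.norm.const_mul C
  have hle : ∀ y, ∀ z ∈ (univ : Set (E n)), ‖F' z y‖ ≤ C * ‖(((y.2.2 : ℝ)⁻¹ : ℝ) : ℂ) * H y‖ := by
    intro y z _
    have ha : 0 < (y.2.2 : ℝ) := y.2.2.2
    rw [hF', norm_smul, ContinuousLinearMap.norm_smulRight_apply, norm_smul, innerSL_apply_norm,
      norm_eq_of_mem_sphere y.1, mul_one, norm_mul, Complex.norm_real]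
    have := hC (phase z y)
    rw [pow_zero, one_mul] at this
    calc _ = ‖sderiv ψ (phase z y)‖ * (‖(y.2.2 : ℝ)⁻¹‖ * ‖H y‖) := by ring
      _ ≤ _ := by gcongr
  have key : HasFDerivAt (synth ψ H) (∫ y, F' z y ∂(measY n)) z := by
    refine hasFDerivAt_integral_of_dominated_of_fderiv_le Filter.univ_mem
      (Filter.Eventually.of_forall fun z => (hH.integrable_synth ψ z).aestronglyMeasurable)
      (hH.integrable_synth ψ z) hmeas (Filter.Eventually.of_forall hle) hbound
      (Filter.Eventually.of_forall fun y z _ => ?_)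
    refine ((((hasDerivAt_sderiv ψ _).hasFDerivAt).comp z
      (hasFDerivAt_phase_left z y)).const_mul (H y)).congr_fderiv ?_
    ext v
    simp [hF', mul_assoc]
  refine ⟨key.differentiableAt, fun v => ?_⟩
  have hi : Integrable (F' z) (measY n) := hbound.mono' hmeas
    (Filter.Eventually.of_forall fun y => hle y z (mem_univ z))
  rw [key.fderiv, ContinuousLinearMap.integral_apply hi, synth]
  refine integral_congr_ae (Filter.Eventually.of_forall fun y => ?_)
  simp [hF', dirFactor]
  ring

lemma contDiff_synth_nat (N : ℕ) : ∀ {H : Y n → ℂ}, RapidDecay H → ∀ ψ : 𝓢(ℝ, ℂ),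
    ContDiff ℝ N (synth ψ H) := by
  induction N with
  | zero =>
    intro H hH ψ
    exact contDiff_zero.2 (continuous_iff_continuousAt.2 fun z =>
      (fderiv_synth hH ψ z).1.continuousAt)
  | succ N ih =>
    intro H hH ψ
    push_cast
    rw [contDiff_succ_iff_fderiv_apply]
    refine ⟨fun z => (fderiv_synth hH ψ z).1, by simp, fun v => ?_⟩
    simp only [(fderiv_synth hH ψ _).2]
    exact ih (hH.dirFactor_mul v) _

lemma contDiff_synth {H : Y n → ℂ} (hH : RapidDecay H) (ψ : 𝓢(ℝ, ℂ)) :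
    ContDiff ℝ ∞ (synth ψ H) :=
  contDiff_infty.2 fun N => contDiff_synth_nat N hH ψ

lemma synth_add {H H' : Y n → ℂ} (hH : RapidDecay H) (hH' : RapidDecay H') (ψ : 𝓢(ℝ, ℂ)) :
    synth ψ (H + H') = synth ψ H + synth ψ H' := by
  funext z
  simp only [synth, Pi.add_apply]
  rw [← integral_add (hH.integrable_synth ψ z) (hH'.integrable_synth ψ z)]
  simp [add_mul]

lemma synth_smul (c : ℂ) (H : Y n → ℂ) (ψ : 𝓢(ℝ, ℂ)) :
    synth ψ (c • H) = c • synth ψ H := by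
  funext z
  simp only [synth, Pi.smul_apply, smul_eq_mul]
  rw [← integral_const_mul]
  simp [mul_assoc]

/-! ### Bounds for iterated derivatives -/

/-- The derivative of `f` is the sum of the partial derivatives times the coordinate functionals,
which have norm at most one. -/
lemma norm_iteratedFDeriv_succ_le_sum {F : Type*} [NormedAddCommGroup F] [NormedSpace ℝ F]
    {f : E n → F} (hf : ContDiff ℝ ∞ f) (m : ℕ) (x : E n) :
    ‖iteratedFDeriv ℝ (m + 1) f x‖ ≤
      ∑ i, ‖iteratedFDeriv ℝ m (fun y => fderiv ℝ f y (EuclideanSpace.single i 1)) x‖ := by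
  set π : Fin n → (E n →L[ℝ] ℝ) := fun i => EuclideanSpace.proj i
  set g : Fin n → E n → F := fun i y => fderiv ℝ f y (EuclideanSpace.single i 1)
  have hg : ∀ i, ContDiff ℝ ∞ (g i) := fun i =>
    (hf.fderiv_right (m := ∞) (by simp)).clm_apply contDiff_const
  set L : Fin n → (F →L[ℝ] (E n →L[ℝ] F)) := fun i => ContinuousLinearMap.smulRightL ℝ (E n) F (π i)
  have hL : ∀ i, ‖L i‖ ≤ 1 := by
    intro i
    refine ContinuousLinearMap.opNorm_le_bound _ zero_le_one fun c => ?_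
    change ‖(π i).smulRight c‖ ≤ _
    rw [ContinuousLinearMap.norm_smulRight_apply]
    gcongr
    exact ContinuousLinearMap.opNorm_le_bound _ zero_le_one fun v => by
      simpa [π] using PiLp.norm_apply_le v i
  have e : fderiv ℝ f = fun y => ∑ i, (L i ∘ g i) y := by
    funext y
    refine ContinuousLinearMap.ext fun v => ?_
    have hv : v = ∑ i, v i • EuclideanSpace.single i (1 : ℝ) := by
      have := (EuclideanSpace.basisFun (Fin n) ℝ).sum_repr v
      simpa using this.symm
    rw [sum_apply]
    conv_lhs => rw [hv, map_sum]
    refine Finset.sum_congr rfl fun i _ => ?_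
    simp only [L, π, g, map_smul]
    rfl
  rw [← norm_iteratedFDeriv_fderiv]
  conv_lhs => rw [e]
  rw [iteratedFDeriv_fun_sum_apply fun i _ =>
    ((L i).contDiff.comp ((hg i).of_le (by exact_mod_cast le_top))).contDiffAt]
  refine (norm_sum_le _ _).trans (Finset.sum_le_sum fun i _ => ?_)
  refine ((L i).norm_iteratedFDeriv_comp_left (hg i).contDiffAt (by exact_mod_cast le_top)).trans ?_
  exact mul_le_of_le_one_left (norm_nonneg _) (hL i)

section Family

variable {V : Type*} [AddCommGroup V] [Module ℂ V] [TopologicalSpace V]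

/-- Families of functions of rapid decay on `𝕐ⁿ⁺¹`, with bounds given by continuous seminorms. -/
def DecayFamily (T : V → Y n → ℂ) : Prop :=
  (∀ v, Continuous (T v)) ∧ ∀ s r, SeminormBdd fun v y => wt s r y * ‖T v y‖

lemma DecayFamily.rapidDecay {T : V → Y n → ℂ} (hT : DecayFamily T) (v : V) : RapidDecay (T v) :=
  ⟨hT.1 v, fun s r => by
    obtain ⟨p, -, h⟩ := hT.2 s r
    exact ⟨p v, h v⟩⟩

lemma DecayFamily.dirFactor_mul {T : V → Y n → ℂ} (hT : DecayFamily T) (e : E n) :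
    DecayFamily fun v y => dirFactor e y * T v y := by
  refine ⟨fun v => (continuous_dirFactor e).mul (hT.1 v), fun s r => ?_⟩
  refine ((hT.2 (s + 1) r).const_mul (C := 2 * ‖e‖) (by positivity)).mono fun v y => ?_
  have hw := (wt_pos s r y).le
  rw [norm_mul]
  calc wt s r y * (‖dirFactor e y‖ * ‖T v y‖)
      ≤ wt s r y * ((‖e‖ * (y.2.2 : ℝ) ^ (-1 : ℤ)) * ‖T v y‖) := by
        gcongr
        exact norm_dirFactor_le e y
    _ = ‖e‖ * (wt s r y * (y.2.2 : ℝ) ^ (-1 : ℤ)) * ‖T v y‖ := by ring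
    _ ≤ ‖e‖ * (2 * wt (s + 1) r y) * ‖T v y‖ := by
        have : wt s r y * (y.2.2 : ℝ) ^ (-1 : ℤ) ≤ 2 * wt (s + 1) r y := wt_mul_zpow_le s r (-1) y
        gcongr ?_ * ?_ * ?_
    _ = _ := by ring

lemma DecayFamily.seminormBdd_iteratedFDeriv (m : ℕ) : ∀ {T : V → Y n → ℂ}, DecayFamily T →
    ∀ ψ : 𝓢(ℝ, ℂ), SeminormBdd fun v (x : E n) => ‖iteratedFDeriv ℝ m (synth ψ (T v)) x‖ := by
  induction m with
  | zero =>
    intro T hT ψ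
    obtain ⟨D, hD0, hD⟩ := exists_norm_synth_le (n := n) ψ
    lift D to NNReal using hD0
    obtain ⟨p, hp, h⟩ := hT.2 2 1
    exact ⟨D • p, hp.const_smul D, fun v x => by
      simp only [norm_iteratedFDeriv_zero]
      exact hD (hT.rapidDecay v) (h v) x⟩
  | succ m ih =>
    intro T hT ψ
    refine (SeminormBdd.sum Finset.univ fun i _ =>
      ih (hT.dirFactor_mul (EuclideanSpace.single i 1)) (sderiv ψ)).mono fun v x => ?_
    refine (norm_iteratedFDeriv_succ_le_sum (contDiff_synth (hT.rapidDecay v) ψ) m x).trans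
      (Finset.sum_le_sum fun i _ => ?_)
    simp only [(fderiv_synth (hT.rapidDecay v) ψ _).2]
    exact le_rfl

end Family

end

section

variable {n : ℕ}

/-! ### Green's formula on the sphere -/

lemma laplacian_eq_sum_fderiv {F : E n → ℂ} (hF : ContDiffOn ℝ ∞ F {0}ᶜ) {x : E n} (hx : x ≠ 0) :
    Laplacian.laplacian F x = ∑ i, fderiv ℝ
      (fun y => fderiv ℝ F y (EuclideanSpace.single i 1)) x (EuclideanSpace.single i 1) := by
  rw [InnerProductSpace.laplacian_eq_iteratedFDeriv_orthonormalBasis F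
    (EuclideanSpace.basisFun (Fin n) ℝ)]
  refine Finset.sum_congr rfl fun i _ => ?_
  have hd : DifferentiableAt ℝ (fderiv ℝ F) x :=
    ((hF.fderiv_of_isOpen (m := ∞) isOpen_compl_singleton (by simp)).contDiffAt
      (isOpen_compl_singleton.mem_nhds hx)).differentiableAt (by simp)
  rw [iteratedFDeriv_two_apply, fderiv_clm_apply hd (differentiableAt_const _)]
  simp

lemma contDiffOn_fderiv_dir {F : E n → ℂ} (hF : ContDiffOn ℝ ∞ F {0}ᶜ) (v : E n) :
    ContDiffOn ℝ ∞ (fun x => fderiv ℝ F x v) {0}ᶜ :=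
  (hF.fderiv_of_isOpen isOpen_compl_singleton (by simp)).clm_apply contDiffOn_const

lemma differentiableAt_of_ne_zero {F : E n → ℂ} (hF : ContDiffOn ℝ ∞ F {0}ᶜ) {x : E n}
    (hx : x ≠ 0) : DifferentiableAt ℝ F x :=
  (hF.contDiffAt (isOpen_compl_singleton.mem_nhds hx)).differentiableAt (by simp)

/-- The derivative of a function that is constant along rays vanishes in the radial direction. -/
lemma fderiv_radial_eq_zero {F : E n → ℂ} (hF : ContDiffOn ℝ ∞ F {0}ᶜ)
    (h0 : ∀ c : ℝ, 0 < c → ∀ x, F (c • x) = F x) {x : E n} (hx : x ≠ 0) : fderiv ℝ F x x = 0 := by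
  have h1 : HasDerivAt (fun t : ℝ => t • x) x 1 := by
    simpa using (hasDerivAt_id (1 : ℝ)).smul_const x
  have h2 : HasFDerivAt F (fderiv ℝ F x) ((1 : ℝ) • x) := by
    rw [one_smul]; exact (differentiableAt_of_ne_zero hF hx).hasFDerivAt
  have h3 : HasDerivAt (F ∘ fun t : ℝ => t • x) (fderiv ℝ F x x) 1 := h2.comp_hasDerivAt 1 h1
  have h4 : (F ∘ fun t : ℝ => t • x) =ᶠ[nhds 1] fun _ => F x := by
    filter_upwards [lt_mem_nhds (zero_lt_one' ℝ)] with t ht using h0 t ht x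
  exact (h3.congr_of_eventuallyEq h4.symm).unique (hasDerivAt_const 1 (F x))

/-- The Laplacian of a function constant along rays is homogeneous of degree `-2`. -/
lemma laplacian_smul_of_ray {F : E n → ℂ} (hF : ContDiffOn ℝ ∞ F {0}ᶜ)
    (h0 : ∀ c : ℝ, 0 < c → ∀ x, F (c • x) = F x) {x : E n} (hx : x ≠ 0) {c : ℝ} (hc : 0 < c) :
    Laplacian.laplacian F (c • x) = ((c ^ 2)⁻¹ : ℝ) * Laplacian.laplacian F x := by
  have d1 : ∀ y, fderiv ℝ F (c • y) = c⁻¹ • fderiv ℝ F y := by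
    intro y
    have h := fderiv_comp_smul (𝕜 := ℝ) (f := F) (c := c) (x := y)
    have e : (fun y => F (c • y)) = F := funext fun y => h0 c hc y
    rw [e] at h
    rw [h, smul_smul, inv_mul_cancel₀ hc.ne', one_smul]
  have d2 : ∀ v, fderiv ℝ (fun y => fderiv ℝ F y v) (c • x) v =
      ((c ^ 2)⁻¹ : ℝ) * fderiv ℝ (fun y => fderiv ℝ F y v) x v := by
    intro v
    have h := fderiv_comp_smul (𝕜 := ℝ) (f := fun y => fderiv ℝ F y v) (c := c) (x := x)
    have e : (fun y => fderiv ℝ F (c • y) v) = fun y => c⁻¹ • fderiv ℝ F y v := by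
      funext y; rw [d1]; rfl
    rw [e, fderiv_fun_const_smul (differentiableAt_of_ne_zero (contDiffOn_fderiv_dir hF v) hx)] at h
    have h' := DFunLike.congr_fun h v
    simp only [smul_apply, Complex.real_smul] at h'
    have hcc : (c : ℂ) ≠ 0 := by exact_mod_cast hc.ne'
    push_cast at h' ⊢
    field_simp at h' ⊢
    linear_combination -h'
  rw [laplacian_eq_sum_fderiv hF hx, laplacian_eq_sum_fderiv hF (smul_ne_zero hc.ne' hx),
    Finset.mul_sum]
  exact Finset.sum_congr rfl fun i _ => d2 _

/-- A radial bump function supported away from the origin. -/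
def bump : ContDiffBump (1 : ℝ) := ⟨1 / 4, 1 / 2, by norm_num, by norm_num⟩

/-- A radial bump function on `ℝⁿ` supported away from the origin. -/
def radialBump (x : E n) : ℂ := (bump (‖x‖ ^ 2) : ℝ)

lemma contDiff_radialBump : ContDiff ℝ ∞ (radialBump (n := n)) :=
  Complex.ofRealCLM.contDiff.comp (bump.contDiff.comp (contDiff_id.norm_sq ℝ))

lemma radialBump_tsupport : tsupport (radialBump (n := n)) ⊆
    {x | 1 / 2 ≤ ‖x‖ ^ 2 ∧ ‖x‖ ^ 2 ≤ 3 / 2} := by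
  refine closure_minimal (fun x hx => ?_) ?_
  · have h1 : (‖x‖ ^ 2 : ℝ) ∈ Function.support (bump : ℝ → ℝ) := fun h0 => hx (by
      simp [radialBump, h0])
    rw [bump.support_eq, mem_ball, Real.dist_eq, abs_lt] at h1
    simp only [bump] at h1
    constructor <;> linarith [h1.1, h1.2]
  · have hc : Continuous (fun x : E n => ‖x‖ ^ 2) := by fun_prop
    exact (isClosed_le continuous_const hc).inter (isClosed_le hc continuous_const)

lemma radialBump_tsupport_ne {x : E n} (hx : x ∈ tsupport (radialBump (n := n))) : x ≠ 0 := by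
  rintro rfl
  have := (radialBump_tsupport hx).1
  norm_num at this

lemma hasCompactSupport_radialBump : HasCompactSupport (radialBump (n := n)) := by
  refine (isCompact_closedBall (0 : E n) 2).of_isClosed_subset (isClosed_tsupport _) fun x hx => ?_
  have := (radialBump_tsupport hx).2
  rw [mem_closedBall_zero_iff]
  nlinarith [norm_nonneg x]

lemma fderiv_comp_norm_sq {η : ℝ → ℝ} (x v : E n) (hη : DifferentiableAt ℝ η (‖x‖ ^ 2)) :
    fderiv ℝ (fun x : E n => ((η (‖x‖ ^ 2) : ℝ) : ℂ)) x v =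
      ((deriv η (‖x‖ ^ 2) * 2 : ℝ) : ℂ) * (inner ℝ x v : ℝ) := by
  have h1 : HasFDerivAt (fun x : E n => ‖x‖ ^ 2) (2 • innerSL ℝ x) x :=
    (hasStrictFDerivAt_norm_sq x).hasFDerivAt
  have h3 : HasFDerivAt (fun x : E n => ((η (‖x‖ ^ 2) : ℝ) : ℂ)) _ x :=
    Complex.ofRealCLM.hasFDerivAt.comp x (hη.hasDerivAt.comp_hasFDerivAt x h1)
  rw [h3.fderiv]
  simp
  ring

lemma fderiv_radialBump (x v : E n) :
    fderiv ℝ radialBump x v = ((deriv bump (‖x‖ ^ 2) * 2 : ℝ) : ℂ) * (inner ℝ x v : ℝ) :=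
  fderiv_comp_norm_sq x v ((bump.contDiffAt (n := 1)).differentiableAt (by simp))

lemma integrable_mul_of_tsupport {h k : E n → ℂ} (hc : Continuous h) (hs : HasCompactSupport h)
    (ht : ∀ x ∈ tsupport h, x ≠ 0) (hk : ContinuousOn k {0}ᶜ) :
    Continuous (fun x => h x * k x) ∧ Integrable (fun x => h x * k x) := by
  have hcont : Continuous (fun x => h x * k x) := by
    refine continuous_of_tsupport fun x hx => ?_
    have hx0 := ht x (tsupport_mul_subset_left hx)
    exact hc.continuousAt.mul (hk.continuousAt (isOpen_compl_singleton.mem_nhds hx0))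
  exact ⟨hcont, hcont.integrable_of_hasCompactSupport hs.mul_right⟩

/-- One integration by parts in the direction `v`. The bump provides compact support away from the
origin, where `F` and `G` may be singular. -/
lemma integral_radialBump_mul_second {F G : E n → ℂ} (hF : ContDiffOn ℝ ∞ F {0}ᶜ)
    (hG : ContDiffOn ℝ ∞ G {0}ᶜ) (v : E n) :
    Integrable (fun x => radialBump x * (F x * fderiv ℝ (fun y => fderiv ℝ G y v) x v)) ∧
    Integrable (fun x => fderiv ℝ radialBump x v * (F x * fderiv ℝ G x v)) ∧
    Integrable (fun x => radialBump x * (fderiv ℝ F x v * fderiv ℝ G x v)) ∧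
    ∫ x, radialBump x * (F x * fderiv ℝ (fun y => fderiv ℝ G y v) x v) =
      -((∫ x, fderiv ℝ radialBump x v * (F x * fderiv ℝ G x v)) +
        ∫ x, radialBump x * (fderiv ℝ F x v * fderiv ℝ G x v)) := by
  have hF1 := contDiffOn_fderiv_dir hF v
  have hG1 := contDiffOn_fderiv_dir hG v
  have hG2 := contDiffOn_fderiv_dir hG1 v
  have hb := contDiff_radialBump (n := n)
  have hts : ∀ x ∈ tsupport (fun x => fderiv ℝ (radialBump (n := n)) x v), x ≠ 0 := fun x hx =>
    radialBump_tsupport_ne (tsupport_fderiv_apply_subset ℝ v hx)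
  have i1 := (integrable_mul_of_tsupport hb.continuous hasCompactSupport_radialBump
    (fun x => radialBump_tsupport_ne) (hF.continuousOn.mul hG2.continuousOn)).2
  have i2 := (integrable_mul_of_tsupport
    ((hb.continuous_fderiv (by simp)).clm_apply continuous_const)
    (hasCompactSupport_radialBump.fderiv_apply ℝ v) hts (hF.continuousOn.mul hG1.continuousOn)).2
  have i3 := (integrable_mul_of_tsupport hb.continuous hasCompactSupport_radialBump
    (fun x => radialBump_tsupport_ne) (hF1.continuousOn.mul hG1.continuousOn)).2
  have i4 := (integrable_mul_of_tsupport hb.continuous hasCompactSupport_radialBump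
    (fun x => radialBump_tsupport_ne) (hF.continuousOn.mul hG1.continuousOn)).2
  simp only [Pi.mul_apply] at i1 i2 i3 i4
  refine ⟨i1, i2, i3, ?_⟩
  have i23 := i2.add i3
  have e1 : ∀ x, radialBump x * (F x * fderiv ℝ (fun y => fderiv ℝ G y v) x v) =
      (radialBump x * F x) * fderiv ℝ (fun y => fderiv ℝ G y v) x v := fun x => by ring
  have e2 : ∀ x, fderiv ℝ radialBump x v * (F x * fderiv ℝ G x v) +
      radialBump x * (fderiv ℝ F x v * fderiv ℝ G x v) =
      (fderiv ℝ radialBump x v * F x + radialBump x * fderiv ℝ F x v) * fderiv ℝ G x v :=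
    fun x => by ring
  simp only [Pi.add_def, e2] at i23
  rw [← integral_add i2 i3]
  simp only [e1, e2] at i1 ⊢
  refine integral_bilinear_hasLineDerivAt_right_eq_neg_left_of_integrable
    (B := ContinuousLinearMap.mul ℝ ℂ) (v := v)
    (f := fun x => radialBump x * F x) (g := fun x => fderiv ℝ G x v) i23 i1 ?_ ?_ ?_
  · simpa only [ContinuousLinearMap.mul_apply', mul_assoc] using i4
  · intro x _
    by_cases hx : x ∈ tsupport (radialBump (n := n))
    · have hx0 := radialBump_tsupport_ne hx
      have := ((hb.differentiable (by simp) x).hasFDerivAt.fun_mul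
        (differentiableAt_of_ne_zero hF hx0).hasFDerivAt).hasLineDerivAt v
      rw [add_apply, smul_apply, smul_apply, smul_eq_mul, smul_eq_mul] at this
      convert this using 1
      ring
    -- Off the support of the bump the product is locally zero, hence differentiable whatever `F`
    -- does there, in particular at the origin.
    · have hz : (fun x => radialBump x * F x) =ᶠ[nhds x] fun _ => 0 := by
        filter_upwards [notMem_tsupport_iff_eventuallyEq.1 hx] with y hy
        simp [hy]
      have h1 : radialBump x = 0 := image_eq_zero_of_notMem_tsupport hx
      have h2 : fderiv ℝ (radialBump (n := n)) x = 0 := by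
        rw [(notMem_tsupport_iff_eventuallyEq.1 hx).fderiv_eq]; simp
      rw [h1, h2]
      have h3 : HasFDerivAt (fun x => radialBump x * F x) (0 : E n →L[ℝ] ℂ) x :=
        (hasFDerivAt_const (𝕜 := ℝ) (0 : ℂ) x).congr_of_eventuallyEq hz
      simpa using h3.hasLineDerivAt v
  · intro x hx
    have hx0 := radialBump_tsupport_ne (tsupport_mul_subset_left hx)
    exact (differentiableAt_of_ne_zero hG1 hx0).hasFDerivAt.hasLineDerivAt v

/-- The gradient of the bump is radial, so the terms containing it sum to a multiple of the radial
derivative of `G`, which is zero. The remaining Dirichlet form is symmetric in `F` and `G`. -/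
lemma integral_radialBump_mul_laplacian {F G : E n → ℂ} (hF : ContDiffOn ℝ ∞ F {0}ᶜ)
    (hG : ContDiffOn ℝ ∞ G {0}ᶜ) (hG0 : ∀ c : ℝ, 0 < c → ∀ x, G (c • x) = G x) :
    ∫ x, radialBump x * (F x * Laplacian.laplacian G x) =
      -∑ i, ∫ x, radialBump x * (fderiv ℝ F x (EuclideanSpace.single i 1) *
        fderiv ℝ G x (EuclideanSpace.single i 1)) := by
  have h := fun i : Fin n => integral_radialBump_mul_second hF hG (EuclideanSpace.single i 1)
  have e : ∀ x, radialBump x * (F x * Laplacian.laplacian G x) = ∑ i, radialBump x * (F x *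
      fderiv ℝ (fun y => fderiv ℝ G y (EuclideanSpace.single i 1)) x
        (EuclideanSpace.single i 1)) := by
    intro x
    by_cases hx : x = 0
    · have : radialBump x = 0 := image_eq_zero_of_notMem_tsupport fun hx' =>
        radialBump_tsupport_ne hx' hx
      simp [this]
    · rw [laplacian_eq_sum_fderiv hG hx, Finset.mul_sum, Finset.mul_sum]
  have z : ∑ i, ∫ x, fderiv ℝ radialBump x (EuclideanSpace.single i 1) *
      (F x * fderiv ℝ G x (EuclideanSpace.single i 1)) = 0 := by
    rw [← integral_finsetSum _ fun i _ => (h i).2.1]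
    refine integral_eq_zero_of_ae (Filter.Eventually.of_forall fun x => ?_)
    by_cases hx : x = 0
    · subst hx
      simp [fderiv_radialBump]
    · have hv : x = ∑ i, x i • EuclideanSpace.single i (1 : ℝ) := by
        have := (EuclideanSpace.basisFun (Fin n) ℝ).sum_repr x
        simpa using this.symm
      have h0 := fderiv_radial_eq_zero hG hG0 hx
      rw [show fderiv ℝ G x x = fderiv ℝ G x (∑ i, x i • EuclideanSpace.single i (1 : ℝ)) by
        rw [← hv], map_sum] at h0
      simp only [map_smul, Complex.real_smul] at h0
      have : ∀ i : Fin n, fderiv ℝ radialBump x (EuclideanSpace.single i 1) *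
          (F x * fderiv ℝ G x (EuclideanSpace.single i 1)) =
          (((deriv bump (‖x‖ ^ 2) * 2 : ℝ) : ℂ) * F x) *
            ((x i : ℂ) * fderiv ℝ G x (EuclideanSpace.single i 1)) := by
        intro i
        rw [fderiv_radialBump, EuclideanSpace.inner_single_right]
        simp
        ring
      simp only [this]
      rw [← Finset.mul_sum, h0, mul_zero]
      rfl
  simp only [e]
  rw [integral_finsetSum _ fun i _ => (h i).1]
  simp only [(h _).2.2.2]
  rw [Finset.sum_neg_distrib, Finset.sum_add_distrib, z, zero_add]

/-- Polar coordinates for the product of a radial bump and a function homogeneous of degree `-2`. -/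
lemma integral_radialBump_mul_homogeneous (hn : n ≠ 0) : ∃ c : ℂ, c ≠ 0 ∧ ∀ k : E n → ℂ,
    (∀ x, x ≠ 0 → ∀ r : ℝ, 0 < r → k (r • x) = ((r ^ 2)⁻¹ : ℝ) * k x) →
    ∫ x, radialBump x * k x = c * ∫ u : sphere (0 : E n) 1, k u ∂(volume : Measure (E n)).toSphere := by
  have : NeZero n := ⟨hn⟩
  set ν := Measure.volumeIoiPow (Module.finrank ℝ (E n) - 1)
  set c : ℂ := ∫ r : Ioi (0 : ℝ), ((bump ((r : ℝ) ^ 2) * ((r : ℝ) ^ 2)⁻¹ : ℝ) : ℂ) ∂ν with hc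
  have hpol : ∀ k : E n → ℂ,
      (∀ x, x ≠ 0 → ∀ r : ℝ, 0 < r → k (r • x) = ((r ^ 2)⁻¹ : ℝ) * k x) →
      ∫ x, radialBump x * k x =
        c * ∫ u : sphere (0 : E n) 1, k u ∂(volume : Measure (E n)).toSphere := by
    intro k hk
    calc ∫ x, radialBump x * k x
        = ∫ x : ({(0 : E n)}ᶜ : Set (E n)), radialBump x.1 * k x.1 ∂((volume : Measure (E n)).comap (↑)) := by
          rw [integral_subtype_comap (measurableSet_singleton _).compl
            fun x => radialBump x * k x, restrict_compl_singleton]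
      _ = ∫ q, k q.1 * ((bump ((q.2 : ℝ) ^ 2) * ((q.2 : ℝ) ^ 2)⁻¹ : ℝ) : ℂ)
            ∂((volume : Measure (E n)).toSphere.prod ν) := by
          rw [← (volume : Measure (E n)).measurePreserving_homeomorphUnitSphereProd.integral_comp
            (Homeomorph.measurableEmbedding _)]
          refine integral_congr_ae (Filter.Eventually.of_forall fun x => ?_)
          have hx : 0 < ‖(x : E n)‖ := norm_pos_iff.2 x.2
          have h1 := hk (‖(x : E n)‖⁻¹ • (x : E n)) (smul_ne_zero (inv_ne_zero hx.ne') x.2) _ hx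
          rw [smul_smul, mul_inv_cancel₀ hx.ne', one_smul] at h1
          simp only [homeomorphUnitSphereProd_apply_fst_coe,
            homeomorphUnitSphereProd_apply_snd_coe, radialBump]
          rw [h1]
          push_cast
          ring
      _ = _ := by rw [integral_prod_mul (fun u : sphere (0 : E n) 1 => k u)
          (fun r : Ioi (0 : ℝ) => ((bump ((r : ℝ) ^ 2) * ((r : ℝ) ^ 2)⁻¹ : ℝ) : ℂ)), mul_comm]
  refine ⟨c, fun h0 => ?_, hpol⟩
  -- If `c` were zero, this test function would make the integral of a continuous, nonnegative, not
  -- identically zero function vanish.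
  have h1 := hpol (fun x => ((‖x‖ ^ 2)⁻¹ : ℝ)) fun x hx r hr => by
    rw [norm_smul, Real.norm_of_nonneg hr.le, mul_pow, mul_inv]; push_cast; ring
  rw [h0, zero_mul] at h1
  have hcont : ContinuousOn (fun x : E n => (((‖x‖ ^ 2)⁻¹ : ℝ) : ℂ)) {0}ᶜ :=
    Complex.continuous_ofReal.comp_continuousOn
      (ContinuousOn.inv₀ (by fun_prop) fun x hx => by simpa using hx)
  have hf := (integrable_mul_of_tsupport contDiff_radialBump.continuous
    hasCompactSupport_radialBump (fun x => radialBump_tsupport_ne) hcont).1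
  set f : E n → ℝ := fun x => bump (‖x‖ ^ 2) * (‖x‖ ^ 2)⁻¹ with hfdef
  have hfe : ∀ x : E n, radialBump x * (((‖x‖ ^ 2)⁻¹ : ℝ) : ℂ) = (f x : ℂ) := fun x => by
    simp [radialBump, hfdef]
  simp only [hfe] at h1 hf
  rw [integral_complex_ofReal, Complex.ofReal_eq_zero] at h1
  have hfc : Continuous f := by
    have := Complex.continuous_re.comp hf
    simpa [Function.comp_def] using this
  have hcs : HasCompactSupport f := by
    have : HasCompactSupport (fun x : E n => bump (‖x‖ ^ 2)) :=
      (hasCompactSupport_radialBump (n := n)).comp_left (g := Complex.re) rfl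
    exact this.mul_right
  obtain ⟨i⟩ : Nonempty (Fin n) := inferInstance
  have hpos := hfc.integral_pos_of_hasCompactSupport_nonneg_nonzero (μ := volume) hcs
    (fun x => mul_nonneg bump.nonneg (by positivity)) (x := EuclideanSpace.single i 1) (by
      have : (bump : ℝ → ℝ) 1 = 1 := bump.one_of_mem_closedBall (by simp [bump])
      simp [hfdef, this])
  exact hpos.ne' h1

/-- The Laplace–Beltrami operator of the sphere is symmetric. -/
theorem integral_sphere_mul_laplacian_comm (hn : n ≠ 0) {F G : E n → ℂ}
    (hF : ContDiffOn ℝ ∞ F {0}ᶜ) (hF0 : ∀ c : ℝ, 0 < c → ∀ x, F (c • x) = F x)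
    (hG : ContDiffOn ℝ ∞ G {0}ᶜ) (hG0 : ∀ c : ℝ, 0 < c → ∀ x, G (c • x) = G x) :
    ∫ u : sphere (0 : E n) 1, F u * Laplacian.laplacian G (u : E n) ∂(volume : Measure (E n)).toSphere =
      ∫ u : sphere (0 : E n) 1, Laplacian.laplacian F (u : E n) * G u
        ∂(volume : Measure (E n)).toSphere := by
  obtain ⟨c, hc, h⟩ := integral_radialBump_mul_homogeneous hn
  have h1 := integral_radialBump_mul_laplacian hF hG hG0
  have h2 := integral_radialBump_mul_laplacian hG hF hF0
  -- The product of a function constant along rays and a Laplacian of such a function is homogeneous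
  -- of degree `-2`, so polar coordinates turn the volume integral into `c` times the integral over
  -- the sphere.
  rw [h _ fun x hx r hr => by rw [hF0 r hr, laplacian_smul_of_ray hG hG0 hx hr]; ring] at h1
  rw [h _ fun x hx r hr => by rw [hG0 r hr, laplacian_smul_of_ray hF hF0 hx hr]; ring] at h2
  have h3 : c * ∫ u : sphere (0 : E n) 1, F u * Laplacian.laplacian G (u : E n)
      ∂(volume : Measure (E n)).toSphere = c * ∫ u : sphere (0 : E n) 1,
      G u * Laplacian.laplacian F (u : E n) ∂(volume : Measure (E n)).toSphere := by
    rw [h1, h2]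
    simp only [mul_comm (fderiv ℝ F _ _)]
  simpa only [mul_comm (G _)] using mul_left_cancel₀ hc h3

end

section

variable {n : ℕ}

/-! ### Decay from bounds on the derivatives of the products with `(1 + ‖x‖²) ^ N` -/

lemma norm_iteratedFDeriv_pow_le {N m i : ℕ} (hi : i ≤ m) (hm : m ≤ N) (hN : 1 ≤ N) {y : ℝ}
    (hy0 : 0 ≤ y) (hy1 : y ≤ 1) :
    ‖iteratedFDeriv ℝ i (fun y : ℝ => y ^ N) y‖ ≤ (N : ℝ) ^ m * y ^ (N - m) := by
  have hN' : (1 : ℝ) ≤ N := by exact_mod_cast hN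
  rw [norm_iteratedFDeriv_eq_norm_iteratedDeriv, iteratedDeriv_eq_iterate, iter_deriv_pow,
    norm_mul, norm_prod, Real.norm_of_nonneg (by positivity : 0 ≤ y ^ (N - i))]
  have h1 : ∏ j ∈ Finset.range i, ‖(N : ℝ) - j‖ ≤ (N : ℝ) ^ m := by
    refine (Finset.prod_le_prod (g := fun _ => (N : ℝ)) (fun j _ => norm_nonneg _)
      fun j hj => ?_).trans ?_
    · have : (j : ℝ) ≤ N := by
        exact_mod_cast ((Finset.mem_range.1 hj).le.trans hi).trans hm
      rw [Real.norm_of_nonneg (by linarith)]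
      linarith [(Nat.cast_nonneg j : (0 : ℝ) ≤ j)]
    · rw [Finset.prod_const, Finset.card_range]
      exact pow_le_pow_right₀ hN' hi
  have h2 : y ^ (N - i) ≤ y ^ (N - m) := pow_le_pow_of_le_one hy0 hy1 (by omega)
  gcongr

/-- With `h = (1 + ‖x‖²)⁻¹`, up to `m` derivatives of `h ^ N` leave a factor `h ^ (N - m)` and cost
a power of `1 + ‖x‖` independent of `N`. A large `N` therefore wins. -/
lemma exists_pow_mul_iteratedFDeriv_inv_pow_le (n m k : ℕ) : ∃ (N : ℕ) (C : ℝ), 0 ≤ C ∧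
    ∀ j ≤ m, ∀ x : E n,
      ‖x‖ ^ k * ‖iteratedFDeriv ℝ j (fun x : E n => ((1 + ‖x‖ ^ 2)⁻¹) ^ N) x‖ ≤ C := by
  have ht : (fun x : E n => (1 + ‖x‖ ^ 2)⁻¹).HasTemperateGrowth := by
    simpa only [Real.rpow_neg_one] using
      Function.hasTemperateGrowth_one_add_norm_sq_rpow (H := E n) (-1)
  obtain ⟨k₀, C₀, hC₀, h₀⟩ := ht.norm_iteratedFDeriv_le_uniform m
  -- The growth is at most `(1 + ‖x‖) ^ (k + k₀ * m)`, which `h ^ M` beats by `(1 + ‖x‖) h ≤ 2`. The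
  -- extra `1` ensures `1 ≤ N`.
  set M := k + k₀ * m + 1
  set N := m + M
  refine ⟨N, m.factorial * (N : ℝ) ^ m * (1 + C₀) ^ m * 2 ^ M, by positivity, fun j hj x => ?_⟩
  set h : ℝ := (1 + ‖x‖ ^ 2)⁻¹
  have hh0 : 0 ≤ h := by positivity
  have hh1 : h ≤ 1 := inv_le_one_of_one_le₀ (by nlinarith [sq_nonneg ‖x‖])
  -- The bound for derivatives of a composition needs `D ^ i` for the `i`-th derivative; `1 + C₀`
  -- instead of `C₀` makes `D ≥ 1`, hence `D ≤ D ^ i`.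
  set D : ℝ := (1 + C₀) * (1 + ‖x‖) ^ k₀
  have hone : 1 ≤ (1 + ‖x‖) ^ k₀ := one_le_pow₀ (by linarith [norm_nonneg x])
  have hD : 1 ≤ D := one_le_mul_of_one_le_of_one_le (by linarith) hone
  have key := norm_iteratedFDeriv_comp_le (g := fun y : ℝ => y ^ N)
    (f := fun x : E n => (1 + ‖x‖ ^ 2)⁻¹) (N := ∞) (n := j) (contDiff_id.pow N) ht.1
    (by exact_mod_cast le_top) x (C := (N : ℝ) ^ m * h ^ (N - m)) (D := D)
    (fun i hi => norm_iteratedFDeriv_pow_le (hi.trans hj) (by omega) (by omega) hh0 hh1)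
    (fun i hi hij => (h₀ i (hij.trans hj) x).trans <| by
      calc C₀ * (1 + ‖x‖) ^ k₀ ≤ D := by simp only [D]; gcongr; linarith
        _ ≤ D ^ i := le_self_pow₀ hD (by omega))
  have hfac : (j.factorial : ℝ) ≤ m.factorial := by exact_mod_cast Nat.factorial_le hj
  have hNm : N - m = M := by omega
  rw [hNm] at key
  have hbase : (1 + ‖x‖) * h ≤ 2 := by
    rw [← div_eq_mul_inv, div_le_iff₀ (by positivity)]
    nlinarith [sq_nonneg (‖x‖ - 1), sq_nonneg ‖x‖]
  calc _ ≤ ‖x‖ ^ k * (j.factorial * ((N : ℝ) ^ m * h ^ M) * D ^ j) := by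
        gcongr
        exact key
    _ ≤ (1 + ‖x‖) ^ k * (m.factorial * ((N : ℝ) ^ m * h ^ M) * D ^ m) := by
        gcongr
        linarith
    _ = m.factorial * (N : ℝ) ^ m * (1 + C₀) ^ m * ((1 + ‖x‖) ^ (k + k₀ * m) * h ^ M) := by
        simp only [D, mul_pow, pow_add, pow_mul]
        ring
    _ ≤ m.factorial * (N : ℝ) ^ m * (1 + C₀) ^ m * ((1 + ‖x‖) ^ M * h ^ M) := by
        gcongr
        · linarith [norm_nonneg x]
        · omega
    _ ≤ _ := by
        rw [← mul_pow]
        gcongr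

/-- Leibniz rule for `g` written as `(1 + ‖x‖²)⁻ᴺ` times `(1 + ‖x‖²)ᴺ g`. It allows the weight to
stay inside the derivative, where `norm_sq_smul_synth` applies directly. -/
lemma seminormBdd_pow_mul_iteratedFDeriv {V : Type*} [AddCommGroup V] [Module ℂ V]
    [TopologicalSpace V] {g : V → E n → ℂ} (hg : ∀ v, ContDiff ℝ ∞ (g v))
    (h : ∀ N m, SeminormBdd fun v (x : E n) =>
      ‖iteratedFDeriv ℝ m (fun x => ((1 + ‖x‖ ^ 2) ^ N : ℝ) • g v x) x‖) (k m : ℕ) :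
    SeminormBdd fun v (x : E n) => ‖x‖ ^ k * ‖iteratedFDeriv ℝ m (g v) x‖ := by
  obtain ⟨N, C, hC0, hC⟩ := exists_pow_mul_iteratedFDeriv_inv_pow_le n m k
  refine (SeminormBdd.sum (Finset.range (m + 1)) fun i _ =>
    (h N (m - i)).const_mul (C := m.choose i * C) (by positivity)).mono fun v x => ?_
  have hinv : ContDiff ℝ ∞ (fun x : E n => ((1 + ‖x‖ ^ 2)⁻¹) ^ N) :=
    (ContDiff.inv (contDiff_const.add (contDiff_norm_sq ℝ)) fun x => by positivity).pow N
  have hq : ContDiff ℝ ∞ (fun x : E n => ((1 + ‖x‖ ^ 2) ^ N : ℝ) • g v x) :=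
    ((contDiff_const.add (contDiff_norm_sq ℝ)).pow N).smul (hg v)
  have e : g v = fun x => ((1 + ‖x‖ ^ 2)⁻¹) ^ N • (((1 + ‖x‖ ^ 2) ^ N : ℝ) • g v x) := by
    funext x
    rw [smul_smul, inv_pow, inv_mul_cancel₀ (by positivity), one_smul]
  have := norm_iteratedFDeriv_smul_le hinv hq x (n := m) (by exact_mod_cast le_top)
  rw [← e] at this
  calc _ ≤ ‖x‖ ^ k * _ := mul_le_mul_of_nonneg_left this (by positivity)
    _ ≤ _ := by
      rw [Finset.mul_sum]
      refine Finset.sum_le_sum fun i hi => ?_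
      have := hC i (by simp at hi; omega) x
      calc _ = m.choose i * (‖x‖ ^ k * ‖iteratedFDeriv ℝ i (fun x : E n => ((1 + ‖x‖ ^ 2)⁻¹) ^ N) x‖) *
            ‖iteratedFDeriv ℝ (m - i) (fun x => ((1 + ‖x‖ ^ 2) ^ N : ℝ) • g v x) x‖ := by ring
        _ ≤ _ := by gcongr

end

section

variable {n : ℕ}

/-! ### The spherical Laplacian of ridge functions -/

lemma fderiv_eq_of_hasDerivAt_line {F : E n → ℂ} {x v : E n} {c : ℂ} (hF : DifferentiableAt ℝ F x)
    (h : HasDerivAt (fun τ : ℝ => F (x + τ • v)) c 0) : fderiv ℝ F x v = c :=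
  (hF.hasFDerivAt.hasLineDerivAt v).unique h

lemma hasDerivAt_inner_line (z x v : E n) (τ : ℝ) :
    HasDerivAt (fun τ : ℝ => inner ℝ z (x + τ • v)) (inner ℝ z v) τ := by
  simp only [inner_add_right, inner_smul_right]
  simpa using ((hasDerivAt_id τ).mul_const (inner ℝ z v)).const_add (inner ℝ z x)

lemma hasDerivAt_inv_norm_line {x : E n} (hx : x ≠ 0) (v : E n) :
    HasDerivAt (fun τ : ℝ => ‖x + τ • v‖⁻¹) (-(‖x‖⁻¹ ^ 3 * inner ℝ x v)) 0 := by
  have h0 : ‖x‖ ≠ 0 := norm_ne_zero_iff.2 hx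
  have h1 : HasDerivAt (fun τ : ℝ => ‖x + τ • v‖ ^ 2) (2 * inner ℝ x v) 0 := by
    have := (((hasDerivAt_id (0 : ℝ)).smul_const v).const_add x).norm_sq
    simpa using this
  have h2 := (h1.sqrt (by simpa using h0)).inv (by simpa using h0)
  simp only [Real.sqrt_sq (norm_nonneg _)] at h2
  refine h2.congr_deriv ?_
  simp
  field_simp

/-- The ridge function `x ↦ Ψ((z · x / ‖x‖ - b) / a)`. -/
def sphRidge (Ψ : 𝓢(ℝ, ℂ)) (z : E n) (b a : ℝ) (x : E n) : ℂ :=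
  Ψ ((‖x‖⁻¹ * inner ℝ z x - b) / a)

lemma sphRidge_smul (Ψ : 𝓢(ℝ, ℂ)) (z : E n) (b a c : ℝ) (hc : 0 < c) (x : E n) :
    sphRidge Ψ z b a (c • x) = sphRidge Ψ z b a x := by
  simp only [sphRidge, norm_smul, inner_smul_right, Real.norm_of_nonneg hc.le]
  congr 2
  field_simp

lemma contDiffOn_sphRidge (Ψ : 𝓢(ℝ, ℂ)) (z : E n) (b a : ℝ) :
    ContDiffOn ℝ ∞ (sphRidge Ψ z b a) {0}ᶜ := by
  intro x hx
  have h1 : ContDiffAt ℝ ∞ (fun x : E n => ‖x‖⁻¹) x :=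
    (contDiffAt_id.norm ℝ hx).inv (norm_ne_zero_iff.2 hx)
  have h2 : ContDiffAt ℝ ∞ (fun x : E n => (‖x‖⁻¹ * inner ℝ z x - b) / a) x :=
    ((h1.mul (contDiffAt_const.inner ℝ contDiffAt_id)).sub contDiffAt_const).div_const a
  exact ((SchwartzMap.smooth Ψ ⊤).contDiffAt.comp x h2).contDiffWithinAt

lemma hasDerivAt_sphRidge_line (Ψ : 𝓢(ℝ, ℂ)) (z : E n) (b a : ℝ) {x : E n} (hx : x ≠ 0) (v : E n) :
    HasDerivAt (fun τ : ℝ => sphRidge Ψ z b a (x + τ • v))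
      (sphRidge (sderiv Ψ) z b a x *
        (((‖x‖⁻¹ * inner ℝ z v - ‖x‖⁻¹ ^ 3 * inner ℝ x v * inner ℝ z x) / a : ℝ) : ℂ)) 0 := by
  have h1 := (((hasDerivAt_inv_norm_line hx v).fun_mul (hasDerivAt_inner_line z x v 0)).sub_const
    b).div_const a
  have h2 := (hasDerivAt_sderiv Ψ ((‖x + (0 : ℝ) • v‖⁻¹ * inner ℝ z (x + (0 : ℝ) • v) - b) / a)).scomp
    (0 : ℝ) h1
  refine h2.congr_deriv ?_
  simp only [zero_smul, add_zero, sphRidge, Complex.real_smul]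
  rw [mul_comm]
  congr 2
  ring

lemma fderiv_sphRidge (Ψ : 𝓢(ℝ, ℂ)) (z : E n) (b a : ℝ) {x : E n} (hx : x ≠ 0) (v : E n) :
    fderiv ℝ (sphRidge Ψ z b a) x v = sphRidge (sderiv Ψ) z b a x *
      (((‖x‖⁻¹ * inner ℝ z v - ‖x‖⁻¹ ^ 3 * inner ℝ x v * inner ℝ z x) / a : ℝ) : ℂ) :=
  fderiv_eq_of_hasDerivAt_line (differentiableAt_of_ne_zero (contDiffOn_sphRidge Ψ z b a) hx)
    (hasDerivAt_sphRidge_line Ψ z b a hx v)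

lemma fderiv_fderiv_sphRidge (Ψ : 𝓢(ℝ, ℂ)) (z : E n) (b a : ℝ) {x : E n} (hx : ‖x‖ = 1) (v : E n) :
    fderiv ℝ (fun y => fderiv ℝ (sphRidge Ψ z b a) y v) x v =
      sphRidge (sderiv (sderiv Ψ)) z b a x *
        (((inner ℝ z v - inner ℝ x v * inner ℝ z x) / a : ℝ) : ℂ) ^ 2 +
      sphRidge (sderiv Ψ) z b a x *
        (((3 * inner ℝ x v ^ 2 * inner ℝ z x - 2 * (inner ℝ x v * inner ℝ z v) -
          ‖v‖ ^ 2 * inner ℝ z x) / a : ℝ) : ℂ) := by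
  have hx0 : x ≠ 0 := by rintro rfl; simp at hx
  refine fderiv_eq_of_hasDerivAt_line
    (differentiableAt_of_ne_zero (contDiffOn_fderiv_dir (contDiffOn_sphRidge Ψ z b a) v) hx0) ?_
  have hi := hasDerivAt_inv_norm_line hx0 v
  have hxv : HasDerivAt (fun τ : ℝ => inner ℝ (x + τ • v) v) (‖v‖ ^ 2) 0 := by
    have := hasDerivAt_inner_line v x v 0
    simpa only [real_inner_comm v, real_inner_self_eq_norm_sq] using this
  have h1 := ((hi.fun_mul (hasDerivAt_const (0 : ℝ) (inner ℝ z v))).sub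
    (((hi.fun_pow 3).fun_mul hxv).fun_mul (hasDerivAt_inner_line z x v 0))).div_const a
  have h2 := (hasDerivAt_sphRidge_line (sderiv Ψ) z b a hx0 v).fun_mul h1.ofReal_comp
  -- The line leaves the sphere, so the first derivative is needed at all nonzero points; `‖x‖ = 1`
  -- may be inserted only after differentiating again.
  have h3 : (fun τ : ℝ => fderiv ℝ (sphRidge Ψ z b a) (x + τ • v) v) =ᶠ[nhds 0] fun τ : ℝ =>
      sphRidge (sderiv Ψ) z b a (x + τ • v) *
      (((‖x + τ • v‖⁻¹ * inner ℝ z v - ‖x + τ • v‖⁻¹ ^ 3 * inner ℝ (x + τ • v) v *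
        inner ℝ z (x + τ • v)) / a : ℝ) : ℂ) := by
    have hc : ContinuousAt (fun τ : ℝ => x + τ • v) 0 := by fun_prop
    filter_upwards [hc.eventually_ne (by simpa using hx0)] with τ hτ
    exact fderiv_sphRidge Ψ z b a hτ v
  refine HasDerivAt.congr_of_eventuallyEq ?_ h3
  refine h2.congr_deriv ?_
  simp [hx]
  ring

lemma sum_inner_single_mul (z x : E n) :
    ∑ i, inner ℝ x (EuclideanSpace.single i (1 : ℝ)) * inner ℝ z (EuclideanSpace.single i 1) =
      inner ℝ z x := by
  have := (EuclideanSpace.basisFun (Fin n) ℝ).sum_inner_mul_inner x z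
  simp only [EuclideanSpace.basisFun_apply] at this
  rw [real_inner_comm, ← this]
  exact Finset.sum_congr rfl fun i _ => by rw [real_inner_comm z]

/-- Obtained by summing the second derivatives with Parseval's identity. Solved for the term with
`‖z‖²`, it expresses multiplication by `‖z‖²` through the spherical Laplacian and powers of `z · x`.
-/
lemma laplacian_sphRidge (Ψ : 𝓢(ℝ, ℂ)) (z : E n) (b : ℝ) {a : ℝ} (ha : a ≠ 0) {x : E n}
    (hx : ‖x‖ = 1) :
    (a : ℂ) ^ 2 * Laplacian.laplacian (sphRidge Ψ z b a) x =
      ((‖z‖ ^ 2 - inner ℝ z x ^ 2 : ℝ) : ℂ) * sphRidge (sderiv (sderiv Ψ)) z b a x -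
      (n - 1) * a * ((inner ℝ z x : ℝ) : ℂ) * sphRidge (sderiv Ψ) z b a x := by
  have hx0 : x ≠ 0 := by rintro rfl; simp at hx
  have ha' : (a : ℂ) ≠ 0 := by exact_mod_cast ha
  rw [laplacian_eq_sum_fderiv (contDiffOn_sphRidge Ψ z b a) hx0]
  simp only [fderiv_fderiv_sphRidge Ψ z b a hx]
  rw [Finset.sum_add_distrib, ← Finset.mul_sum, ← Finset.mul_sum]
  have s1 := sum_inner_single_mul z x
  have s2 := sum_inner_single_mul x x
  have s3 := sum_inner_single_mul z z
  rw [real_inner_self_eq_norm_sq] at s2 s3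
  rw [hx] at s2
  have e1 : ∑ i, (((inner ℝ z (EuclideanSpace.single i 1) -
      inner ℝ x (EuclideanSpace.single i 1) * inner ℝ z x) / a : ℝ) : ℂ) ^ 2 =
      (((‖z‖ ^ 2 - inner ℝ z x ^ 2) / a ^ 2 : ℝ) : ℂ) := by
    norm_cast
    rw [eq_div_iff (by positivity), Finset.sum_mul]
    have : ∀ i : Fin n, ((inner ℝ z (EuclideanSpace.single i (1 : ℝ)) -
        inner ℝ x (EuclideanSpace.single i (1 : ℝ)) * inner ℝ z x) / a) ^ 2 * a ^ 2 =
        inner ℝ z (EuclideanSpace.single i (1 : ℝ)) * inner ℝ z (EuclideanSpace.single i (1 : ℝ)) -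
        2 * inner ℝ z x * (inner ℝ x (EuclideanSpace.single i (1 : ℝ)) *
          inner ℝ z (EuclideanSpace.single i (1 : ℝ))) +
        inner ℝ z x ^ 2 * (inner ℝ x (EuclideanSpace.single i (1 : ℝ)) *
          inner ℝ x (EuclideanSpace.single i (1 : ℝ))) := by
      intro i
      field_simp
      ring
    simp only [this]
    rw [Finset.sum_add_distrib, Finset.sum_sub_distrib, ← Finset.mul_sum, ← Finset.mul_sum, s1, s2,
      s3]
    ring
  have e2 : ∑ i, (((3 * inner ℝ x (EuclideanSpace.single i 1) ^ 2 * inner ℝ z x -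
      2 * (inner ℝ x (EuclideanSpace.single i 1) * inner ℝ z (EuclideanSpace.single i 1)) -
      ‖EuclideanSpace.single i (1 : ℝ)‖ ^ 2 * inner ℝ z x) / a : ℝ) : ℂ) =
      ((-((n - 1) * inner ℝ z x) / a : ℝ) : ℂ) := by
    norm_cast
    rw [← Finset.sum_div]
    congr 1
    simp only [PiLp.norm_single, norm_one, one_pow, one_mul]
    rw [Finset.sum_sub_distrib, Finset.sum_sub_distrib, ← Finset.mul_sum, s1, ← Finset.sum_mul,
      ← Finset.mul_sum]
    simp only [pow_two (inner ℝ x _)]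
    rw [s2]
    simp
    ring
  rw [e1, e2]
  push_cast
  field_simp
  ring

end

section

variable {n : ℕ}

/-! ### Smooth functions of rapid decay on `𝕐ⁿ⁺¹` -/

lemma rayExt_incl (Φ : Y n → ℂ) (y : Y n) : rayExt Φ (incl y) = Φ y := by
  have hr : retract (incl y) (incl_mem y) = y := by
    refine Prod.ext (Subtype.ext ?_) rfl
    simp [retract, incl]
  rw [rayExt, dif_pos (incl_mem y), hr]

lemma SmoothY.continuous {Φ : Y n → ℂ} (h : SmoothY Φ) : Continuous Φ := by
  have hi : Continuous (incl (n := n)) := by unfold incl; fun_prop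
  have := ContDiffOn.continuousOn h
  refine (this.comp_continuous hi incl_mem).congr fun y => rayExt_incl Φ y

lemma SmoothY.contDiffOn_slice {Φ : Y n → ℂ} (h : SmoothY Φ) (b : ℝ) {a : ℝ} (ha : 0 < a) :
    ContDiffOn ℝ ∞ (fun x : E n => rayExt Φ (x, b, a)) {0}ᶜ :=
  ContDiffOn.comp (f := fun x : E n => (x, b, a)) h
    (contDiff_id.prodMk contDiff_const).contDiffOn fun _ hx => ⟨hx, ha⟩

lemma rayExt_ray (Φ : Y n → ℂ) (b a : ℝ) {c : ℝ} (hc : 0 < c) (x : E n) :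
    rayExt Φ (c • x, b, a) = rayExt Φ (x, b, a) := by
  by_cases hx : (x, b, a) ∈ Omega n
  · have hcx : (c • x, b, a) ∈ Omega n := ⟨smul_ne_zero hc.ne' hx.1, hx.2⟩
    have e : ret (c • x, b, a) = ret (x, b, a) := by
      simp only [ret, norm_smul, Real.norm_of_nonneg hc.le, smul_smul]
      congr 2
      field_simp
    rw [← rayExt_ret Φ hx, ← rayExt_ret Φ hcx, e]
  · have hcx : (c • x, b, a) ∉ Omega n := fun h =>
      hx ⟨fun h0 : x = 0 => h.1 (by simp [h0]), h.2⟩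
    simp [rayExt, hx, hcx]

/-- The function `b ^ i a ^ j` on `𝕐ⁿ⁺¹`. -/
def monoY (i : ℕ) (j : ℤ) (y : Y n) : ℂ := ((y.2.1 ^ i * (y.2.2 : ℝ) ^ j : ℝ) : ℂ)

lemma norm_monoY (i : ℕ) (j : ℤ) (y : Y n) : ‖monoY i j y‖ = |y.2.1| ^ i * (y.2.2 : ℝ) ^ j := by
  have ha : 0 < (y.2.2 : ℝ) := y.2.2.2
  rw [monoY, Complex.norm_real, norm_mul, norm_pow, norm_zpow, Real.norm_of_nonneg ha.le,
    Real.norm_eq_abs]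

lemma rayExt_monoY_mul (i : ℕ) (j : ℤ) (Φ : Y n → ℂ) (p : E n × ℝ × ℝ) :
    rayExt (monoY i j * Φ) p = ((p.2.1 ^ i * p.2.2 ^ j : ℝ) : ℂ) * rayExt Φ p := by
  by_cases hp : p ∈ Omega n <;> simp [rayExt, hp, monoY, retract]

lemma SmoothY.monoY_mul {Φ : Y n → ℂ} (h : SmoothY Φ) (i : ℕ) (j : ℤ) :
    SmoothY (monoY i j * Φ) := by
  have h1 : ContDiffOn ℝ ∞ (fun p : E n × ℝ × ℝ => p.2.2 ^ j) (Omega n) := by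
    have h2 : ContDiff ℝ ∞ (fun p : E n × ℝ × ℝ => p.2.2) := contDiff_snd.comp contDiff_snd
    obtain ⟨k, rfl | rfl⟩ := j.eq_nat_or_neg
    · simpa only [zpow_natCast] using (h2.pow k).contDiffOn
    · simp only [zpow_neg, zpow_natCast]
      exact (h2.pow k).contDiffOn.inv fun p hp => pow_ne_zero _ hp.2.ne'
  have h3 : ContDiffOn ℝ ∞ (fun p : E n × ℝ × ℝ => p.2.1 ^ i * p.2.2 ^ j) (Omega n) :=
    ((contDiff_fst.comp contDiff_snd).pow i).contDiffOn.mul h1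
  exact ((Complex.ofRealCLM.contDiff.comp_contDiffOn h3).mul h).congr fun p _ =>
    rayExt_monoY_mul i j Φ p

lemma lapU_monoY_mul {Φ : Y n → ℂ} (h : SmoothY Φ) (i : ℕ) (j : ℤ) :
    lapU (monoY i j * Φ) = monoY i j * lapU Φ := by
  funext y
  simp only [lapU, rayExt_monoY_mul, Pi.mul_apply]
  exact InnerProductSpace.laplacian_smul (monoY i j y) (h.contDiffAt_slice y)

lemma iterate_lapU_monoY_mul (k : ℕ) {Φ : Y n → ℂ} (h : SmoothY Φ) (i : ℕ) (j : ℤ) :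
    lapU^[k] (monoY i j * Φ) = monoY i j * lapU^[k] Φ := by
  induction k with
  | zero => rfl
  | succ k ih =>
    rw [Function.iterate_succ_apply', ih, lapU_monoY_mul ((iterate_lapU k).1 h),
      Function.iterate_succ_apply']

section Family

variable {V : Type*} [AddCommGroup V] [Module ℂ V] [TopologicalSpace V]

/-- Families of smooth functions on `𝕐ⁿ⁺¹` which decay rapidly together with all their spherical
Laplacians, with bounds given by continuous seminorms. -/
def SmoothDecay (T : V → Y n → ℂ) : Prop :=
  (∀ v, SmoothY (T v)) ∧ ∀ k s r, SeminormBdd fun v y => wt s r y * ‖lapU^[k] (T v) y‖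

lemma SmoothDecay.decayFamily {T : V → Y n → ℂ} (hT : SmoothDecay T) : DecayFamily T :=
  ⟨fun v => (hT.1 v).continuous, hT.2 0⟩

lemma SmoothDecay.lapU {T : V → Y n → ℂ} (hT : SmoothDecay T) :
    SmoothDecay fun v => lapU (T v) :=
  ⟨fun v => (hT.1 v).lapU, fun k => hT.2 (k + 1)⟩

lemma SmoothDecay.monoY_mul {T : V → Y n → ℂ} (hT : SmoothDecay T) (i : ℕ) (j : ℤ) :
    SmoothDecay fun v => monoY i j * T v := by
  refine ⟨fun v => (hT.1 v).monoY_mul i j, fun k s r => ?_⟩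
  refine ((hT.2 k (s + j.natAbs) (r + i)).const_mul (C := 2) (by positivity)).mono fun v y => ?_
  have ha : 0 < (y.2.2 : ℝ) := y.2.2.2
  simp only [iterate_lapU_monoY_mul k (hT.1 v), Pi.mul_apply, norm_mul, norm_monoY]
  calc _ = wt s r y * |y.2.1| ^ i * (y.2.2 : ℝ) ^ j * ‖Ridgelet.lapU^[k] (T v) y‖ := by ring
    _ ≤ wt s (r + i) y * (y.2.2 : ℝ) ^ j * ‖Ridgelet.lapU^[k] (T v) y‖ := by
        gcongr
        exact wt_mul_abs_pow_le s r i y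
    _ ≤ 2 * wt (s + j.natAbs) (r + i) y * ‖Ridgelet.lapU^[k] (T v) y‖ := by
        gcongr ?_ * ?_
        exact wt_mul_zpow_le s (r + i) j y
    _ = _ := by ring

lemma smoothDecay_coe (n : ℕ) : SmoothDecay fun Φ : SchwartzY n => (Φ : Y n → ℂ) := by
  -- The index is `2 * r` because the seminorm carries `(1 + b²) ^ (r / 2)` and `wt` carries `(1 +
  -- b²) ^ r`.
  refine ⟨fun Φ => Φ.smoothY, fun k s r => ⟨SchwartzY.rho s (2 * r) 0 0 k, ?_, fun Φ y => ?_⟩⟩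
  · exact (SchwartzY.withSeminorms n).continuous_seminorm (s, 2 * r, 0, 0, k)
  · refine le_of_eq_of_le ?_ (le_ciSup (Φ.bddAbove s (2 * r) 0 0 k) y)
    simp only [weighted, wt]
    congr 2
    push_cast
    rw [mul_div_cancel_left₀ _ two_ne_zero, Real.rpow_natCast]

/-! ### Decay of the synthesis integral -/

lemma sphRidge_eq (Ψ : 𝓢(ℝ, ℂ)) (z : E n) (y : Y n) :
    sphRidge Ψ z y.2.1 y.2.2 (y.1 : E n) = Ψ (phase z y) := by
  simp [sphRidge, phase]

/-- Fubini with the sphere as the inner integral, and Green's formula for each fixed `(b, a)`. -/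
lemma integral_mul_lapU (hn : n ≠ 0) {Φ Θ : Y n → ℂ} {G : ℝ → ℝ → E n → ℂ} {J : Y n → ℂ}
    (hΦ : SmoothY Φ) (hG : ∀ b a, ContDiffOn ℝ ∞ (G b a) {0}ᶜ)
    (hG0 : ∀ b a (c : ℝ), 0 < c → ∀ x, G b a (c • x) = G b a x)
    (hΘ : ∀ y, Θ y = G y.2.1 y.2.2 (y.1 : E n))
    (hJ : ∀ y, J y = Laplacian.laplacian (G y.2.1 y.2.2) (y.1 : E n))
    (h1 : Integrable (fun y => Φ y * J y) (measY n))
    (h2 : Integrable (fun y => lapU Φ y * Θ y) (measY n)) :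
    ∫ y, Φ y * J y ∂(measY n) = ∫ y, lapU Φ y * Θ y ∂(measY n) := by
  rw [measY] at h1 h2 ⊢
  rw [integral_prod_symm _ h1, integral_prod_symm _ h2]
  refine integral_congr_ae (Filter.Eventually.of_forall fun q => ?_)
  have := integral_sphere_mul_laplacian_comm hn (hΦ.contDiffOn_slice q.1 q.2.2)
    (fun c hc x => rayExt_ray Φ q.1 q.2 hc x) (hG q.1 q.2) (hG0 q.1 q.2)
  simp only [hJ, hΘ]
  refine Eq.trans ?_ this
  refine integral_congr_ae (Filter.Eventually.of_forall fun u => ?_)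
  have := rayExt_incl Φ (u, q)
  simp only [incl] at this
  simp only [this]

/-- Substitute `z · u = a t + b` in `laplacian_sphRidge` and collect the coefficients of `a²`, `ab`
and `b²`; the first term is `a² Δ_u Ψ(t)` after Green's formula. No `z` remains outside the
profiles, and these are again in `𝓢₀(ℝ)` when `Ψ` is. -/
lemma norm_sq_smul_synth (hn : n ≠ 0) {T : V → Y n → ℂ} (hT : SmoothDecay T) (Ψ : 𝓢(ℝ, ℂ)) (v : V)
    (z : E n) :
    (‖z‖ ^ 2 : ℝ) • synth (sderiv (sderiv Ψ)) (T v) z =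
      synth Ψ (monoY 0 2 * lapU (T v)) z +
      synth (smulVar (smulVar (sderiv (sderiv Ψ))) + ((n : ℂ) - 1) • smulVar (sderiv Ψ))
        (monoY 0 2 * T v) z +
      synth ((2 : ℂ) • smulVar (sderiv (sderiv Ψ)) + ((n : ℂ) - 1) • sderiv Ψ)
        (monoY 1 1 * T v) z +
      synth (sderiv (sderiv Ψ)) (monoY 2 0 * T v) z := by
  set ψ := sderiv (sderiv Ψ)
  set χ₁ := smulVar (smulVar ψ) + ((n : ℂ) - 1) • smulVar (sderiv Ψ)
  set χ₂ := (2 : ℂ) • smulVar ψ + ((n : ℂ) - 1) • sderiv Ψ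
  have i0 := (hT.decayFamily.rapidDecay v).integrable_synth ψ z
  have i1 := ((hT.monoY_mul 0 2).decayFamily.rapidDecay v).integrable_synth χ₁ z
  have i2 := ((hT.monoY_mul 1 1).decayFamily.rapidDecay v).integrable_synth χ₂ z
  have i3 := ((hT.monoY_mul 2 0).decayFamily.rapidDecay v).integrable_synth ψ z
  have i4 := ((hT.monoY_mul 0 2).lapU.decayFamily.rapidDecay v).integrable_synth Ψ z
  have i0' := i0.const_mul ((‖z‖ ^ 2 : ℝ) : ℂ)
  simp only [Pi.mul_apply] at i1 i2 i3
  have i01 := i0'.sub i1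
  simp only [Pi.sub_def] at i01
  have i012 := i01.sub i2
  simp only [Pi.sub_def] at i012
  have hJ : ∀ y : Y n, (monoY 0 2 y * T v y) *
      Laplacian.laplacian (sphRidge Ψ z y.2.1 y.2.2) (y.1 : E n) =
      ((‖z‖ ^ 2 : ℝ) : ℂ) * (T v y * ψ (phase z y)) -
        (monoY 0 2 y * T v y) * χ₁ (phase z y) - (monoY 1 1 y * T v y) * χ₂ (phase z y) -
        (monoY 2 0 y * T v y) * ψ (phase z y) := by
    intro y
    have ha := scale_ne_zero y
    have hl := laplacian_sphRidge Ψ z y.2.1 ha (norm_eq_of_mem_sphere y.1)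
    have hs : inner ℝ z (y.1 : E n) = (y.2.2 : ℝ) * phase z y + y.2.1 := by
      rw [phase, mul_div_cancel₀ _ ha, sub_add_cancel]
    rw [sphRidge_eq, sphRidge_eq, hs] at hl
    have e : (monoY 0 2 y * T v y) * Laplacian.laplacian (sphRidge Ψ z y.2.1 y.2.2) (y.1 : E n) =
        T v y * (((y.2.2 : ℝ) : ℂ) ^ 2 *
          Laplacian.laplacian (sphRidge Ψ z y.2.1 y.2.2) (y.1 : E n)) := by
      rw [monoY, pow_zero, one_mul, zpow_ofNat]
      push_cast
      ring
    rw [e, hl]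
    simp only [χ₁, χ₂, add_apply, smul_apply, smulVar_apply, smul_eq_mul,
      monoY]
    rw [zpow_ofNat, zpow_one, zpow_zero]
    push_cast
    ring
  have hint : Integrable (fun y => (monoY 0 2 y * T v y) *
      Laplacian.laplacian (sphRidge Ψ z y.2.1 y.2.2) (y.1 : E n)) (measY n) := by
    simp only [hJ]
    exact i012.sub i3
  have key := integral_mul_lapU hn ((hT.1 v).monoY_mul 0 2)
    (G := fun b a => sphRidge Ψ z b a) (Θ := fun y => Ψ (phase z y))
    (fun b a => contDiffOn_sphRidge Ψ z b a) (fun b a c hc x => sphRidge_smul Ψ z b a c hc x)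
    (fun y => (sphRidge_eq Ψ z y).symm) (fun y => rfl) hint i4
  simp only [Pi.mul_apply, hJ] at key
  rw [integral_sub i012 i3, integral_sub i01 i2, integral_sub i0' i1,
    integral_const_mul] at key
  rw [lapU_monoY_mul (hT.1 v)] at key
  simp only [synth, Complex.real_smul, Pi.mul_apply] at key ⊢
  rw [← key]
  ring

end Family

end

/-! ### Weighted derivative bounds for the synthesis integral -/

section

variable {n : ℕ}

section Family

variable {V : Type*} [AddCommGroup V] [Module ℂ V] [TopologicalSpace V]

lemma norm_iteratedFDeriv_add_le {f g : E n → ℂ} (hf : ContDiff ℝ ∞ f) (hg : ContDiff ℝ ∞ g)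
    (m : ℕ) (x : E n) :
    ‖iteratedFDeriv ℝ m (f + g) x‖ ≤ ‖iteratedFDeriv ℝ m f x‖ + ‖iteratedFDeriv ℝ m g x‖ := by
  rw [iteratedFDeriv_add_apply (hf.of_le (by exact_mod_cast le_top)).contDiffAt
    (hg.of_le (by exact_mod_cast le_top)).contDiffAt]
  exact norm_add_le _ _

/-- With `ψ = Ψ''`, one factor `1 + ‖x‖²` is traded for a sum of five synthesis integrals. Their
families and profiles differ from `T` and `ψ`, hence the induction runs over all of them at once. -/
lemma SmoothDecay.seminormBdd_iteratedFDeriv_weight (hn : n ≠ 0) (N : ℕ) :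
    ∀ {T : V → Y n → ℂ}, SmoothDecay T → ∀ {ψ : 𝓢(ℝ, ℂ)}, ψ ∈ lizorkinReal → ∀ m,
      SeminormBdd fun v (x : E n) =>
        ‖iteratedFDeriv ℝ m (fun x => ((1 + ‖x‖ ^ 2) ^ N : ℝ) • synth ψ (T v) x) x‖ := by
  induction N with
  | zero =>
    intro T hT ψ _ m
    simpa only [pow_zero, one_smul] using hT.decayFamily.seminormBdd_iteratedFDeriv m ψ
  | succ N ih =>
    intro T hT ψ hψ m
    obtain ⟨Ψ₁, hΨ₁, rfl⟩ := exists_sderiv_eq hψ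
    obtain ⟨Ψ, hΨ, rfl⟩ := exists_sderiv_eq hΨ₁
    set χ₁ := smulVar (smulVar (sderiv (sderiv Ψ))) + ((n : ℂ) - 1) • smulVar (sderiv Ψ)
    set χ₂ := (2 : ℂ) • smulVar (sderiv (sderiv Ψ)) + ((n : ℂ) - 1) • sderiv Ψ
    have hχ₁ : χ₁ ∈ lizorkinReal := lizorkinReal.add_mem (smulVar_mem (smulVar_mem hψ))
      (lizorkinReal.smul_mem _ (smulVar_mem hΨ₁))
    have hχ₂ : χ₂ ∈ lizorkinReal := lizorkinReal.add_mem (lizorkinReal.smul_mem _ (smulVar_mem hψ))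
      (lizorkinReal.smul_mem _ hΨ₁)
    have h1 := hT.lapU.monoY_mul 0 2
    have h2 := hT.monoY_mul 0 2
    have h3 := hT.monoY_mul 1 1
    have h4 := hT.monoY_mul 2 0
    refine (((((ih hT hψ m).add (ih h1 hΨ m)).add (ih h2 hχ₁ m)).add (ih h3 hχ₂ m)).add
      (ih h4 hψ m)).mono fun v x => ?_
    have hc : ∀ {T : V → Y n → ℂ}, SmoothDecay T → ∀ ψ : 𝓢(ℝ, ℂ),
        ContDiff ℝ ∞ (fun x : E n => ((1 + ‖x‖ ^ 2) ^ N : ℝ) • synth ψ (T v) x) := fun hT ψ =>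
      ((contDiff_const.add (contDiff_norm_sq ℝ)).pow N).smul
        (contDiff_synth (hT.decayFamily.rapidDecay v) ψ)
    have e : (fun x : E n => ((1 + ‖x‖ ^ 2) ^ (N + 1) : ℝ) • synth (sderiv (sderiv Ψ)) (T v) x) =
        ((((fun x => ((1 + ‖x‖ ^ 2) ^ N : ℝ) • synth (sderiv (sderiv Ψ)) (T v) x) +
        fun x => ((1 + ‖x‖ ^ 2) ^ N : ℝ) • synth Ψ (monoY 0 2 * Ridgelet.lapU (T v)) x) +
        fun x => ((1 + ‖x‖ ^ 2) ^ N : ℝ) • synth χ₁ (monoY 0 2 * T v) x) +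
        fun x => ((1 + ‖x‖ ^ 2) ^ N : ℝ) • synth χ₂ (monoY 1 1 * T v) x) +
        fun x => ((1 + ‖x‖ ^ 2) ^ N : ℝ) • synth (sderiv (sderiv Ψ)) (monoY 2 0 * T v) x := by
      funext x
      simp only [Pi.add_apply, ← smul_add]
      rw [pow_succ, mul_smul, add_smul, one_smul, norm_sq_smul_synth hn hT Ψ v x]
      simp only [add_assoc, χ₁, χ₂]
    have c0 := hc hT (sderiv (sderiv Ψ))
    have c1 := hc h1 Ψ
    have c2 := hc h2 χ₁
    have c3 := hc h3 χ₂
    have c4 := hc h4 (sderiv (sderiv Ψ))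
    simp only [e]
    refine (norm_iteratedFDeriv_add_le (((c0.add c1).add c2).add c3) c4 m x).trans
      (add_le_add ?_ le_rfl)
    refine (norm_iteratedFDeriv_add_le ((c0.add c1).add c2) c3 m x).trans (add_le_add ?_ le_rfl)
    refine (norm_iteratedFDeriv_add_le (c0.add c1) c2 m x).trans (add_le_add ?_ le_rfl)
    exact norm_iteratedFDeriv_add_le c0 c1 m x

lemma SmoothDecay.seminormBdd_pow_mul_iteratedFDeriv (hn : n ≠ 0) {T : V → Y n → ℂ}
    (hT : SmoothDecay T) {ψ : 𝓢(ℝ, ℂ)} (hψ : ψ ∈ lizorkinReal) (k m : ℕ) :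
    SeminormBdd fun v (x : E n) => ‖x‖ ^ k * ‖iteratedFDeriv ℝ m (synth ψ (T v)) x‖ :=
  Ridgelet.seminormBdd_pow_mul_iteratedFDeriv
    (fun v => contDiff_synth (hT.decayFamily.rapidDecay v) ψ)
    (fun N m => hT.seminormBdd_iteratedFDeriv_weight hn N hψ m) k m

/-- The synthesis integral as a Schwartz function. -/
def SmoothDecay.toSchwartz (hn : n ≠ 0) {T : V → Y n → ℂ} (hT : SmoothDecay T) {ψ : 𝓢(ℝ, ℂ)}
    (hψ : ψ ∈ lizorkinReal) (v : V) : 𝓢(E n, ℂ) where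
  toFun := synth ψ (T v)
  smooth' := contDiff_synth (hT.decayFamily.rapidDecay v) ψ
  decay' k m := by
    obtain ⟨p, -, h⟩ := hT.seminormBdd_pow_mul_iteratedFDeriv hn hψ k m
    exact ⟨p v, h v⟩

lemma SmoothDecay.coe_toSchwartz (hn : n ≠ 0) {T : V → Y n → ℂ} (hT : SmoothDecay T) {ψ : 𝓢(ℝ, ℂ)}
    (hψ : ψ ∈ lizorkinReal) (v : V) : (hT.toSchwartz hn hψ v : E n → ℂ) = synth ψ (T v) := rfl

/-! ### Vanishing moments of the synthesis integral -/

/-- The moments of order less than `d` vanish. -/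
def MomentsVanish (d : ℕ) (g : 𝓢(E n, ℂ)) : Prop :=
  ∀ m : Fin n → ℕ, ∑ i, m i < d → ∫ x : E n, (∏ i, (x i : ℂ) ^ m i) * g x = 0

lemma hasLineDerivAt_monomial (m : Fin n → ℕ) (i : Fin n) (x : E n) :
    HasLineDerivAt ℝ (fun x : E n => ∏ j, (x j : ℂ) ^ m j)
      (m i * ∏ j, (x j : ℂ) ^ (m j - (Pi.single i 1 : Fin n → ℕ) j)) x (EuclideanSpace.single i (1 : ℝ)) := by
  have h1 : ∀ τ : ℝ, ∏ j, (((x + τ • EuclideanSpace.single i (1 : ℝ)) j : ℝ) : ℂ) ^ m j =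
      ((x i : ℂ) + τ) ^ m i * ∏ j ∈ Finset.univ.erase i, (x j : ℂ) ^ m j := by
    intro τ
    rw [← Finset.mul_prod_erase _ _ (Finset.mem_univ i)]
    congr 1
    · simp
    · refine Finset.prod_congr rfl fun j hj => ?_
      simp [(Finset.mem_erase.1 hj).1]
  have h2 : ∏ j, (x j : ℂ) ^ (m j - (Pi.single i 1 : Fin n → ℕ) j) =
      (x i : ℂ) ^ (m i - 1) * ∏ j ∈ Finset.univ.erase i, (x j : ℂ) ^ m j := by
    rw [← Finset.mul_prod_erase _ _ (Finset.mem_univ i)]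
    congr 1
    · simp
    · refine Finset.prod_congr rfl fun j hj => ?_
      simp [(Finset.mem_erase.1 hj).1]
  have h3 : HasDerivAt (fun τ : ℝ => (x i : ℂ) + τ) 1 (0 : ℝ) :=
    (Complex.ofRealCLM.hasDerivAt (x := (0 : ℝ))).const_add (x i : ℂ)
  have h4 := (h3.fun_pow (m i)).mul_const (∏ j ∈ Finset.univ.erase i, (x j : ℂ) ^ m j)
  rw [HasLineDerivAt]
  simp only [h1, h2]
  refine h4.congr_deriv ?_
  simp [mul_assoc]

/-- Integration by parts lowers the degree of the monomial by one. If `xᵢ` does not occur in it, the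
coefficient `m i` is zero and the truncated exponent is harmless. -/
lemma MomentsVanish.pderiv {d : ℕ} {g : 𝓢(E n, ℂ)} (h : MomentsVanish d g) (i : Fin n) :
    MomentsVanish (d + 1) (pderiv i g) := by
  intro m hm
  have hi := integrable_monomial_mul n (m - Pi.single i 1) g
  have hi' : Integrable (fun x : E n =>
      (m i * ∏ j, (x j : ℂ) ^ (m j - (Pi.single i 1 : Fin n → ℕ) j)) * g x) := by
    simpa only [mul_assoc, Pi.sub_apply] using hi.const_mul (m i : ℂ)
  have key := integral_bilinear_hasLineDerivAt_right_eq_neg_left_of_integrable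
    (B := ContinuousLinearMap.mul ℝ ℂ) (v := EuclideanSpace.single i (1 : ℝ)) (g := g)
    (g' := Ridgelet.pderiv i g) hi' (integrable_monomial_mul n m (Ridgelet.pderiv i g))
    (integrable_monomial_mul n m g)
    (fun x _ => hasLineDerivAt_monomial m i x)
    (fun x _ => (g.differentiable x).hasFDerivAt.hasLineDerivAt _)
  simp only [ContinuousLinearMap.mul_apply'] at key
  rw [key, neg_eq_zero]
  simp only [mul_assoc]
  rw [integral_const_mul]
  rcases Nat.eq_zero_or_pos (m i) with h0 | h0
  · simp [h0]
  · have hle : Pi.single i 1 ≤ m := by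
      intro j
      rcases eq_or_ne j i with rfl | hj
      · simpa using Nat.succ_le_of_lt h0
      · simp [hj]
    have hs : ∑ j, (m j - (Pi.single i 1 : Fin n → ℕ) j) + 1 = ∑ j, m j := by
      have e : ∑ j, (Pi.single i 1 : Fin n → ℕ) j = 1 := by simp
      nth_rewrite 2 [← e]
      rw [← Finset.sum_add_distrib]
      exact Finset.sum_congr rfl fun j _ => Nat.sub_add_cancel (hle j)
    rw [h _ (by omega), mul_zero]

lemma MomentsVanish.sum {d : ℕ} {g : Fin n → 𝓢(E n, ℂ)} (h : ∀ i, MomentsVanish d (g i)) :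
    MomentsVanish d (∑ i, g i) := by
  intro m hm
  have e : ∀ x : E n, (∏ i, (x i : ℂ) ^ m i) * (∑ i, g i) x =
      ∑ i, (∏ j, (x j : ℂ) ^ m j) * g i x := fun x => by
    rw [sum_apply, Finset.mul_sum]
  simp only [e]
  rw [integral_finsetSum _ fun i _ => integrable_monomial_mul n m (g i)]
  exact Finset.sum_eq_zero fun i _ => h i m hm

lemma sum_dirFactor_sq (y : Y n) : ∑ i, dirFactor (EuclideanSpace.single i 1) y *
    dirFactor (EuclideanSpace.single i 1) y * monoY 0 2 y = 1 := by
  have ha := scale_ne_zero y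
  have h := sum_inner_single_mul (y.1 : E n) (y.1 : E n)
  rw [real_inner_self_eq_norm_sq, norm_eq_of_mem_sphere y.1, one_pow] at h
  refine Eq.trans ?_ (congrArg ((↑) : ℝ → ℂ) h)
  rw [Complex.ofReal_sum]
  refine Finset.sum_congr rfl fun i _ => ?_
  have ha' : ((y.2.2 : ℝ) : ℂ) ≠ 0 := by exact_mod_cast ha
  rw [dirFactor, monoY, pow_zero, one_mul, zpow_ofNat]
  push_cast
  field_simp

/-- Since `|u| = 1`, the Laplacian in `z` of `Ψ(t)` is `a⁻² Ψ''(t)`; the factor `a²` put on `T`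
cancels `a⁻²`. -/
lemma SmoothDecay.toSchwartz_eq_sum (hn : n ≠ 0) {T : V → Y n → ℂ} (hT : SmoothDecay T)
    {Ψ : 𝓢(ℝ, ℂ)} (hΨ : Ψ ∈ lizorkinReal) (v : V) :
    hT.toSchwartz hn (sderiv_mem (sderiv_mem hΨ)) v =
      ∑ i, pderiv i (pderiv i ((hT.monoY_mul 0 2).toSchwartz hn hΨ v)) := by
  ext z
  rw [sum_apply, coe_toSchwartz]
  have hR : RapidDecay fun y => monoY 0 2 y * T v y :=
    (hT.monoY_mul 0 2).decayFamily.rapidDecay v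
  have h : ∀ i, pderiv i (pderiv i ((hT.monoY_mul 0 2).toSchwartz hn hΨ v)) z =
      synth (sderiv (sderiv Ψ)) (fun y => dirFactor (EuclideanSpace.single i 1) y *
        (dirFactor (EuclideanSpace.single i 1) y * (monoY 0 2 y * T v y))) z := by
    intro i
    have e : (pderiv i ((hT.monoY_mul 0 2).toSchwartz hn hΨ v) : E n → ℂ) =
        synth (sderiv Ψ) (fun y => dirFactor (EuclideanSpace.single i 1) y *
          (monoY 0 2 y * T v y)) := by
      funext x
      exact (fderiv_synth hR Ψ x).2 _
    rw [pderiv_apply, e]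
    exact (fderiv_synth (hR.dirFactor_mul _) (sderiv Ψ) z).2 _
  simp only [h, synth]
  rw [← integral_finsetSum _ fun i _ =>
    ((hR.dirFactor_mul _).dirFactor_mul _).integrable_synth _ _]
  refine integral_congr_ae (Filter.Eventually.of_forall fun y => ?_)
  have := sum_dirFactor_sq y
  calc _ = 1 * (T v y * sderiv (sderiv Ψ) (phase z y)) := by rw [one_mul]
    _ = _ := by
      rw [← this, Finset.sum_mul]
      exact Finset.sum_congr rfl fun i _ => by ring

/-- Each pair of primitives exhibits the function as one more Laplacian of a function of the same
kind. This gains two orders of vanishing, of which one suffices. -/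
lemma SmoothDecay.momentsVanish (hn : n ≠ 0) (d : ℕ) : ∀ {T : V → Y n → ℂ} (hT : SmoothDecay T)
    {ψ : 𝓢(ℝ, ℂ)} (hψ : ψ ∈ lizorkinReal) (v : V), MomentsVanish d (hT.toSchwartz hn hψ v) := by
  induction d with
  | zero => exact fun _ _ _ _ _ h => absurd h (Nat.not_lt_zero _)
  | succ d ih =>
    intro T hT ψ hψ v
    obtain ⟨Ψ₁, hΨ₁, rfl⟩ := exists_sderiv_eq hψ
    obtain ⟨Ψ, hΨ, rfl⟩ := exists_sderiv_eq hΨ₁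
    rw [hT.toSchwartz_eq_sum hn hΨ]
    intro m hm
    exact MomentsVanish.sum (fun i => ((ih (hT.monoY_mul 0 2) hΨ v).pderiv i).pderiv i) m (by omega)

lemma SmoothDecay.toSchwartz_mem (hn : n ≠ 0) {T : V → Y n → ℂ} (hT : SmoothDecay T)
    {ψ : 𝓢(ℝ, ℂ)} (hψ : ψ ∈ lizorkinReal) (v : V) : hT.toSchwartz hn hψ v ∈ lizorkin n :=
  fun m => hT.momentsVanish hn _ hψ v m (Nat.lt_succ_self _)

end Family

/-! ### The synthesis operator on `𝓢(𝕐ⁿ⁺¹)` -/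

/-- The exponent `n + 1` combines `a⁻ⁿ` from the measure with `a⁻¹` from the ridgelet. Rapid decay
makes the integrand integrable, which justifies the iterated integral. -/
lemma synthesisFun_eq_synth (ψ : 𝓢(ℝ, ℂ)) (Φ : SchwartzY n) (x : E n) :
    synthesisFun ψ Φ x = synth ψ (monoY 0 (-(n + 1 : ℤ)) * (Φ : Y n → ℂ)) x := by
  have hi := (((smoothDecay_coe n).monoY_mul 0 (-(n + 1 : ℤ))).decayFamily.rapidDecay
    Φ).integrable_synth ψ x
  have e : ∀ y : Y n, Φ y * ridgelet ψ y x / ((y.2.2 : ℝ) : ℂ) ^ n =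
      (monoY 0 (-(n + 1 : ℤ)) y * Φ y) * ψ (phase x y) := by
    intro y
    have ha : ((y.2.2 : ℝ) : ℂ) ≠ 0 := by exact_mod_cast scale_ne_zero y
    rw [ridgelet, monoY, phase, pow_zero, one_mul, Complex.ofReal_zpow, zpow_neg,
      zpow_add₀ ha, zpow_natCast, zpow_one]
    field_simp
  rw [synth]
  rw [measY] at hi ⊢
  rw [integral_prod _ hi, synthesisFun]
  refine integral_congr_ae ?_
  filter_upwards [hi.prod_right_ae] with u hu
  rw [integral_prod_symm _ hu]
  refine integral_congr_ae (Filter.Eventually.of_forall fun a => ?_)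
  exact integral_congr_ae (Filter.Eventually.of_forall fun b => e (u, b, a))

/-- `R^t_{ψ̄}` maps `𝓢(𝕐ⁿ⁺¹)` continuously to `𝓢₀(ℝⁿ)`. -/
theorem exists_synthesisCLM (hn : n ≠ 0) (ψ : lizorkinReal) :
    ∃ B : SchwartzY n →L[ℂ] lizorkin n, ∀ Φ x,
      (B Φ : 𝓢(E n, ℂ)) x = synthesisFun (conjFun (ψ : 𝓢(ℝ, ℂ))) Φ x := by
  -- The synthesis operator involves no conjugation of its own, so the profile really is `ψ̄`.
  have hψ := conjSchwartz_mem ψ.2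
  set χ := conjSchwartz (ψ : 𝓢(ℝ, ℂ)) with hχ
  have hT := (smoothDecay_coe n).monoY_mul 0 (-(n + 1 : ℤ))
  let B₀ : SchwartzY n →ₗ[ℂ] 𝓢(E n, ℂ) :=
    { toFun := hT.toSchwartz hn hψ
      map_add' := fun Φ Φ' => by
        ext x
        rw [add_apply]
        simp only [SmoothDecay.coe_toSchwartz, SchwartzY.coe_add, mul_add]
        rw [synth_add (hT.decayFamily.rapidDecay Φ) (hT.decayFamily.rapidDecay Φ')]
        rfl
      map_smul' := fun c Φ => by
        ext x
        rw [smul_apply]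
        simp only [SmoothDecay.coe_toSchwartz, SchwartzY.coe_smul, mul_smul_comm, synth_smul]
        rfl }
  have hB₀ : Continuous B₀ := by
    rw [(schwartz_withSeminorms ℂ (E n) ℂ).continuous_iff_continuous_comp]
    rintro ⟨k, m⟩
    obtain ⟨p, hp, h⟩ := hT.seminormBdd_pow_mul_iteratedFDeriv hn hψ k m
    exact Seminorm.continuous_of_le hp fun Φ =>
      SchwartzMap.seminorm_le_bound ℂ k m _ (apply_nonneg p Φ) fun x => h Φ x
  refine ⟨(⟨B₀, hB₀⟩ : SchwartzY n →L[ℂ] 𝓢(E n, ℂ)).codRestrict (lizorkin n)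
    fun Φ => hT.toSchwartz_mem hn hψ Φ, fun Φ x => ?_⟩
  rw [← coe_conjSchwartz, synthesisFun_eq_synth]
  rfl

end

end Ridgelet

end

/-! ### Transposition to distributions -/

theorem proposition5p3 (n : ℕ) (hn : 2 ≤ n) (ψ : Ridgelet.lizorkinReal) :
    (∃ T : Ridgelet.LizorkinDist n →L[ℂ] Ridgelet.DistY n,
      Ridgelet.IsRidgeletTransform (ψ : 𝓢(ℝ, ℂ)) T) ∧
    (∃ T : Ridgelet.DistY n →L[ℂ] Ridgelet.LizorkinDist n,
      Ridgelet.IsRidgeletSynthesis (ψ : 𝓢(ℝ, ℂ)) T) := by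
  obtain ⟨A, hA⟩ := Ridgelet.exists_ridgeletCLM n ψ
  obtain ⟨B, hB⟩ := Ridgelet.exists_synthesisCLM (n := n) (by omega) ψ
  -- A continuous linear map sends bounded sets to bounded sets, so precomposition with it is
  -- continuous for uniform convergence on bounded sets.
  exact ⟨⟨ContinuousLinearMap.precomp ℂ B, fun Φ => ⟨B Φ, hB Φ, fun _ => rfl⟩⟩,
    ⟨ContinuousLinearMap.precomp ℂ A, fun φ => ⟨A φ, hA φ, fun _ => rfl⟩⟩⟩
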